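/- Let $n\ge 1$ and let $T^{n+1}=(S^1)^{n+1}$ act on $S^{2n+1}\subset\mathbb C^{n+1}$ by coordinatewise multiplication. Let $\Delta^n$ be the $n$-simplex with facets $E_j=\{x_j=0\}$, $0\le j\le n$. (a) Let $\xi$ be a function assigning to each facet $E_j$ a vector $\xi_j\in\mathbb Z^{n+1}$ such that any $n$ of the vectors $\xi_0,\dots,\xi_n$ span a direct summand of $\mathbb Z^{n+1}$ of rank $n$ (a hyper characteristic function on $\Delta^n$), and assume that $\xi_0,\dots,\xi_n$ span a submodule of rank $n+1$. Let $\Lambda_\xi\colon T^{n+1}\to T^{n+1}$, $t\mapsto\prod_j t_j^{\xi_j}$ (where $s^{v}=(s^{v^{(0)}},\dots,s^{v^{(n)}})$ for $s\in S^1$ and $v=(v^{(0)},\dots,v^{(n)})\in\mathbb Z^{n+1}$), and let $G_\xi=\ker\Lambda_\xi$, a finite group acting freely on $S^{2n+1}$. The generalized lens space $S^{2n+1}/G_\xi$ is a smooth manifold, with charts induced from those of $S^{2n+1}$, on which $T^{n+1}\cong T^{n+1}/G_\xi$ acts by $\Lambda_\xi(t)\cdot[z]=[tz]$. It is $T^{n+1}$-equivariantly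 homeomorphic to $N(\Delta^n,\xi)=(T^{n+1}\times\Delta^n)/\!\sim$, where $(t,x)\sim(s,y)$ iff $x=y$ and $t^{-1}s\in\exp(\langle\xi_j : x\in E_j\rangle\otimes\mathbb R)$, with $T^{n+1}$ acting by multiplication on the first factor. Moreover $S^{2n+1}/G_\xi$ is equivariantly the boundary of an oriented smooth manifold: there are a compact oriented smooth manifold with boundary $M$ of dimension $2n+2$ with a smooth $T^{n+1}$-action and a $T^{n+1}$-equivariant diffeomorphism from $S^{2n+1}/G_\xi$ onto $\partial M$. (b) Let $p>1$ be an integer and let $q_1,\dots,q_n$ be integers prime to $p$. The classical lens space $L(p;q_1,\dots,q_n)=S^{2n+1}/\mathbb Z_p$, where $g\cdot(z_0,\dots,z_n)=(gz_0,g^{q_1}z_1,\dots,g^{q_n}z_n)$ for $g\in\mathbb Z_p=\{g\in S^1: g^p=1\}$, is a smooth manifold, with charts induced from those of $S^{2n+1}$, and there are $\xi$ as in (a) and a diffeomorphism $\Phi\colon L(p;q_1,\dots,q_n)\to S^{2n+1}/G_\xi$ with $\Phi([tz])=\Lambda_\xi(t)\cdot\Phi([z])$ for all $t\in T^{n+1}$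 and $z\in S^{2n+1}$. With the $T^{n+1}$-action $t\cdot[z]=[tz]$, the lens space $L(p;q_1,\dots,q_n)$ is likewise equivariantly the boundary of a compact oriented smooth $T^{n+1}$-manifold of dimension $2n+2$. -/

import Mathlib

open scoped Manifold ContDiff

namespace GenLens

noncomputable section

/-! ### The torus and its standard action on the odd sphere -/

/-- The compact torus `T^{n+1} = (S¹)^{n+1}`. -/
abbrev Torus (n : ℕ) : Type := Fin (n + 1) → Circle

/-- The Lie group structure of the torus is the product one. -/
abbrev torusModel (n : ℕ) := ModelWithCorners.pi (fun _ : Fin (n + 1) => 𝓡 1)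

/-- The unit sphere `S^{2n+1}` in `ℂ^{n+1}`. -/
abbrev OddSphere (n : ℕ) : Type := Metric.sphere (0 : EuclideanSpace ℂ (Fin (n + 1))) 1

instance finrankFact (n : ℕ) :
    Fact (Module.finrank ℝ (EuclideanSpace ℂ (Fin (n + 1))) = 2 * n + 1 + 1) :=
  ⟨by
    rw [← Module.finrank_mul_finrank ℝ ℂ (EuclideanSpace ℂ (Fin (n + 1)))]
    simp [Complex.finrank_real_complex]
    ring⟩

/-- Coordinatewise multiplication `(t₀z₀, …, tₙzₙ)`. -/
def rotate {n : ℕ} (t : Torus n) (z : EuclideanSpace ℂ (Fin (n + 1))) :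
    EuclideanSpace ℂ (Fin (n + 1)) :=
  WithLp.toLp 2 fun i => (t i : ℂ) * z i

theorem norm_rotate {n : ℕ} (t : Torus n) (z : EuclideanSpace ℂ (Fin (n + 1))) :
    ‖rotate t z‖ = ‖z‖ := by
  simp only [EuclideanSpace.norm_eq, rotate, norm_mul, Circle.norm_coe, one_mul]

/-- The standard action of `T^{n+1}` on `S^{2n+1}`. -/
instance sphereAction (n : ℕ) : MulAction (Torus n) (OddSphere n) where
  smul t z := ⟨rotate t z.1, by
    have := z.2
    rw [mem_sphere_zero_iff_norm] at this ⊢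
    rw [norm_rotate, this]⟩
  one_smul z := by
    apply Subtype.ext
    ext i
    change ((1 : Circle) : ℂ) * z.1 i = z.1 i
    simp
  mul_smul s t z := by
    apply Subtype.ext
    ext i
    change ((s i * t i : Circle) : ℂ) * z.1 i = (s i : ℂ) * ((t i : ℂ) * z.1 i)
    simp [mul_assoc]

theorem smul_coord {n : ℕ} (t : Torus n) (z : OddSphere n) (i : Fin (n + 1)) :
    (t • z).1 i = (t i : ℂ) * z.1 i := rfl

instance sphereContinuousConstSMul (n : ℕ) : ContinuousConstSMul (Torus n) (OddSphere n) where
  continuous_const_smul t := by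
    apply Continuous.subtype_mk
    unfold rotate
    fun_prop

instance subgroupContinuousConstSMul {n : ℕ} (H : Subgroup (Torus n)) :
    ContinuousConstSMul H (OddSphere n) where
  continuous_const_smul t := continuous_const_smul (t : Torus n)

theorem exists_coord_ne_zero {n : ℕ} (z : OddSphere n) : ∃ i, z.1 i ≠ 0 := by
  by_contra! h
  have h0 : z.1 = 0 := by
    ext i
    simpa using h i
  have := z.2
  rw [mem_sphere_zero_iff_norm, h0] at this
  simp at this

/-- An element of the torus that fixes a point with nonzero `i`-th coordinate has `tᵢ = 1`. -/
theorem coord_eq_one {n : ℕ} {t : Torus n} {z : OddSphere n} (h : t • z = z) {i : Fin (n + 1)}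
    (hi : z.1 i ≠ 0) : t i = 1 := by
  have h1 : (t i : ℂ) * z.1 i = z.1 i := by
    rw [← smul_coord, h]
  exact Circle.ext (by simpa using mul_right_cancel₀ hi (h1.trans (one_mul _).symm))

theorem isCancelSMul_of_free {n : ℕ} (H : Subgroup (Torus n))
    (h : ∀ t ∈ H, ∀ z : OddSphere n, t • z = z → t = 1) : IsCancelSMul H (OddSphere n) where
  left_cancel' a b c hab := smul_left_cancel a hab
  right_cancel' a b c hab := by
    have h1 : (a⁻¹ * b) • c = c := by rw [mul_smul, ← hab, inv_smul_smul]
    have h2 := h _ (a⁻¹ * b).2 c h1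
    have h3 : a⁻¹ * b = 1 := Subtype.ext h2
    exact (inv_mul_eq_one.mp h3)

/-- The torus action on the orbit space of a subgroup `H`: `t • [z] = [t • z]`. -/
@[reducible] def quotientAction {n : ℕ} (H : Subgroup (Torus n)) :
    MulAction (Torus n) (MulAction.orbitRel.Quotient H (OddSphere n)) where
  smul t := Quotient.map' (fun z => t • z) (by
    rintro _ b ⟨h, rfl⟩
    exact ⟨h, smul_comm (h : Torus n) t b⟩)
  one_smul x := by
    induction x using Quotient.inductionOn' with
    | h z => exact congrArg _ (one_smul _ z)
  mul_smul s t x := by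
    induction x using Quotient.inductionOn' with
    | h z => exact congrArg _ (mul_smul s t z)

/-! ### Hyper characteristic functions on the simplex -/

/-- The facet `xᵢ = 0` of the simplex `Δⁿ`. -/
def facet {n : ℕ} (i : Fin (n + 1)) : Set (stdSimplex ℝ (Fin (n + 1))) := {x | x.1 i = 0}

/-- A function from the facets of `Δⁿ` to `ℤ^{n+1}` is hyper characteristic if any `n` facets with
a common point are sent to vectors that span a rank `n` unimodular submodule, that is, a direct
summand of rank `n`. -/
def IsHyperCharacteristic {n : ℕ} (ξ : Fin (n + 1) → Fin (n + 1) → ℤ) : Prop :=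
  ∀ s : Finset (Fin (n + 1)), s.card = n → (⋂ j ∈ s, facet (n := n) j).Nonempty →
    Module.finrank ℤ (Submodule.span ℤ (ξ '' s)) = n ∧
      ∃ W : Submodule ℤ (Fin (n + 1) → ℤ), IsCompl (Submodule.span ℤ (ξ '' s)) W

/-- The data of a generalized lens space: a hyper characteristic function on `Δⁿ` whose values
span a submodule of full rank `n + 1`. -/
structure LensCharacteristic (n : ℕ) where
  /-- `vec j` is the vector in `ℤ^{n+1}` of the facet `xⱼ = 0`. -/
  vec : Fin (n + 1) → Fin (n + 1) → ℤ
  isHyperCharacteristic : IsHyperCharacteristic vec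
  rank_eq : Module.finrank ℤ (Submodule.span ℤ (Set.range vec)) = n + 1

/-- The homomorphism of tori induced by `ξ`: it sends `t` to `∏ⱼ tⱼ ^ ξⱼ`. -/
def torusHom {n : ℕ} (ξ : Fin (n + 1) → Fin (n + 1) → ℤ) : Torus n →* Torus n where
  toFun t := fun i => ∏ j, t j ^ ξ j i
  map_one' := by
    ext i
    simp
  map_mul' s t := by
    funext i
    simp [mul_zpow, Finset.prod_mul_distrib]

namespace LensCharacteristic

variable {n : ℕ} (ξ : LensCharacteristic n)

theorem linearIndependent : LinearIndependent ℤ ξ.vec := by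
  rw [linearIndependent_iff_card_eq_finrank_span, Set.finrank, ξ.rank_eq, Fintype.card_fin]

theorem det_ne_zero : (Matrix.of ξ.vec).det ≠ 0 := by
  intro h
  obtain ⟨v, hv, hv0⟩ := Matrix.exists_vecMul_eq_zero_iff.mpr h
  refine hv (funext fun j => Fintype.linearIndependent_iff.mp ξ.linearIndependent v ?_ j)
  rw [← hv0]
  ext i
  simp [Matrix.vecMul, dotProduct]

theorem torusHom_surjective : Function.Surjective (torusHom ξ.vec) := by
  intro s
  choose θ hθ using fun i => (⟨_, Circle.exp_arg (s i)⟩ : ∃ r, Circle.exp r = s i)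
  let A : Matrix (Fin (n + 1)) (Fin (n + 1)) ℝ := (Matrix.of ξ.vec).map (Int.castRingHom ℝ)
  have hA : IsUnit A.det := by
    have h : A.det = ((Matrix.of ξ.vec).det : ℝ) := (RingHom.map_det _ _).symm
    rw [isUnit_iff_ne_zero, h]
    exact_mod_cast ξ.det_ne_zero
  let φ := Matrix.vecMul θ A⁻¹
  have hφ : Matrix.vecMul φ A = θ := by
    rw [Matrix.vecMul_vecMul, Matrix.nonsing_inv_mul _ hA, Matrix.vecMul_one]
  refine ⟨fun j => Circle.exp (φ j), funext fun i => ?_⟩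
  rw [← hθ i, ← congrFun hφ i]
  have h := map_sum Circle.expHom (fun j => φ j * A j i) Finset.univ
  have h2 : ∀ j, Circle.exp (φ j * A j i) = Circle.exp (φ j) ^ ξ.vec j i := by
    intro j
    have h3 := map_zsmul Circle.expHom (ξ.vec j i) (φ j)
    have h4 : φ j * A j i = ξ.vec j i • φ j := by
      simp [A, mul_comm]
    rw [h4]
    exact congrArg Additive.toMul h3
  change ∏ j, Circle.exp (φ j) ^ ξ.vec j i = Circle.exp (∑ j, φ j * A j i)
  simp only [← h2]
  exact (congrArg Additive.toMul h).symm

theorem prod_torusHom_zpow (t : Torus n) (c : Fin (n + 1) → ℤ) :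
    ∏ i, torusHom ξ.vec t i ^ c i = ∏ j, t j ^ ∑ i, ξ.vec j i * c i := by
  change ∏ i, (∏ j, t j ^ ξ.vec j i) ^ c i = _
  simp only [← Finset.prod_zpow, ← zpow_mul]
  rw [Finset.prod_comm]
  refine Finset.prod_congr rfl fun j _ => ?_
  induction (Finset.univ : Finset (Fin (n + 1))) using Finset.induction_on with
  | empty => simp
  | insert a u ha ih => rw [Finset.prod_insert ha, Finset.sum_insert ha, zpow_add, ih]

/-- The finite group `G_ξ`, the kernel of the homomorphism of tori induced by `ξ`. -/
def group : Subgroup (Torus n) := (torusHom ξ.vec).ker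

theorem prod_zpow_eq_one {t : Torus n} (ht : t ∈ ξ.group) (c : Fin (n + 1) → ℤ) :
    ∏ j, t j ^ ∑ i, ξ.vec j i * c i = 1 := by
  have h1 : torusHom ξ.vec t = 1 := ht
  rw [← prod_torusHom_zpow, h1]
  simp

instance finite_group : Finite ξ.group := by
  have hd := ξ.det_ne_zero
  set d := (Matrix.of ξ.vec).det with hdef
  have hfin : {x : Circle | x ^ d.natAbs = 1}.Finite := by
    have h1 : ({x : ℂ | x ^ d.natAbs = 1}).Finite := by
      refine ((Polynomial.nthRoots d.natAbs (1 : ℂ)).toFinset.finite_toSet).subset fun x hx => ?_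
      simpa [Polynomial.mem_nthRoots (Int.natAbs_pos.mpr hd)] using hx
    refine Set.Finite.subset
      (h1.preimage (f := fun x : Circle => (x : ℂ)) Circle.coe_injective.injOn) fun x hx => ?_
    have h2 : x ^ d.natAbs = 1 := hx
    change (x : ℂ) ^ d.natAbs = 1
    rw [← Circle.coe_pow, h2, Circle.coe_one]
  have hpi : {t : Torus n | ∀ k, t k ^ d.natAbs = 1}.Finite := by
    have := Set.Finite.pi' (fun _ : Fin (n + 1) => hfin)
    exact this
  refine (hpi.subset fun t ht k => ?_).to_subtype
  have h1 := ξ.prod_zpow_eq_one ht (fun i => (Matrix.of ξ.vec).adjugate i k)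
  have h2 : ∀ j, ∑ i, ξ.vec j i * (Matrix.of ξ.vec).adjugate i k = if j = k then d else 0 := by
    intro j
    have h3 := congrFun (congrFun (Matrix.mul_adjugate (Matrix.of ξ.vec)) j) k
    rw [Matrix.mul_apply] at h3
    simpa [Matrix.one_apply] using h3
  have h4 : t k ^ d = 1 := by
    rw [← h1, Finset.prod_eq_single k]
    · rw [h2, if_pos rfl]
    · intro j _ hj
      rw [h2, if_neg hj, zpow_zero]
    · simp
  rcases Int.natAbs_eq d with h5 | h5
  · rw [h5, zpow_natCast] at h4
    exact h4
  · rw [h5, zpow_neg, zpow_natCast, inv_eq_one] at h4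
    exact h4

theorem exists_dual (i k : Fin (n + 1)) (hk : k ≠ i) :
    ∃ c : Fin (n + 1) → ℤ, ∀ j, j ≠ i → ∑ m, ξ.vec j m * c m = if j = k then 1 else 0 := by
  classical
  let s : Finset (Fin (n + 1)) := Finset.univ.erase i
  have hs : s.card = n := by simp [s]
  have hne : (⋂ j ∈ s, facet (n := n) j).Nonempty := by
    refine ⟨⟨Pi.single i 1, single_mem_stdSimplex ℝ i⟩, ?_⟩
    simp only [Set.mem_iInter]
    intro j hj
    exact Pi.single_eq_of_ne (Finset.ne_of_mem_erase hj) 1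
  obtain ⟨-, W, hW⟩ := ξ.isHyperCharacteristic s hs hne
  let v : s → Fin (n + 1) → ℤ := fun j => ξ.vec j
  have hv : LinearIndependent ℤ v := ξ.linearIndependent.comp _ Subtype.val_injective
  have hr : ξ.vec '' s = Set.range v := by
    ext x
    simp [v]
  rw [hr] at hW
  let f : (Fin (n + 1) → ℤ) →ₗ[ℤ] ℤ :=
    (Finsupp.lapply ⟨k, by simp [s, hk]⟩).comp
      (hv.repr.comp (Submodule.projectionOnto _ _ hW))
  refine ⟨fun m => f (Pi.single m 1), fun j hj => ?_⟩
  have hfs : f (ξ.vec j) = ∑ m, ξ.vec j m * f (Pi.single m 1) := by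
    conv_lhs => rw [← Finset.univ_sum_single (ξ.vec j), map_sum]
    refine Finset.sum_congr rfl fun m _ => ?_
    rw [← smul_eq_mul, ← map_smul, ← Pi.single_smul, smul_eq_mul, mul_one]
  rw [← hfs]
  let j' : s := ⟨j, by simp [s, hj]⟩
  have h1 : Submodule.projectionOnto _ _ hW (ξ.vec j) =
      ⟨v j', Submodule.subset_span ⟨j', rfl⟩⟩ :=
    Submodule.projectionOnto_apply_left hW ⟨v j', Submodule.subset_span ⟨j', rfl⟩⟩
  change hv.repr (Submodule.projectionOnto _ _ hW (ξ.vec j)) _ = _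
  rw [h1, hv.repr_eq_single j' _ rfl, Finsupp.single_apply]
  simp [j']

theorem free : ∀ t ∈ ξ.group, ∀ z : OddSphere n, t • z = z → t = 1 := by
  intro t ht z hz
  obtain ⟨i, hi⟩ := exists_coord_ne_zero z
  have hti := coord_eq_one hz hi
  funext k
  by_cases hk : k = i
  · rw [hk, hti]
    rfl
  obtain ⟨c, hc⟩ := ξ.exists_dual i k hk
  have h := ξ.prod_zpow_eq_one ht c
  rw [Finset.prod_eq_single k] at h
  · rwa [hc k hk, if_pos rfl, zpow_one] at h
  · intro j _ hj
    by_cases hji : j = i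
    · rw [hji, hti, one_zpow]
    · rw [hc j hji, if_neg hj, zpow_zero]
  · simp

instance isCancelSMul : IsCancelSMul ξ.group (OddSphere n) := isCancelSMul_of_free _ ξ.free

/-- The generalized lens space `S^{2n+1} / G_ξ`. -/
def LensSpace : Type := MulAction.orbitRel.Quotient ξ.group (OddSphere n)

instance : TopologicalSpace ξ.LensSpace :=
  inferInstanceAs (TopologicalSpace (MulAction.orbitRel.Quotient ξ.group (OddSphere n)))

/-- The charts are those of the sphere, composed with local inverses of the covering
`S^{2n+1} → S^{2n+1} / G_ξ`. -/
instance : ChartedSpace (EuclideanSpace ℝ (Fin (2 * n + 1))) ξ.LensSpace :=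
  inferInstanceAs (ChartedSpace (EuclideanSpace ℝ (Fin (2 * n + 1)))
    (MulAction.orbitRel.Quotient ξ.group (OddSphere n)))

/-- The class in `S^{2n+1} / G_ξ` of a point of the sphere. -/
def toLens (z : OddSphere n) : ξ.LensSpace := Quotient.mk'' z

theorem quotientAction_eq_of_torusHom_eq {s t : Torus n}
    (h : torusHom ξ.vec s = torusHom ξ.vec t) (x : ξ.LensSpace) :
    (quotientAction ξ.group).smul s x = (quotientAction ξ.group).smul t x := by
  induction x using Quotient.inductionOn' with
  | h z =>
    refine Quotient.sound' ⟨⟨s * t⁻¹, ?_⟩, ?_⟩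
    · change torusHom ξ.vec (s * t⁻¹) = 1
      rw [map_mul, map_inv, h, mul_inv_cancel]
    · change (s * t⁻¹) • (t • z) = s • z
      rw [smul_smul, inv_mul_cancel_right]

/-- The action of `T^{n+1} ≅ T^{n+1} / G_ξ` on `S^{2n+1} / G_ξ`, the isomorphism being induced by
`torusHom ξ`: an element `s = torusHom ξ t` sends `[z]` to `[t • z]`, see `torusHom_smul_toLens`. -/
instance : MulAction (Torus n) ξ.LensSpace where
  smul s x := (quotientAction ξ.group).smul (Function.surjInv ξ.torusHom_surjective s) x
  one_smul x := by
    refine (ξ.quotientAction_eq_of_torusHom_eq (t := 1) ?_ x).trans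
      ((quotientAction ξ.group).one_smul x)
    rw [Function.surjInv_eq ξ.torusHom_surjective, map_one]
  mul_smul s t x := by
    refine (ξ.quotientAction_eq_of_torusHom_eq (t := Function.surjInv ξ.torusHom_surjective s *
      Function.surjInv ξ.torusHom_surjective t) ?_ x).trans
      ((quotientAction ξ.group).mul_smul _ _ x)
    simp only [map_mul, Function.surjInv_eq ξ.torusHom_surjective]

theorem torusHom_smul_toLens (t : Torus n) (z : OddSphere n) :
    torusHom ξ.vec t • ξ.toLens z = ξ.toLens (t • z) :=
  ξ.quotientAction_eq_of_torusHom_eq (Function.surjInv_eq _ _) (ξ.toLens z)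

/-! ### The identification space `N(Δⁿ, ξ)` -/

/-- The subtorus `T_p = exp(⟨ξⱼ : p ∈ Eⱼ⟩ ⊗ ℝ)` of `T^{n+1}` belonging to a point `p` of `Δⁿ`. -/
def isotropy (p : stdSimplex ℝ (Fin (n + 1))) : Subgroup (Torus n) where
  carrier := {t | ∃ v ∈ Submodule.span ℝ {w : Fin (n + 1) → ℝ | ∃ j, p ∈ facet j ∧
    w = fun i => (ξ.vec j i : ℝ)}, t = fun i => Circle.exp (2 * Real.pi * v i)}
  one_mem' := ⟨0, Submodule.zero_mem _, by
    funext i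
    simp⟩
  mul_mem' := by
    rintro _ _ ⟨v, hv, rfl⟩ ⟨w, hw, rfl⟩
    refine ⟨v + w, Submodule.add_mem _ hv hw, ?_⟩
    funext i
    simp [mul_add, Circle.exp_add]
  inv_mem' := by
    rintro _ ⟨v, hv, rfl⟩
    refine ⟨-v, Submodule.neg_mem _ hv, ?_⟩
    funext i
    simp [Circle.exp_neg]

/-- The relation `(t, p) ∼ (s, q)` iff `p = q` and `t⁻¹ s ∈ T_p`. -/
def identification : Setoid (Torus n × stdSimplex ℝ (Fin (n + 1))) where
  r a b := a.2 = b.2 ∧ a.1⁻¹ * b.1 ∈ ξ.isotropy a.2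
  iseqv :=
    { refl := fun a => ⟨rfl, by
        rw [inv_mul_cancel]
        exact one_mem _⟩
      symm := by
        rintro ⟨t, p⟩ ⟨s, q⟩ ⟨h, h'⟩
        obtain rfl : p = q := h
        exact ⟨rfl, by simpa using inv_mem h'⟩
      trans := by
        rintro ⟨t, p⟩ ⟨s, q⟩ ⟨r, o⟩ ⟨h, h'⟩ ⟨k, k'⟩
        obtain rfl : p = q := h
        obtain rfl : p = o := k
        exact ⟨rfl, by simpa [mul_assoc] using mul_mem h' k'⟩ }

/-- The space `N(Δⁿ, ξ) = (T^{n+1} × Δⁿ) / ∼`. -/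
def IdentificationSpace : Type := Quotient ξ.identification

/-- `N(Δⁿ, ξ)` carries the quotient topology. -/
instance : TopologicalSpace ξ.IdentificationSpace :=
  inferInstanceAs (TopologicalSpace (Quotient ξ.identification))

/-- The torus acts on `N(Δⁿ, ξ)` by multiplication on the first factor. -/
instance : MulAction (Torus n) ξ.IdentificationSpace where
  smul t := Quotient.map (fun a => (t * a.1, a.2)) (by
    rintro ⟨s, p⟩ ⟨r, q⟩ ⟨h, h'⟩
    refine ⟨h, ?_⟩
    change (t * s)⁻¹ * (t * r) ∈ ξ.isotropy p
    rw [mul_inv_rev, mul_assoc, inv_mul_cancel_left]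
    exact h')
  one_smul x := by
    induction x using Quotient.inductionOn with
    | h a => exact congrArg (Quotient.mk _) (Prod.ext (one_mul a.1) rfl)
  mul_smul s t x := by
    induction x using Quotient.inductionOn with
    | h a => exact congrArg (Quotient.mk _) (Prod.ext (mul_assoc s t a.1) rfl)

end LensCharacteristic

/-! ### Classical lens spaces -/

/-- The parameters of a classical lens space `L(p; q₁, …, qₙ)`. -/
structure LensParameters (n : ℕ) where
  p : ℕ
  one_lt : 1 < p
  q : Fin n → ℤ
  coprime : ∀ i, IsCoprime (p : ℤ) (q i)

namespace LensParameters

variable {n : ℕ} (L : LensParameters n)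

/-- The image of `ℤ_p = {g : g ^ p = 1}` in the torus under `g ↦ (g, g^{q₁}, …, g^{qₙ})`. -/
def group : Subgroup (Torus n) where
  carrier := {t | ∃ g : Circle, g ^ L.p = 1 ∧ t = Fin.cons g fun i => g ^ L.q i}
  one_mem' := ⟨1, one_pow _, by
    funext i
    refine Fin.cases ?_ (fun i => ?_) i <;> simp⟩
  mul_mem' := by
    rintro _ _ ⟨g, hg, rfl⟩ ⟨h, hh, rfl⟩
    refine ⟨g * h, by rw [mul_pow, hg, hh, one_mul], ?_⟩
    funext i
    refine Fin.cases ?_ (fun i => ?_) i <;> simp [mul_zpow]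
  inv_mem' := by
    rintro _ ⟨g, hg, rfl⟩
    refine ⟨g⁻¹, by rw [inv_pow, hg, inv_one], ?_⟩
    funext i
    refine Fin.cases ?_ (fun i => ?_) i <;> simp

instance finite_group : Finite L.group := by
  have hp : 0 < L.p := zero_lt_one.trans L.one_lt
  have h1 : ({x : ℂ | x ^ L.p = 1}).Finite := by
    refine ((Polynomial.nthRoots L.p (1 : ℂ)).toFinset.finite_toSet).subset fun x hx => ?_
    simpa [Polynomial.mem_nthRoots hp] using hx
  have h2 : {x : Circle | x ^ L.p = 1}.Finite := by
    refine Set.Finite.subset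
      (h1.preimage (f := fun x : Circle => (x : ℂ)) Circle.coe_injective.injOn) fun x hx => ?_
    have h2 : x ^ L.p = 1 := hx
    change (x : ℂ) ^ L.p = 1
    rw [← Circle.coe_pow, h2, Circle.coe_one]
  refine ((h2.image fun g => (Fin.cons g fun i => g ^ L.q i : Torus n)).subset ?_).to_subtype
  rintro _ ⟨g, hg, rfl⟩
  exact ⟨g, hg, rfl⟩

theorem free : ∀ t ∈ L.group, ∀ z : OddSphere n, t • z = z → t = 1 := by
  rintro _ ⟨g, hg, rfl⟩ z hz
  have hg1 : g = 1 := by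
    obtain ⟨i, hi⟩ := exists_coord_ne_zero z
    have h := coord_eq_one hz hi
    revert h
    refine Fin.cases ?_ (fun i => ?_) i
    · exact fun h => h
    · intro h
      have h1 : g ^ L.q i = 1 := by simpa using h
      obtain ⟨a, b, hab⟩ := L.coprime i
      rw [← zpow_one g, ← hab, zpow_add, mul_comm a, mul_comm b, zpow_mul, zpow_mul, h1,
        zpow_natCast, hg, one_zpow, one_zpow, one_mul]
  subst hg1
  funext i
  refine Fin.cases ?_ (fun i => ?_) i <;> simp

instance isCancelSMul : IsCancelSMul L.group (OddSphere n) := isCancelSMul_of_free _ L.free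

/-- The lens space `L(p; q₁, …, qₙ) = S^{2n+1} / ℤ_p`. -/
def LensSpace : Type := MulAction.orbitRel.Quotient L.group (OddSphere n)

instance : TopologicalSpace L.LensSpace :=
  inferInstanceAs (TopologicalSpace (MulAction.orbitRel.Quotient L.group (OddSphere n)))

instance : ChartedSpace (EuclideanSpace ℝ (Fin (2 * n + 1))) L.LensSpace :=
  inferInstanceAs (ChartedSpace (EuclideanSpace ℝ (Fin (2 * n + 1)))
    (MulAction.orbitRel.Quotient L.group (OddSphere n)))

/-- The action `t • [z] = [t • z]` of the torus on the lens space. -/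
instance : MulAction (Torus n) L.LensSpace := quotientAction L.group

end LensParameters

/-! ### Equivariant boundaries -/

/-- A smooth manifold with boundary is orientable if it is covered by smooth charts whose
transition maps have positive Jacobian determinant. -/
def IsOrientable (d : ℕ) [NeZero d] (M : Type) [TopologicalSpace M]
    [ChartedSpace (EuclideanHalfSpace d) M] : Prop :=
  ∃ A ⊆ IsManifold.maximalAtlas (𝓡∂ d) ∞ M,
    (∀ x : M, ∃ e ∈ A, x ∈ e.source) ∧
    ∀ e ∈ A, ∀ e' ∈ A, ∀ x ∈ e.source ∩ e'.source,
      0 < (fderivWithin ℝ (e'.extend (𝓡∂ d) ∘ (e.extend (𝓡∂ d)).symm) (Set.range (𝓡∂ d))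
        (e.extend (𝓡∂ d) x)).det

/-- The smooth `(2n+1)`-dimensional `T^{n+1}`-manifold `N` is equivariantly the boundary of a
compact oriented smooth manifold: there is a compact Hausdorff orientable smooth manifold with
boundary `M` of dimension `2n+2`, with a smooth action of `T^{n+1}`, and an equivariant smooth
embedding of `N` in `M` with image `∂M`, that is, an equivariant diffeomorphism `N ≅ ∂M`. -/
def IsEquivariantBoundary (n : ℕ) (N : Type) [TopologicalSpace N]
    [ChartedSpace (EuclideanSpace ℝ (Fin (2 * n + 1))) N] [MulAction (Torus n) N] : Prop :=
  ∃ (M : Type) (_ : TopologicalSpace M) (_ : ChartedSpace (EuclideanHalfSpace (2 * n + 2)) M)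
    (_ : MulAction (Torus n) M),
    IsManifold (𝓡∂ (2 * n + 2)) ∞ M ∧ CompactSpace M ∧ T2Space M ∧
    IsOrientable (2 * n + 2) M ∧
    ContMDiffSMul (torusModel n) (𝓡∂ (2 * n + 2)) ∞ (Torus n) M ∧
    ∃ f : N → M, Manifold.IsSmoothEmbedding (𝓡 (2 * n + 1)) (𝓡∂ (2 * n + 2)) ∞ f ∧
      Set.range f = (𝓡∂ (2 * n + 2)).boundary M ∧
      ∀ (t : Torus n) (x : N), f (t • x) = t • f x

end

end GenLens

namespace GenLens

noncomputable section

/-! ### Unimodular polyhedra -/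

/-! The quotient of the unit ball of $\mathbb C^{n+1}$ by $G_\xi$ is a toric orbifold over the
truncated cone $\{\langle\xi_j,y\rangle\ge 0,\ \sum_j\langle\xi_j,y\rangle\le c\}$, and its boundary
is the lens space. Since any $n$ of the $\xi_j$ are part of a lattice basis, $G_\xi$ acts freely
away from the origin, so only the apex is singular. The manifold bounded by the lens space is a
toric resolution of this point.

The resolution takes place on the polyhedral side. The integral points of the half-open
parallelepiped of the active normals (`boxPoints`) measure the failure of these normals to be part
of a basis: the only such point is 0 exactly when they are. A nonzero one is an integral vector
$w=\sum c_kv_k$ with $0\le c_k<1$. Cutting off the face where the facets with $c_k\ne 0$ meet by a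
half space with normal $w$ exchanges some $v_k$ for $w$ and lowers the number of box points
(`ncard_boxPoints_exchange_lt`, `exists_cut`). By the hyper characteristic condition $w$ is interior
to the cone spanned by the $\xi_j$ (`exists_pos_coeff`). Hence each cut removes only a bounded
piece, and for large $c$ the level set $\sum_j\langle\xi_j,y\rangle=c$ is untouched.

The filling is the product of the torus and the resolved polytope, with the circle of $v_k$
collapsed over the facet of $v_k$. Its complex coordinates have as moduli the scaled square roots of
affine functions. Unimodular coordinate systems cover the interior, and the coordinates of the ball
modulo $G_\xi$ cover a neighbourhood of the boundary. Coordinate changes are smooth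
(`contDiffAt_change`), because a vanishing coordinate enters a single new coordinate, and linearly.
They preserve the orientation (`det_fderiv_change`), because squared moduli and phases are action
and angle variables, whose changes have constant positive Jacobian.

The homeomorphism with $N(\Delta^n,\xi)$ comes from $(\Lambda_\xi(t),x)\mapsto[t\sqrt x]$. A
classical lens space is the generalized one of $(p,-q_1,\dots,-q_n),e_1,\dots,e_n$, since $\mathbb
Z_p$ is the kernel of the corresponding homomorphism; it bounds the same filling, on which the torus
acts through $\Lambda_\xi$. -/

/-- A facet of a polyhedron in `ℝ^{n+1}`: the half space `{y | b ≤ ⟨v, y⟩}` is stored as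
`(v, b)`. -/
abbrev Facet (n : ℕ) : Type := (Fin (n + 1) → ℤ) × ℝ

/-- An integral vector regarded as a real one. -/
def realVec {n : ℕ} (v : Fin (n + 1) → ℤ) : Fin (n + 1) → ℝ := fun i => v i

/-- The pairing of an integral vector with a real one. -/
def pairing {n : ℕ} (v : Fin (n + 1) → ℤ) (y : Fin (n + 1) → ℝ) : ℝ := realVec v ⬝ᵥ y

/-- The affine function that vanishes on a facet. -/
def Facet.height {n : ℕ} (k : Facet n) (y : Fin (n + 1) → ℝ) : ℝ := pairing k.1 y - k.2

/-- The polyhedron cut out by a finite set of half spaces. -/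
def polyhedron {n : ℕ} (F : Finset (Facet n)) : Set (Fin (n + 1) → ℝ) :=
  {y | ∀ k ∈ F, 0 ≤ k.height y}

open Classical in
/-- The facets that contain a given point. -/
def activeSet {n : ℕ} (F : Finset (Facet n)) (y : Fin (n + 1) → ℝ) : Finset (Facet n) :=
  F.filter fun k => k.height y = 0

theorem mem_activeSet {n : ℕ} {F : Finset (Facet n)} {y : Fin (n + 1) → ℝ} {k : Facet n} :
    k ∈ activeSet F y ↔ k ∈ F ∧ k.height y = 0 := by
  simp [activeSet]

/-- The normal vectors of the facets in `A` are linearly independent. -/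
def IndepFacets {n : ℕ} (A : Finset (Facet n)) : Prop :=
  ∀ c : Facet n → ℝ, ∑ k ∈ A, c k • realVec k.1 = 0 → ∀ k ∈ A, c k = 0

/-- The integral points of the half-open parallelepiped spanned by the normal vectors in `A`,
given by their coefficients. -/
def boxPoints {n : ℕ} (A : Finset (Facet n)) : Set (Facet n → ℝ) :=
  {c | (∀ k ∉ A, c k = 0) ∧ (∀ k, 0 ≤ c k ∧ c k < 1) ∧
    ∃ u : Fin (n + 1) → ℤ, ∑ k ∈ A, c k • realVec k.1 = realVec u}

variable {n : ℕ}

theorem continuous_pairing (v : Fin (n + 1) → ℤ) : Continuous (pairing v) := by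
  unfold pairing dotProduct
  fun_prop

theorem continuous_height (k : Facet n) : Continuous k.height :=
  (continuous_pairing k.1).sub continuous_const

theorem isClosed_polyhedron (F : Finset (Facet n)) : IsClosed (polyhedron F) := by
  have : polyhedron F = ⋂ k ∈ F, {y | 0 ≤ k.height y} := by
    ext y
    simp [polyhedron]
  rw [this]
  exact isClosed_biInter fun k _ => isClosed_le continuous_const (continuous_height k)

theorem IndepFacets.mono {A A' : Finset (Facet n)} (h : A ⊆ A') (hA : IndepFacets A') :
    IndepFacets A := by
  classical
  intro c hc k hk
  have := hA (fun k => if k ∈ A then c k else 0) ?_ k (h hk)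
  · simpa [hk] using this
  · rw [← hc, ← Finset.sum_subset h]
    · exact Finset.sum_congr rfl fun k hk => by simp [hk]
    · intro k _ hk
      simp [hk]

theorem boxPoints_mono {A A' : Finset (Facet n)} (h : A ⊆ A') : boxPoints A ⊆ boxPoints A' := by
  rintro c ⟨h0, h1, u, hu⟩
  refine ⟨fun k hk => h0 k fun h' => hk (h h'), h1, u, ?_⟩
  rw [← hu]
  refine (Finset.sum_subset h fun k _ hk => ?_).symm
  rw [h0 k hk, zero_smul]

/-- By independence a box point is determined by its integral vector, and the entries of that vector
are bounded by the sums of the absolute values of the entries of the normals. -/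
theorem IndepFacets.finite_boxPoints {A : Finset (Facet n)} (hA : IndepFacets A) :
    (boxPoints A).Finite := by
  classical
  have hex : ∀ c : Facet n → ℝ, ∃ u : Fin (n + 1) → ℤ,
      c ∈ boxPoints A → ∑ k ∈ A, c k • realVec k.1 = realVec u := by
    intro c
    by_cases h : c ∈ boxPoints A
    · exact ⟨h.2.2.choose, fun _ => h.2.2.choose_spec⟩
    · exact ⟨0, fun h' => absurd h' h⟩
  choose U hU using hex
  refine Set.Finite.of_finite_image (f := U) ?_ ?_
  · refine (Set.finite_Icc (fun i => -∑ k ∈ A, |k.1 i|) (fun i => ∑ k ∈ A, |k.1 i|)).subset ?_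
    rintro _ ⟨c, hc, rfl⟩
    have key : ∀ i, |U c i| ≤ ∑ k ∈ A, |k.1 i| := by
      intro i
      have h1 := congrFun (hU c hc) i
      have h2 : |((U c i : ℤ) : ℝ)| ≤ ((∑ k ∈ A, |k.1 i| : ℤ) : ℝ) := by
        change _ = ((U c i : ℤ) : ℝ) at h1
        rw [← h1, Finset.sum_apply]
        push_cast
        refine (Finset.abs_sum_le_sum_abs _ _).trans (Finset.sum_le_sum fun k _ => ?_)
        simp only [Pi.smul_apply, realVec, smul_eq_mul, abs_mul]
        rw [abs_of_nonneg (hc.2.1 k).1]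
        exact mul_le_of_le_one_left (abs_nonneg _) (hc.2.1 k).2.le
      exact_mod_cast h2
    exact ⟨fun i => (abs_le.mp (key i)).1, fun i => (abs_le.mp (key i)).2⟩
  · intro c hc d hd hcd
    have h1 : ∑ k ∈ A, (c k - d k) • realVec k.1 = 0 := by
      simp only [sub_smul, Finset.sum_sub_distrib]
      rw [hU c hc, hU d hd, hcd, sub_self]
    funext k
    by_cases hk : k ∈ A
    · exact sub_eq_zero.mp (hA (fun k => c k - d k) h1 k hk)
    · rw [hc.1 k hk, hd.1 k hk]

/-- Substituting $w=\sum c_kv_k$ turns coefficients for the exchanged set into coefficients for `A`;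
at `k₀` only the contribution of `w` remains. -/
theorem sum_insert_erase_facets [DecidableEq (Facet n)] {A : Finset (Facet n)} {c : Facet n → ℝ}
    {w : Fin (n + 1) → ℤ}
    (hw : ∑ k ∈ A, c k • realVec k.1 = realVec w) {k₀ : Facet n} (hk₀ : k₀ ∈ A) {b : ℝ}
    (hb : (w, b) ∉ A) (d : Facet n → ℝ) :
    ∑ k ∈ insert (w, b) (A.erase k₀), d k • realVec k.1 =
      ∑ k ∈ A, ((if k = k₀ then 0 else d k) + d (w, b) * c k) • realVec k.1 := by
  rw [Finset.sum_insert (fun h => hb (Finset.mem_of_mem_erase h))]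
  simp only [add_smul, mul_smul, Finset.sum_add_distrib]
  rw [← Finset.smul_sum, hw, add_comm (d (w, b) • realVec w), ← Finset.add_sum_erase A _ hk₀]
  simp only [if_true, zero_smul, zero_add]
  congr 1
  refine Finset.sum_congr rfl fun k hk => ?_
  rw [if_neg (Finset.ne_of_mem_erase hk)]

theorem IndepFacets.exchange [DecidableEq (Facet n)] {A : Finset (Facet n)} (hA : IndepFacets A)
    {c : Facet n → ℝ} {w : Fin (n + 1) → ℤ} (hw : ∑ k ∈ A, c k • realVec k.1 = realVec w)
    {k₀ : Facet n} (hk₀ : k₀ ∈ A) (hc : c k₀ ≠ 0) {b : ℝ} (hb : (w, b) ∉ A) :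
    IndepFacets (insert (w, b) (A.erase k₀)) := by
  intro d hd k hk
  rw [sum_insert_erase_facets hw hk₀ hb] at hd
  have h1 := hA _ hd
  have h2 : d (w, b) = 0 := by
    have := h1 k₀ hk₀
    simpa [hc] using this
  rcases Finset.mem_insert.mp hk with rfl | hk
  · exact h2
  · have := h1 k (Finset.mem_of_mem_erase hk)
    simpa [h2, Finset.ne_of_mem_erase hk] using this

/-- Replacing a normal vector by an integral point of the half-open parallelepiped lowers the
number of integral points. -/
theorem IndepFacets.ncard_boxPoints_exchange_lt [DecidableEq (Facet n)] {A : Finset (Facet n)}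
    (hA : IndepFacets A) {c : Facet n → ℝ} (hcA : c ∈ boxPoints A) {w : Fin (n + 1) → ℤ}
    (hw : ∑ k ∈ A, c k • realVec k.1 = realVec w)
    {k₀ : Facet n} (hk₀ : k₀ ∈ A) (hc : c k₀ ≠ 0) {b : ℝ} (hb : (w, b) ∉ A) :
    (boxPoints (insert (w, b) (A.erase k₀))).ncard < (boxPoints A).ncard := by
  have hne : k₀ ≠ (w, b) := fun h => hb (h ▸ hk₀)
  set B := insert (w, b) (A.erase k₀) with hB
  have hk₀B : k₀ ∉ B := by simp [hB, hne]
  -- `e d` lists the coefficients of the point of `d` with respect to `A`, and `φ` reduces them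
  -- modulo 1. The one at `k₀` is `d (w, b) * c k₀ < 1`, unchanged by the reduction, so it recovers
  -- `d (w, b)`; the entries of `d` at the other facets are then determined modulo 1, hence
  -- determined.
  let e : (Facet n → ℝ) → Facet n → ℝ := fun d k => d k + d (w, b) * c k
  let φ : (Facet n → ℝ) → Facet n → ℝ := fun d k => if k ∈ A then Int.fract (e d k) else 0
  have hk₀φ : ∀ d ∈ boxPoints B, φ d k₀ = d (w, b) * c k₀ := by
    intro d hd
    have h1 : e d k₀ = d (w, b) * c k₀ := by simp [e, hd.1 k₀ hk₀B]
    simp only [φ, if_pos hk₀, h1]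
    rw [Int.fract_eq_self]
    exact ⟨mul_nonneg (hd.2.1 _).1 (hcA.2.1 _).1,
      mul_lt_one_of_nonneg_of_lt_one_left (hd.2.1 _).1 (hd.2.1 _).2 (hcA.2.1 _).2.le⟩
  have hpos : 0 < c k₀ := lt_of_le_of_ne (hcA.2.1 k₀).1 hc.symm
  have hinj : Set.InjOn φ (boxPoints B) := by
    intro d hd d' hd' h
    have h1 : d (w, b) = d' (w, b) := by
      have := congrFun h k₀
      rw [hk₀φ d hd, hk₀φ d' hd'] at this
      exact mul_right_cancel₀ hc this
    funext k
    by_cases hkw : k = (w, b)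
    · rw [hkw, h1]
    by_cases hkA : k ∈ A
    · have h2 := congrFun h k
      simp only [φ, if_pos hkA, e] at h2
      obtain ⟨z, hz⟩ := Int.fract_eq_fract.mp h2
      rw [h1, add_sub_add_right_eq_sub] at hz
      have h3 : |(z : ℝ)| < 1 := by
        rw [← hz, abs_lt]
        constructor <;> linarith [(hd.2.1 k).1, (hd.2.1 k).2, (hd'.2.1 k).1, (hd'.2.1 k).2]
      have h4 : z = 0 := Int.abs_lt_one_iff.mp (by exact_mod_cast h3)
      rw [h4, Int.cast_zero] at hz
      exact sub_eq_zero.mp hz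
    · have hkB : k ∉ B := by simp [hB, hkw, hkA]
      rw [hd.1 k hkB, hd'.1 k hkB]
  rw [← hinj.ncard_image]
  refine Set.ncard_lt_ncard ((Set.ssubset_iff_of_subset ?_).mpr ⟨c, hcA, ?_⟩) hA.finite_boxPoints
  · rintro _ ⟨d, hd, rfl⟩
    refine ⟨fun k hk => by simp [φ, hk], fun k => ?_, ?_⟩
    · by_cases hk : k ∈ A
      · simp only [φ, if_pos hk]
        exact ⟨Int.fract_nonneg _, Int.fract_lt_one _⟩
      · simp [φ, hk]
    · obtain ⟨u, hu⟩ := hd.2.2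
      refine ⟨u - ∑ k ∈ A, ⌊e d k⌋ • k.1, ?_⟩
      have h1 : ∑ k ∈ A, e d k • realVec k.1 = realVec u := by
        rw [← hu, sum_insert_erase_facets hw hk₀ hb]
        refine Finset.sum_congr rfl fun k _ => ?_
        by_cases hk : k = k₀
        · rw [if_pos hk, hk]
          simp [e, hd.1 k₀ hk₀B]
        · rw [if_neg hk]
      have h2 : realVec (u - ∑ k ∈ A, ⌊e d k⌋ • k.1) =
          realVec u - ∑ k ∈ A, ((⌊e d k⌋ : ℤ) : ℝ) • realVec k.1 := by
        ext i
        simp [realVec, Finset.sum_apply]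
      rw [h2, ← h1, ← Finset.sum_sub_distrib]
      refine Finset.sum_congr rfl fun k hk => ?_
      simp only [φ, if_pos hk, Int.fract, sub_smul]
  -- The point `c` itself is not hit: this would force `d (w, b) = 1`, which the half-open condition
  -- excludes.
  · rintro ⟨d, hd, h⟩
    have h1 := congrFun h k₀
    rw [hk₀φ d hd] at h1
    have := mul_lt_of_lt_one_left hpos (hd.2.1 (w, b)).2
    linarith

end

end GenLens

/-! ### Cuts of the cone dual to the characteristic vectors. -/

namespace GenLens

noncomputable section

variable {n : ℕ}

theorem pairing_sum {ι : Type*} {s : Finset ι} {c : ι → ℝ} {v : ι → Fin (n + 1) → ℤ}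
    {w : Fin (n + 1) → ℤ} (hw : ∑ k ∈ s, c k • realVec (v k) = realVec w)
    (y : Fin (n + 1) → ℝ) : pairing w y = ∑ k ∈ s, c k * pairing (v k) y := by
  unfold pairing
  rw [← hw, sum_dotProduct]
  simp [smul_dotProduct]

/-- The real matrix with rows `vⱼ`. -/
def realMatrix (V : Fin (n + 1) → Fin (n + 1) → ℤ) : Matrix (Fin (n + 1)) (Fin (n + 1)) ℝ :=
  fun j => realVec (V j)

theorem det_realMatrix (V : Fin (n + 1) → Fin (n + 1) → ℤ) :
    (realMatrix V).det = ((Matrix.of V).det : ℝ) :=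
  (RingHom.map_det (Int.castRingHom ℝ) (Matrix.of V)).symm

theorem isUnit_det_realMatrix {V : Fin (n + 1) → Fin (n + 1) → ℤ} (hV : (Matrix.of V).det ≠ 0) :
    IsUnit (realMatrix V).det := by
  rw [isUnit_iff_ne_zero, det_realMatrix]
  exact_mod_cast hV

theorem realMatrix_mulVec (V : Fin (n + 1) → Fin (n + 1) → ℤ) (y : Fin (n + 1) → ℝ)
    (j : Fin (n + 1)) : (realMatrix V).mulVec y j = pairing (V j) y := rfl

namespace LensCharacteristic

variable (ξ : LensCharacteristic n)

theorem realVec_coeff_eq_zero {a : Fin (n + 1) → ℝ} (h : ∑ j, a j • realVec (ξ.vec j) = 0) :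
    a = 0 := by
  have h1 : Matrix.vecMul a (realMatrix ξ.vec) = 0 := by
    rw [← h]
    ext i
    simp [Matrix.vecMul, dotProduct, realMatrix]
  have h2 := congrArg (fun v => Matrix.vecMul v (realMatrix ξ.vec)⁻¹) h1
  simpa [Matrix.vecMul_vecMul, Matrix.mul_nonsing_inv _ (isUnit_det_realMatrix ξ.det_ne_zero)]
    using h2

/-- The functions $\langle\xi_j,\cdot\rangle$ are linear coordinates of $\mathbb R^{n+1}$, so a
bound on them confines `S` to the linear image of a box. -/
theorem isCompact_of_pairing_le {S : Set (Fin (n + 1) → ℝ)} (hS : IsClosed S)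
    (K : Fin (n + 1) → ℝ) (h : ∀ y ∈ S, ∀ j, 0 ≤ pairing (ξ.vec j) y ∧ pairing (ξ.vec j) y ≤ K j) :
    IsCompact S := by
  have hc : Continuous fun Y : Fin (n + 1) → ℝ => (realMatrix ξ.vec)⁻¹.mulVec Y := by
    unfold Matrix.mulVec dotProduct
    fun_prop
  refine IsCompact.of_isClosed_subset
    ((isCompact_Icc (a := (0 : Fin (n + 1) → ℝ)) (b := K)).image hc) hS fun y hy => ?_
  refine ⟨(realMatrix ξ.vec).mulVec y, ⟨fun j => (h y hy j).1, fun j => (h y hy j).2⟩, ?_⟩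
  change (realMatrix ξ.vec)⁻¹.mulVec ((realMatrix ξ.vec).mulVec y) = y
  rw [Matrix.mulVec_mulVec, Matrix.nonsing_inv_mul _ (isUnit_det_realMatrix ξ.det_ne_zero),
    Matrix.one_mulVec]

/-- The polyhedra obtained from the cone dual to `ξ` by cutting off parts away from infinity:
all facets but those of the cone have normal vectors in the interior of the cone
spanned by `ξ`, and the polyhedron is simple. -/
structure IsSimpleCut (F : Finset (Facet n)) : Prop where
  mem : ∀ j, (ξ.vec j, (0 : ℝ)) ∈ F
  pos : ∀ k ∈ F, (∃ j, k = (ξ.vec j, (0 : ℝ))) ∨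
    ∃ a : Fin (n + 1) → ℝ, (∀ j, 0 < a j) ∧ ∑ j, a j • realVec (ξ.vec j) = realVec k.1
  indep : ∀ y ∈ polyhedron F, IndepFacets (activeSet F y)

variable {ξ}

theorem IsSimpleCut.pairing_nonneg {F : Finset (Facet n)} (hF : ξ.IsSimpleCut F)
    {y : Fin (n + 1) → ℝ} (hy : y ∈ polyhedron F) (j : Fin (n + 1)) :
    0 ≤ pairing (ξ.vec j) y := by
  simpa [Facet.height] using hy _ (hF.mem j)

-- The start of the cutting process is the cone itself, all of whose normals together are
-- independent.
variable (ξ) in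
theorem exists_isSimpleCut : ∃ F, ξ.IsSimpleCut F := by
  classical
  refine ⟨Finset.univ.image fun j => (ξ.vec j, (0 : ℝ)), ⟨fun j => by simp, ?_, ?_⟩⟩
  · intro k hk
    obtain ⟨j, -, rfl⟩ := Finset.mem_image.mp hk
    exact Or.inl ⟨j, rfl⟩
  · intro y _
    refine IndepFacets.mono (A' := Finset.univ.image fun j => (ξ.vec j, (0 : ℝ)))
      (Finset.filter_subset _ _) fun c hc k hk => ?_
    rw [Finset.sum_image fun i _ j _ h => ξ.linearIndependent.injective (Prod.ext_iff.mp h).1] at hc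
    obtain ⟨j, -, rfl⟩ := Finset.mem_image.mp hk
    exact congrFun (ξ.realVec_coeff_eq_zero hc) j

/-- A nonzero integral point of a half-open parallelepiped lies in the interior of the
cone spanned by `ξ`. -/
theorem IsSimpleCut.exists_pos_coeff {F : Finset (Facet n)} (hF : ξ.IsSimpleCut F)
    {A : Finset (Facet n)} (hA : A ⊆ F) {c : Facet n → ℝ} (hc : c ∈ boxPoints A) (hc0 : c ≠ 0)
    {w : Fin (n + 1) → ℤ} (hw : ∑ k ∈ A, c k • realVec k.1 = realVec w) :
    ∃ a : Fin (n + 1) → ℝ, (∀ j, 0 < a j) ∧ ∑ j, a j • realVec (ξ.vec j) = realVec w := by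
  classical
  have hex : ∀ k : Facet n, ∃ a : Fin (n + 1) → ℝ, k ∈ F → (∀ j, 0 ≤ a j) ∧
      ∑ j, a j • realVec (ξ.vec j) = realVec k.1 ∧
      ((∃ j, k = (ξ.vec j, (0 : ℝ)) ∧ a = Pi.single j 1) ∨ ∀ j, 0 < a j) := by
    intro k
    by_cases hk : k ∈ F
    · rcases hF.pos k hk with ⟨j, rfl⟩ | ⟨a, ha, h⟩
      · refine ⟨Pi.single j 1, fun _ => ⟨fun i => ?_, ?_, Or.inl ⟨j, rfl, rfl⟩⟩⟩
        · by_cases h : i = j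
          · subst h; simp
          · simp [h]
        · rw [Finset.sum_eq_single j] <;> simp +contextual
      · exact ⟨a, fun _ => ⟨fun j => (ha j).le, h, Or.inr ha⟩⟩
    · exact ⟨0, fun h => absurd h hk⟩
  choose a ha using hex
  let α : Fin (n + 1) → ℝ := fun j => ∑ k ∈ A, c k * a k j
  have hα : ∑ j, α j • realVec (ξ.vec j) = realVec w := by
    rw [← hw]
    simp only [α, Finset.sum_smul]
    rw [Finset.sum_comm]
    refine Finset.sum_congr rfl fun k hk => ?_
    rw [← (ha k (hA hk)).2.1, Finset.smul_sum]
    exact Finset.sum_congr rfl fun j _ => mul_smul _ _ _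
  have hterm : ∀ j, ∀ k ∈ A, 0 ≤ c k * a k j := fun j k hk =>
    mul_nonneg (hc.2.1 k).1 ((ha k (hA hk)).1 j)
  refine ⟨α, fun j => lt_of_le_of_ne (Finset.sum_nonneg (hterm j)) fun hj => hc0 ?_, hα⟩
  have hzero : ∀ k ∈ A, c k * a k j = 0 := (Finset.sum_eq_zero_iff_of_nonneg (hterm j)).mp hj.symm
  -- If the coefficient at `j` vanishes, the support of `c` consists of facets of the cone, since
  -- any other normal has a positive coefficient at `j`.
  have htype : ∀ k, c k ≠ 0 → ∃ i, k = (ξ.vec i, (0 : ℝ)) ∧ a k = Pi.single i 1 := by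
    intro k hk
    have hkA : k ∈ A := by
      by_contra h
      exact hk (hc.1 k h)
    rcases (ha k (hA hkA)).2.2 with h | h
    · exact h
    · exact absurd (hzero k hkA) (mul_ne_zero hk (h j).ne')
  have hαi : ∀ i, α i = c (ξ.vec i, 0) := by
    intro i
    have h1 : ∀ k ∈ A, k ≠ (ξ.vec i, (0 : ℝ)) → c k * a k i = 0 := by
      intro k _ hne
      by_cases hk : c k = 0
      · rw [hk, zero_mul]
      · obtain ⟨l, rfl, h⟩ := htype k hk
        have : i ≠ l := by
          rintro rfl
          exact hne rfl
        rw [h, Pi.single_eq_of_ne this, mul_zero]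
    simp only [α]
    rw [Finset.sum_eq_single _ h1 fun h => by rw [hc.1 _ h, zero_mul]]
    by_cases hk : c (ξ.vec i, 0) = 0
    · rw [hk, zero_mul]
    · obtain ⟨l, h1, h⟩ := htype _ hk
      have : i = l := ξ.linearIndependent.injective (Prod.ext_iff.mp h1).1
      rw [h, this, Pi.single_eq_same, mul_one]
  -- A functional dual to the $\xi_l$ with $l\ne j$ takes the value `α i` on the integral vector
  -- `w`. So `α i` is an integer, and being equal to `c (ξ.vec i, 0)` it lies in $[0,1)$. The hyper
  -- characteristic condition enters here, through `exists_dual`.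
  have hαzero : ∀ i, α i = 0 := by
    intro i
    by_cases hij : i = j
    · rw [hij, ← hj]
    obtain ⟨d, hd⟩ := ξ.exists_dual j i hij
    have h1 : ((∑ m, w m * d m : ℤ) : ℝ) = α i := by
      have h2 : ∀ l, ∑ m, (ξ.vec l m : ℝ) * (d m : ℝ) =
          ((∑ m, ξ.vec l m * d m : ℤ) : ℝ) := fun l => by push_cast; rfl
      have h3 := congrArg (fun v => v ⬝ᵥ fun m => (d m : ℝ)) hα
      simp only [sum_dotProduct, smul_dotProduct] at h3
      have h4 : ∀ l, α l • (realVec (ξ.vec l) ⬝ᵥ fun m => (d m : ℝ)) =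
          if l = i then α i else 0 := by
        intro l
        have : (realVec (ξ.vec l) ⬝ᵥ fun m => (d m : ℝ)) = ((∑ m, ξ.vec l m * d m : ℤ) : ℝ) := h2 l
        rw [this]
        by_cases hl : l = j
        · subst hl
          rw [← hj, zero_smul, if_neg fun h => hij h.symm]
        · rw [hd l hl]
          split_ifs with h
          · simp [h]
          · simp
      rw [Finset.sum_congr rfl fun l _ => h4 l] at h3
      simp only [Finset.sum_ite_eq', Finset.mem_univ, if_true] at h3
      rw [h3]
      push_cast
      rfl
    have h2 := hc.2.1 (ξ.vec i, 0)
    rw [← hαi, ← h1] at h2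
    have h3 : (∑ m, w m * d m : ℤ) = 0 := by
      have h4 : (0 : ℤ) ≤ ∑ m, w m * d m := by exact_mod_cast h2.1
      have h5 : (∑ m, w m * d m : ℤ) < 1 := by exact_mod_cast h2.2
      omega
    rw [← h1, h3, Int.cast_zero]
  funext k
  by_contra hk
  obtain ⟨i, rfl, -⟩ := htype k hk
  exact hk (by rw [← hαi, hαzero]; rfl)

end LensCharacteristic

end

end GenLens

/-! ### Lowering the number of box points by cutting off faces. -/

namespace GenLens

noncomputable section

variable {n : ℕ}

namespace LensCharacteristic

variable {ξ : LensCharacteristic n}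

theorem pairing_pos_combination {a : Fin (n + 1) → ℝ} {w : Fin (n + 1) → ℤ}
    (hw : ∑ j, a j • realVec (ξ.vec j) = realVec w) (y : Fin (n + 1) → ℝ) :
    pairing w y = ∑ j, a j * pairing (ξ.vec j) y := pairing_sum hw y

/-- On a face that misses the face `σ`, the function `∑ c_k ⟨v_k, ·⟩` stays away from its
minimum. -/
theorem IsSimpleCut.exists_gap {F : Finset (Facet n)} (hF : ξ.IsSimpleCut F)
    {A' : Finset (Facet n)} (hA' : A' ⊆ F) {c : Facet n → ℝ} (hc : c ∈ boxPoints A') (hc0 : c ≠ 0)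
    {w : Fin (n + 1) → ℤ} (hw : ∑ k ∈ A', c k • realVec k.1 = realVec w) (A : Finset (Facet n))
    (hA : ∀ y ∈ polyhedron F, A ⊆ activeSet F y → ∃ k ∈ A', c k ≠ 0 ∧ k ∉ activeSet F y) :
    ∃ ε > 0, ∀ y ∈ polyhedron F, A ⊆ activeSet F y →
      ∑ k ∈ A', c k * k.2 + ε < pairing w y := by
  obtain ⟨a, ha, haw⟩ := hF.exists_pos_coeff hA' hc hc0 hw
  set b := ∑ k ∈ A', c k * k.2 with hb
  have hgap : ∀ y ∈ polyhedron F, A ⊆ activeSet F y → b < pairing w y := by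
    intro y hy hAy
    rw [pairing_sum hw, hb]
    obtain ⟨k, hk, hck, hka⟩ := hA y hy hAy
    refine Finset.sum_lt_sum (fun k hk => ?_) ⟨k, hk, ?_⟩
    · have := hy k (hA' hk)
      exact mul_le_mul_of_nonneg_left (by simpa [Facet.height] using this) (hc.2.1 k).1
    · have h1 := hy k (hA' hk)
      have h2 : k.height y ≠ 0 := fun h => hka (mem_activeSet.mpr ⟨hA' hk, h⟩)
      have h3 : 0 < k.height y := lt_of_le_of_ne h1 h2.symm
      exact mul_lt_mul_of_pos_left (by simpa [Facet.height] using h3)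
        (lt_of_le_of_ne (hc.2.1 k).1 hck.symm)
  -- Since `w` is a positive combination of the $\xi_j$, this sublevel set is compact, and the
  -- strict inequality on it becomes a uniform gap. Above the level `b + 1` there is room for any `ε
  -- < 1`.
  let S : Set (Fin (n + 1) → ℝ) :=
    polyhedron F ∩ (⋂ k ∈ A, {y | k ∈ F ∧ k.height y = 0}) ∩ {y | pairing w y ≤ b + 1}
  have hmem : ∀ y, y ∈ S ↔ y ∈ polyhedron F ∧ A ⊆ activeSet F y ∧ pairing w y ≤ b + 1 := by
    intro y
    simp only [S, Set.mem_inter_iff, Set.mem_iInter, Set.mem_ofPred_eq, and_assoc,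
      Finset.subset_iff, mem_activeSet]
  have hclosed : IsClosed S := by
    refine ((isClosed_polyhedron F).inter (isClosed_biInter fun k _ => ?_)).inter
      (isClosed_le (continuous_pairing w) continuous_const)
    exact isClosed_const.inter (isClosed_eq (continuous_height k) continuous_const)
  have hcomp : IsCompact S := by
    refine ξ.isCompact_of_pairing_le hclosed (fun j => (b + 1) / a j) fun y hy j => ?_
    obtain ⟨hy1, -, hy3⟩ := (hmem y).mp hy
    refine ⟨hF.pairing_nonneg hy1 j, ?_⟩
    rw [le_div_iff₀ (ha j), mul_comm]
    refine le_trans ?_ hy3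
    rw [pairing_pos_combination haw]
    exact Finset.single_le_sum (f := fun j => a j * pairing (ξ.vec j) y)
      (fun i _ => mul_nonneg (ha i).le (hF.pairing_nonneg hy1 i)) (Finset.mem_univ j)
  by_cases hne : S.Nonempty
  · obtain ⟨y₀, hy₀, hmin⟩ := hcomp.exists_isMinOn hne (continuous_pairing w).continuousOn
    obtain ⟨h1, h2, h3⟩ := (hmem y₀).mp hy₀
    have h4 := hgap y₀ h1 h2
    refine ⟨(pairing w y₀ - b) / 2, by linarith, fun y hy hAy => ?_⟩
    by_cases hy' : pairing w y ≤ b + 1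
    · have := hmin ((hmem y).mpr ⟨hy, hAy, hy'⟩)
      have h5 : pairing w y₀ ≤ pairing w y := this
      linarith
    · linarith
  · refine ⟨1, one_pos, fun y hy hAy => ?_⟩
    by_contra! h
    exact hne ⟨y, (hmem y).mpr ⟨hy, hAy, h⟩⟩

/-- Cutting off the face on which all `k` with `c k ≠ 0` are active. -/
theorem IsSimpleCut.exists_cut {F : Finset (Facet n)} (hF : ξ.IsSimpleCut F)
    {y₀ : Fin (n + 1) → ℝ} (hy₀ : y₀ ∈ polyhedron F) {c : Facet n → ℝ}
    (hc : c ∈ boxPoints (activeSet F y₀)) (hc0 : c ≠ 0) :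
    ∃ F', ξ.IsSimpleCut F' ∧ ∀ y ∈ polyhedron F',
      (y ∈ polyhedron F ∧ activeSet F' y = activeSet F y ∧ activeSet F' y ≠ activeSet F y₀) ∨
      ∃ z ∈ polyhedron F,
        (boxPoints (activeSet F' y)).ncard < (boxPoints (activeSet F z)).ncard := by
  classical
  set A' := activeSet F y₀ with hA'def
  have hA' : A' ⊆ F := Finset.filter_subset _ _
  obtain ⟨w, hw⟩ := hc.2.2
  set b := ∑ k ∈ A', c k * k.2 with hb
  -- The constant is chosen for every set `A`, with the irrelevant value 1 where the face of `A`
  -- meets the face to be cut off, so that a minimum over the finitely many subsets of `F` can be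
  -- taken.
  have hgap : ∀ A : Finset (Facet n), ∃ ε > 0,
      (∀ y ∈ polyhedron F, A ⊆ activeSet F y → ∃ k ∈ A', c k ≠ 0 ∧ k ∉ activeSet F y) →
      ∀ y ∈ polyhedron F, A ⊆ activeSet F y → b + ε < pairing w y := by
    intro A
    by_cases h : ∀ y ∈ polyhedron F, A ⊆ activeSet F y → ∃ k ∈ A', c k ≠ 0 ∧ k ∉ activeSet F y
    · obtain ⟨ε, hε, h'⟩ := hF.exists_gap hA' hc hc0 hw A h
      exact ⟨ε, hε, fun _ => h'⟩
    · exact ⟨1, one_pos, fun h' => absurd h' h⟩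
  choose ε hε hgap using hgap
  obtain ⟨δ, hδ, hδε⟩ : ∃ δ > 0, ∀ A ∈ F.powerset, δ ≤ ε A := by
    refine ⟨F.powerset.inf' ⟨∅, Finset.empty_mem_powerset F⟩ ε, ?_, fun A hA =>
      Finset.inf'_le _ hA⟩
    exact (Finset.lt_inf'_iff _).mpr fun A _ => hε A
  have hface : ∀ y, (∀ k ∈ A', c k ≠ 0 → k.height y = 0) → pairing w y = b := by
    intro y hy
    rw [pairing_sum hw, hb]
    refine Finset.sum_congr rfl fun k hk => ?_
    by_cases hck : c k = 0
    · rw [hck, zero_mul, zero_mul]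
    · have := hy k hk hck
      rw [Facet.height, sub_eq_zero] at this
      rw [this]
  have hy₀w : pairing w y₀ = b := hface y₀ fun k hk _ => (mem_activeSet.mp hk).2
  have hnot : (w, b + δ) ∉ F := by
    intro h
    have := hy₀ _ h
    simp only [Facet.height, hy₀w] at this
    linarith
  have hpoly : ∀ y, y ∈ polyhedron (insert (w, b + δ) F) ↔
      y ∈ polyhedron F ∧ b + δ ≤ pairing w y := by
    intro y
    simp [polyhedron, Facet.height, and_comm]
  have hnew : ∀ y ∈ polyhedron F, pairing w y = b + δ →
      activeSet (insert (w, b + δ) F) y = insert (w, b + δ) (activeSet F y) := by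
    intro y _ hy
    rw [activeSet, Finset.filter_insert, if_pos (by simp [Facet.height, hy])]
    rfl
  have hold : ∀ y, pairing w y ≠ b + δ → activeSet (insert (w, b + δ) F) y = activeSet F y := by
    intro y hy
    rw [activeSet, Finset.filter_insert,
      if_neg (by simpa [Facet.height, sub_eq_zero] using hy)]
    rfl
  -- The face of a point `y` of the new facet meets the face cut off, for otherwise `w` would exceed
  -- `b + δ` at `y`; `z` is a common point. Some `k₀` in the support of `c` is not active at `y`,
  -- since otherwise `w` would take the value `b` there. So the active set at `y` is contained in
  -- that of `z` with `k₀` exchanged for the new facet.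
  have hkey : ∀ y ∈ polyhedron F, pairing w y = b + δ → ∃ z ∈ polyhedron F,
      ∃ k₀ ∈ activeSet F z, c k₀ ≠ 0 ∧ (∀ k ∈ A', c k ≠ 0 → k ∈ activeSet F z) ∧
        insert (w, b + δ) (activeSet F y) ⊆ insert (w, b + δ) ((activeSet F z).erase k₀) := by
    intro y hy hyw
    have h1 : ∃ z ∈ polyhedron F, activeSet F y ⊆ activeSet F z ∧
        ∀ k ∈ A', c k ≠ 0 → k ∈ activeSet F z := by
      by_contra! h
      have h2 := hgap (activeSet F y) (fun z hz hyz => by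
        obtain ⟨k, hk⟩ := h z hz hyz
        exact ⟨k, hk⟩) y hy subset_rfl
      have h3 := hδε (activeSet F y) (Finset.mem_powerset.mpr (Finset.filter_subset _ _))
      linarith
    obtain ⟨z, hz, hyz, hσ⟩ := h1
    have h2 : ∃ k₀ ∈ A', c k₀ ≠ 0 ∧ k₀ ∉ activeSet F y := by
      by_contra! h
      have := hface y fun k hk hck => (mem_activeSet.mp (h k hk hck)).2
      linarith
    obtain ⟨k₀, hk₀, hck₀, hk₀y⟩ := h2
    refine ⟨z, hz, k₀, hσ k₀ hk₀ hck₀, hck₀, hσ, Finset.insert_subset_insert _ fun k hk => ?_⟩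
    rw [Finset.mem_erase]
    exact ⟨fun h => hk₀y (h ▸ hk), hyz hk⟩
  have hbox : ∀ z, (∀ k ∈ A', c k ≠ 0 → k ∈ activeSet F z) → c ∈ boxPoints (activeSet F z) ∧
      ∑ k ∈ activeSet F z, c k • realVec k.1 = realVec w := by
    intro z hz
    have h1 : ∀ k, c k ≠ 0 → k ∈ A' := fun k hk => by
      by_contra h
      exact hk (hc.1 k h)
    have h2 : ∑ k ∈ activeSet F z, c k • realVec k.1 = realVec w := by
      rw [← hw]
      have h3 : ∀ s : Finset (Facet n), (∀ k, c k ≠ 0 → k ∈ s) →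
          ∑ k ∈ s, c k • realVec k.1 = ∑ k ∈ s ∪ A', c k • realVec k.1 := by
        intro s hs
        refine Finset.sum_subset Finset.subset_union_left fun k _ hk => ?_
        rw [not_not.mp fun h => hk (hs k h), zero_smul]
      rw [h3 _ fun k hk => hz k (h1 k hk) hk, Finset.union_comm]
      refine (Finset.sum_subset Finset.subset_union_left fun k _ hk => ?_).symm
      rw [hc.1 k hk, zero_smul]
    refine ⟨⟨fun k hk => not_not.mp fun h => hk (hz k (h1 k h) h), hc.2.1, w, h2⟩, h2⟩
  have hnotA : ∀ z, (w, b + δ) ∉ activeSet F z := fun z h => hnot (mem_activeSet.mp h).1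
  refine ⟨insert (w, b + δ) F, ⟨fun j => Finset.mem_insert_of_mem (hF.mem j), ?_, ?_⟩, ?_⟩
  · intro k hk
    rcases Finset.mem_insert.mp hk with rfl | hk
    · exact Or.inr (hF.exists_pos_coeff hA' hc hc0 hw)
    · exact hF.pos k hk
  · intro y hy
    obtain ⟨hyF, -⟩ := (hpoly y).mp hy
    by_cases hyw : pairing w y = b + δ
    · obtain ⟨z, hz, k₀, hk₀, hck₀, hσ, hsub⟩ := hkey y hyF hyw
      rw [hnew y hyF hyw]
      exact ((hF.indep z hz).exchange (hbox z hσ).2 hk₀ hck₀ (hnotA z)).mono hsub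
    · rw [hold y hyw]
      exact hF.indep y hyF
  · intro y hy
    obtain ⟨hyF, hyb⟩ := (hpoly y).mp hy
    by_cases hyw : pairing w y = b + δ
    · right
      obtain ⟨z, hz, k₀, hk₀, hck₀, hσ, hsub⟩ := hkey y hyF hyw
      refine ⟨z, hz, ?_⟩
      rw [hnew y hyF hyw]
      refine lt_of_le_of_lt (Set.ncard_le_ncard (boxPoints_mono hsub) ?_)
        ((hF.indep z hz).ncard_boxPoints_exchange_lt (hbox z hσ).1 (hbox z hσ).2 hk₀ hck₀ (hnotA z))
      exact ((hF.indep z hz).exchange (hbox z hσ).2 hk₀ hck₀ (hnotA z)).finite_boxPoints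
    -- Off the new facet the active set is unchanged. It differs from that of `y₀`, because `w`
    -- equals `b` wherever all facets active at `y₀` are active.
    · left
      refine ⟨hyF, hold y hyw, fun h => ?_⟩
      rw [hold y hyw] at h
      have := hface y fun k hk _ => by
        rw [← h] at hk
        exact (mem_activeSet.mp hk).2
      linarith

/-- The set of faces of a polyhedron, given by their active facets. -/
def faces (F : Finset (Facet n)) : Set (Finset (Facet n)) := activeSet F '' polyhedron F

theorem finite_faces (F : Finset (Facet n)) : (faces F).Finite :=
  F.powerset.finite_toSet.subset (by
    rintro _ ⟨y, -, rfl⟩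
    exact Finset.mem_coe.mpr (Finset.mem_powerset.mpr (Finset.filter_subset _ _)))

theorem zero_mem_boxPoints (A : Finset (Facet n)) : (0 : Facet n → ℝ) ∈ boxPoints A :=
  ⟨fun _ _ => rfl, fun _ => ⟨le_rfl, zero_lt_one⟩, 0, by
    ext i
    simp [realVec]⟩

/-- Double induction on the largest number of box points and on the number of faces attaining it: a
cut at such a face destroys it and creates only faces with fewer box points. The bound has the form
`m + 1` because 0 is always a box point. -/
theorem exists_unimodular_of_le (m N : ℕ) : ∀ F : Finset (Facet n), ξ.IsSimpleCut F →
    (∀ A ∈ faces F, (boxPoints A).ncard ≤ m + 1) →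
    {A ∈ faces F | (boxPoints A).ncard = m + 1}.ncard ≤ N →
    ∃ F', ξ.IsSimpleCut F' ∧ ∀ A ∈ faces F', (boxPoints A).ncard ≤ 1 := by
  induction m generalizing N with
  | zero => exact fun F hF h _ => ⟨F, hF, h⟩
  | succ m ih =>
    induction N with
    | zero =>
      intro F hF h hN
      refine ih _ F hF (fun A hA => ?_) le_rfl
      by_contra hlt
      have h1 : A ∈ {A ∈ faces F | (boxPoints A).ncard = m + 1 + 1} :=
        ⟨hA, le_antisymm (h A hA) (by omega)⟩
      have h2 := (Set.ncard_pos ((finite_faces F).subset (Set.sep_subset _ _))).mpr ⟨A, h1⟩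
      omega
    | succ N ihN =>
      intro F hF h hN
      by_cases hex : ∃ A ∈ faces F, (boxPoints A).ncard = m + 1 + 1
      · obtain ⟨_, ⟨y₀, hy₀, rfl⟩, hA⟩ := hex
        obtain ⟨c, hc, hc0⟩ := Set.exists_ne_of_one_lt_ncard
          (s := boxPoints (activeSet F y₀)) (by omega) 0
        obtain ⟨F', hF', hcut⟩ := hF.exists_cut hy₀ hc hc0
        have hle : ∀ A ∈ faces F', (A ∈ faces F ∧ A ≠ activeSet F y₀) ∨
            (boxPoints A).ncard < m + 1 + 1 := by
          rintro _ ⟨y, hy, rfl⟩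
          rcases hcut y hy with ⟨h1, h2, h3⟩ | ⟨z, hz, h1⟩
          · exact Or.inl ⟨⟨y, h1, h2.symm⟩, h3⟩
          · exact Or.inr (h1.trans_le (h _ ⟨z, hz, rfl⟩))
        refine ihN F' hF' (fun A hA => ?_) ?_
        · rcases hle A hA with h1 | h1
          · exact h A h1.1
          · exact h1.le
        · have hss : {A ∈ faces F' | (boxPoints A).ncard = m + 1 + 1} ⊂
              {A ∈ faces F | (boxPoints A).ncard = m + 1 + 1} := by
            refine (Set.ssubset_iff_of_subset ?_).mpr ⟨activeSet F y₀, ⟨⟨y₀, hy₀, rfl⟩, hA⟩, ?_⟩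
            · rintro A ⟨hA, hAm⟩
              rcases hle A hA with h1 | h1
              · exact ⟨h1.1, hAm⟩
              · omega
            · rintro ⟨hA', hAm⟩
              rcases hle _ hA' with h1 | h1
              · exact h1.2 rfl
              · omega
          exact Nat.le_of_lt_succ (lt_of_lt_of_le (Set.ncard_lt_ncard hss
            ((finite_faces F).subset (Set.sep_subset _ _))) hN)
      · push Not at hex
        exact ih _ F hF (fun A hA => by have := h A hA; have := hex A hA; omega) le_rfl

variable (ξ) in
/-- The cone dual to `ξ` can be cut to a polyhedron at each point of which the active
normal vectors span a direct summand. -/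
theorem exists_unimodular_cut : ∃ F, ξ.IsSimpleCut F ∧
    ∀ y ∈ polyhedron F, boxPoints (activeSet F y) ⊆ {0} := by
  obtain ⟨F, hF⟩ := ξ.exists_isSimpleCut
  obtain ⟨m, hm⟩ : ∃ m : ℕ, ∀ A ∈ faces F, (boxPoints A).ncard ≤ m := by
    obtain ⟨m, hm⟩ := ((finite_faces F).image fun A => (boxPoints A).ncard).bddAbove
    exact ⟨m, fun A hA => hm ⟨A, hA, rfl⟩⟩
  obtain ⟨F', hF', h⟩ := exists_unimodular_of_le m _ F hF
    (fun A hA => (hm A hA).trans (Nat.le_succ m)) le_rfl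
  refine ⟨F', hF', fun y hy c hc => ?_⟩
  have h1 := h _ ⟨y, hy, rfl⟩
  exact (Set.ncard_le_one (hF'.indep y hy).finite_boxPoints).mp h1 c hc 0 (zero_mem_boxPoints _)

end LensCharacteristic

end

end GenLens

/-! ### Lattice bases from box points, and the resolved polytope. -/

namespace GenLens

noncomputable section

variable {n : ℕ}

theorem realVec_injective : Function.Injective (realVec (n := n)) := by
  intro v w h
  funext i
  have h1 : (v i : ℝ) = w i := congrFun h i
  exact_mod_cast h1

theorem IndepFacets.eq_of_fst_eq {A : Finset (Facet n)} (hA : IndepFacets A) {k l : Facet n}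
    (hk : k ∈ A) (hl : l ∈ A) (h : k.1 = l.1) : k = l := by
  classical
  by_contra hne
  have := hA (fun m => if m = k then 1 else if m = l then -1 else 0) ?_ k hk
  · simp at this
  · rw [← Finset.sum_subset (s₁ := {k, l})]
    · rw [Finset.sum_pair hne]
      simp [Ne.symm hne, h]
    · intro m hm
      rcases Finset.mem_insert.mp hm with rfl | hm
      · exact hk
      · rw [Finset.mem_singleton.mp hm]
        exact hl
    · intro m _ hm
      simp only [Finset.mem_insert, Finset.mem_singleton, not_or] at hm
      simp [hm.1, hm.2]

theorem IndepFacets.linearIndependent {A : Finset (Facet n)} (hA : IndepFacets A) :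
    LinearIndependent ℤ fun k : A => k.1.1 := by
  classical
  rw [Fintype.linearIndependent_iff]
  intro g hg k
  have := hA (fun m => if h : m ∈ A then (g ⟨m, h⟩ : ℝ) else 0) ?_ k.1 k.2
  · simpa using this
  · rw [← Finset.sum_coe_sort A]
    have h1 := congrArg realVec hg
    have h2 : realVec (∑ i : A, g i • i.1.1) = ∑ i : A, (g i : ℝ) • realVec i.1.1 := by
      ext j
      simp [realVec, Finset.sum_apply]
    rw [h2] at h1
    simp only [Finset.coe_mem, dite_true]
    rw [h1]
    ext j
    simp [realVec]

/-- Facets whose half-open parallelepiped has no nonzero integral point have normal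
vectors that are part of a basis of `ℤ^{n+1}`. -/
theorem IndepFacets.exists_unimodular_extension {A : Finset (Facet n)} (hA : IndepFacets A)
    (hbox : boxPoints A ⊆ {0}) :
    ∃ V : Fin (n + 1) → Fin (n + 1) → ℤ, IsUnit (Matrix.of V).det ∧ ∀ k ∈ A, ∃ i, V i = k.1 := by
  classical
  let W : Submodule ℤ (Fin (n + 1) → ℤ) := Submodule.span ℤ (Set.range fun k : A => k.1.1)
  have hcomb : ∀ x ∈ W, ∃ g : A → ℤ, ∑ k, g k • k.1.1 = x := fun x hx =>
    (Submodule.mem_span_range_iff_exists_fun ℤ).mp hx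
  -- Saturation of `W`: the fractional parts of the rational coefficients of `x` form a box point
  -- and hence vanish. The quotient by `W` is therefore torsion-free, thus free, and a basis of `W`
  -- extends to the whole lattice.
  have hsat : ∀ (m : ℤ) (x : Fin (n + 1) → ℤ), m ≠ 0 → m • x ∈ W → x ∈ W := by
    intro m x hm hx
    obtain ⟨g, hg⟩ := hcomb _ hx
    let r : Facet n → ℝ := fun k => if h : k ∈ A then (g ⟨k, h⟩ : ℝ) / m else 0
    have hr : ∑ k ∈ A, r k • realVec k.1 = realVec x := by
      rw [← Finset.sum_coe_sort A]
      have h1 : (m : ℝ) ≠ 0 := by exact_mod_cast hm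
      have h2 := congrArg realVec hg
      ext j
      have h3 := congrFun h2 j
      simp only [realVec, Finset.sum_apply, Pi.smul_apply, smul_eq_mul] at h3 ⊢
      push_cast at h3
      rw [← mul_right_inj' h1, ← h3, Finset.mul_sum]
      refine Finset.sum_congr rfl fun k _ => ?_
      simp only [r, Finset.coe_mem, dite_true]
      field_simp
    let c : Facet n → ℝ := fun k => Int.fract (r k)
    have hc : c ∈ boxPoints A := by
      refine ⟨fun k hk => by simp [c, r, hk], fun k => ⟨Int.fract_nonneg _, Int.fract_lt_one _⟩,
        x - ∑ k ∈ A, ⌊r k⌋ • k.1, ?_⟩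
      have h2 : realVec (x - ∑ k ∈ A, ⌊r k⌋ • k.1) =
          realVec x - ∑ k ∈ A, ((⌊r k⌋ : ℤ) : ℝ) • realVec k.1 := by
        ext i
        simp [realVec, Finset.sum_apply]
      rw [h2, ← hr, ← Finset.sum_sub_distrib]
      refine Finset.sum_congr rfl fun k hk => ?_
      simp only [c, Int.fract, sub_smul]
    have hc0 : c = 0 := hbox hc
    have hx2 : x = ∑ k ∈ A, ⌊r k⌋ • k.1 := by
      apply realVec_injective
      rw [← hr]
      ext i
      simp only [realVec, Finset.sum_apply, Pi.smul_apply, smul_eq_mul]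
      push_cast
      refine Finset.sum_congr rfl fun k _ => ?_
      have : Int.fract (r k) = 0 := congrFun hc0 k
      rw [Int.fract, sub_eq_zero] at this
      rw [← this]
    rw [hx2]
    exact Submodule.sum_mem _ fun k hk =>
      Submodule.smul_mem _ _ (Submodule.subset_span ⟨⟨k, hk⟩, rfl⟩)
  have htf : Module.IsTorsionFree ℤ ((Fin (n + 1) → ℤ) ⧸ W) := by
    rw [Module.isTorsionFree_iff_smul_eq_zero]
    intro m x hx
    induction x using Submodule.Quotient.induction_on with
    | _ x =>
      rw [← Submodule.Quotient.mk_smul, Submodule.Quotient.mk_eq_zero] at hx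
      by_cases hm : m = 0
      · exact Or.inl hm
      · exact Or.inr ((Submodule.Quotient.mk_eq_zero W).mpr (hsat m x hm hx))
  have : Module.Free ℤ ((Fin (n + 1) → ℤ) ⧸ W) := Module.free_of_finite_type_torsion_free'
  let bQ := Module.Free.chooseBasis ℤ ((Fin (n + 1) → ℤ) ⧸ W)
  let bW : Module.Basis A ℤ W := Module.Basis.span hA.linearIndependent
  let b := bW.sumQuot bQ
  have hcard : Fintype.card (A ⊕ Module.Free.ChooseBasisIndex ℤ ((Fin (n + 1) → ℤ) ⧸ W)) =
      Fintype.card (Fin (n + 1)) := by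
    rw [← Module.finrank_eq_card_basis b, Module.finrank_fin_fun, Fintype.card_fin]
  let b' := b.reindex (Fintype.equivOfCardEq hcard)
  refine ⟨b', ?_, fun k hk => ⟨Fintype.equivOfCardEq hcard (Sum.inl ⟨k, hk⟩), ?_⟩⟩
  · have h1 := (Pi.basisFun ℤ (Fin (n + 1))).isUnit_det b'
    rw [Module.Basis.det_apply] at h1
    have h2 : (Pi.basisFun ℤ (Fin (n + 1))).toMatrix b' = (Matrix.of b').transpose := by
      ext i j
      simp [Module.Basis.toMatrix]
    rwa [h2, Matrix.det_transpose] at h1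
  · simp only [b', Module.Basis.reindex_apply, Equiv.symm_apply_apply, b,
      Module.Basis.sumQuot_inl, bW]
    exact congrArg Subtype.val (Module.Basis.span_apply hA.linearIndependent ⟨k, hk⟩)

namespace LensCharacteristic

/-- A polytope whose facets have integral normal vectors and which, away from the facet
`∑ⱼ ⟨ξⱼ, y⟩ = c`, is unimodular; a neighbourhood of that facet is cut
out by the vectors `ξⱼ`. -/
structure Resolution (ξ : LensCharacteristic n) where
  facets : Finset (Facet n)
  bound : ℝ
  bound_pos : 0 < bound
  mem : ∀ j, (ξ.vec j, (0 : ℝ)) ∈ facets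
  strict : ∀ k ∈ facets, (∃ j, k = (ξ.vec j, (0 : ℝ))) ∨
    ∀ y, (∀ j, 0 ≤ pairing (ξ.vec j) y) → ∑ j, pairing (ξ.vec j) y = bound → 0 < k.height y
  unimodular : ∀ y ∈ polyhedron facets, ∃ (V : Fin (n + 1) → Fin (n + 1) → ℤ) (β : Fin (n + 1) → ℝ),
    IsUnit (Matrix.of V).det ∧ (∀ k ∈ activeSet facets y, ∃ i, (V i, β i) = k) ∧
      ∀ i, (V i, β i) ∈ facets ∨ 0 < Facet.height (V i, β i) y

/-- A cut normal is $\sum a_j\xi_j$ with all $a_j>0$, so on the level set of $c$ it is at least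
$c\min_ja_j$. This exceeds the constant of the facet for large $c$, and there are only finitely many
facets. -/
theorem IsSimpleCut.exists_bound {ξ : LensCharacteristic n} {F : Finset (Facet n)}
    (hF : ξ.IsSimpleCut F) : ∃ c > 0, ∀ k ∈ F, (∃ j, k = (ξ.vec j, (0 : ℝ))) ∨
      ∀ y, (∀ j, 0 ≤ pairing (ξ.vec j) y) → ∑ j, pairing (ξ.vec j) y = c → 0 < k.height y := by
  have hex : ∀ k : Facet n, ∃ C : ℝ, k ∈ F → (∃ j, k = (ξ.vec j, (0 : ℝ))) ∨
      ∀ c, C < c → ∀ y, (∀ j, 0 ≤ pairing (ξ.vec j) y) → ∑ j, pairing (ξ.vec j) y = c →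
        0 < k.height y := by
    intro k
    by_cases hk : k ∈ F
    · rcases hF.pos k hk with h | ⟨a, ha, hak⟩
      · exact ⟨0, fun _ => Or.inl h⟩
      · obtain ⟨i, -, hi⟩ := Finset.exists_min_image Finset.univ a ⟨0, Finset.mem_univ _⟩
        refine ⟨k.2 / a i, fun _ => Or.inr fun c hc y hy hyc => ?_⟩
        rw [Facet.height, sub_pos, pairing_pos_combination hak]
        rw [div_lt_iff₀ (ha i)] at hc
        refine hc.trans_le ?_
        rw [← hyc, Finset.sum_mul]
        exact Finset.sum_le_sum fun j _ => by
          rw [mul_comm]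
          exact mul_le_mul_of_nonneg_right (hi j (Finset.mem_univ j)) (hy j)
    · exact ⟨0, fun h => absurd h hk⟩
  choose C hC using hex
  obtain ⟨c, hc⟩ := (F.finite_toSet.image C).bddAbove
  refine ⟨max c 0 + 1, by positivity, fun k hk => (hC k hk).imp_right fun h => h _ ?_⟩
  have h1 : C k ≤ c := hc ⟨k, hk, rfl⟩
  have h2 := le_max_left c 0
  linarith

theorem nonempty_resolution (ξ : LensCharacteristic n) : Nonempty ξ.Resolution := by
  classical
  obtain ⟨F, hF, hbox⟩ := ξ.exists_unimodular_cut
  obtain ⟨c, hc, hstrict⟩ := hF.exists_bound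
  refine ⟨⟨F, c, hc, hF.mem, hstrict, fun y hy => ?_⟩⟩
  obtain ⟨V, hV, hVA⟩ := (hF.indep y hy).exists_unimodular_extension (hbox y hy)
  -- A basis vector that is not an active normal gets the shift that makes its affine function equal
  -- to 1 at `y`.
  refine ⟨V, fun i => if h : ∃ k ∈ activeSet F y, V i = k.1 then h.choose.2
    else pairing (V i) y - 1, hV, fun k hk => ?_, fun i => ?_⟩
  · obtain ⟨i, hi⟩ := hVA k hk
    have h : ∃ k ∈ activeSet F y, V i = k.1 := ⟨k, hk, hi⟩
    refine ⟨i, ?_⟩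
    beta_reduce
    rw [dif_pos h]
    have := (hF.indep y hy).eq_of_fst_eq h.choose_spec.1 hk (h.choose_spec.2.symm.trans hi)
    have h2 : h.choose.2 = k.2 := by rw [this]
    exact Prod.ext hi h2
  · by_cases h : ∃ k ∈ activeSet F y, V i = k.1
    · left
      beta_reduce
      rw [dif_pos h]
      have h1 : (V i, h.choose.2) = h.choose := Prod.ext h.choose_spec.2 rfl
      rw [h1]
      exact (mem_activeSet.mp h.choose_spec.1).1
    · right
      beta_reduce
      rw [dif_neg h]
      simp [Facet.height]

end LensCharacteristic

end

end GenLens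

namespace GenLens

noncomputable section

variable {n : ℕ}

/-! ### The filling as an identification space -/

theorem torusHom_exp (V : Fin (n + 1) → Fin (n + 1) → ℤ) (φ : Fin (n + 1) → ℝ) :
    torusHom V (fun j => Circle.exp (φ j)) =
      fun i => Circle.exp (Matrix.vecMul φ (realMatrix V) i) := by
  funext i
  change ∏ j, Circle.exp (φ j) ^ V j i = Circle.exp (∑ j, φ j * V j i)
  have h := map_sum Circle.expHom (fun j => φ j * V j i) Finset.univ
  have h2 : ∀ j, Circle.exp (φ j * V j i) = Circle.exp (φ j) ^ V j i := by
    intro j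
    have h3 := map_zsmul Circle.expHom (V j i) (φ j)
    rw [mul_comm, ← zsmul_eq_mul]
    exact congrArg Additive.toMul h3
  simp only [← h2]
  exact (congrArg Additive.toMul h).symm

theorem torusHom_surjective_of_det {V : Fin (n + 1) → Fin (n + 1) → ℤ}
    (hV : (Matrix.of V).det ≠ 0) : Function.Surjective (torusHom V) := by
  intro t
  refine ⟨fun j => Circle.exp (Matrix.vecMul (fun i => Complex.arg (t i)) (realMatrix V)⁻¹ j), ?_⟩
  rw [torusHom_exp, Matrix.vecMul_vecMul, Matrix.nonsing_inv_mul _ (isUnit_det_realMatrix hV),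
    Matrix.vecMul_one]
  funext i
  exact Circle.exp_arg (t i)

theorem continuous_torusHom (V : Fin (n + 1) → Fin (n + 1) → ℤ) : Continuous (torusHom V) := by
  refine continuous_pi fun i => ?_
  change Continuous fun t : Torus n => ∏ j, t j ^ V j i
  exact continuous_finsetProd _ fun j _ => (continuous_apply j).zpow (V j i)

theorem torusHom_mulSingle (V : Fin (n + 1) → Fin (n + 1) → ℤ) (j : Fin (n + 1)) (s : Circle) :
    torusHom V (Pi.mulSingle j s) = fun i => s ^ V j i := by
  funext i
  change ∏ l, (Pi.mulSingle j s : Torus n) l ^ V l i = s ^ V j i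
  rw [Finset.prod_eq_single j]
  · rw [Pi.mulSingle_eq_same]
  · intro l _ hl
    rw [Pi.mulSingle_eq_of_ne hl, one_zpow]
  · simp

/-- The phases of the coordinates of a vector, with phase `1` for a coordinate `0`. -/
def phase (w : EuclideanSpace ℂ (Fin (n + 1))) : Torus n := fun i => Circle.exp (Complex.arg (w i))

theorem phase_mul_norm (w : EuclideanSpace ℂ (Fin (n + 1))) (i : Fin (n + 1)) :
    (phase w i : ℂ) * ‖w i‖ = w i := by
  rw [mul_comm, phase, Circle.coe_exp]
  exact Complex.norm_mul_exp_arg_mul_I (w i)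

namespace LensCharacteristic.Resolution

variable {ξ : LensCharacteristic n} (R : ξ.Resolution)

/-- The function `∑ⱼ ⟨ξⱼ, y⟩`. -/
def level (_ : ξ.Resolution) (y : Fin (n + 1) → ℝ) : ℝ := ∑ j, pairing (ξ.vec j) y

theorem continuous_level : Continuous R.level :=
  continuous_finsetSum _ fun j _ => continuous_pairing (ξ.vec j)

/-- The orbit space of the filling. -/
def polytope : Set (Fin (n + 1) → ℝ) := {y | y ∈ polyhedron R.facets ∧ R.level y ≤ R.bound}

theorem pairing_nonneg {y : Fin (n + 1) → ℝ} (hy : y ∈ polyhedron R.facets) (j : Fin (n + 1)) :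
    0 ≤ pairing (ξ.vec j) y := by
  simpa [Facet.height] using hy _ (R.mem j)

theorem isCompact_polytope : IsCompact R.polytope := by
  refine ξ.isCompact_of_pairing_le ((isClosed_polyhedron R.facets).inter
    (isClosed_le R.continuous_level continuous_const)) (fun _ => R.bound) fun y hy j => ?_
  refine ⟨R.pairing_nonneg hy.1 j, le_trans ?_ hy.2⟩
  exact Finset.single_le_sum (f := fun j => pairing (ξ.vec j) y)
      (fun i _ => R.pairing_nonneg hy.1 i) (Finset.mem_univ j)

instance : CompactSpace R.polytope := isCompact_iff_compactSpace.mp R.isCompact_polytope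

/-- A point with `∑ⱼ ⟨ξⱼ, y⟩ = c` lies in the polytope as soon as all `⟨ξⱼ, y⟩` are nonnegative. -/
theorem mem_polytope_of_level_eq {y : Fin (n + 1) → ℝ} (hy : ∀ j, 0 ≤ pairing (ξ.vec j) y)
    (h : R.level y = R.bound) : y ∈ R.polytope := by
  refine ⟨fun k hk => ?_, h.le⟩
  rcases R.strict k hk with ⟨j, rfl⟩ | h1
  · simpa [Facet.height] using hy j
  · exact (h1 y hy h).le

instance : Nonempty R.polytope := by
  -- The barycentre of the simplex cut out by the level `R.bound`, in the coordinates
  -- $\langle\xi_j,y\rangle$.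
  let Y : Fin (n + 1) → ℝ := fun _ => R.bound / (n + 1)
  have h1 : ∀ j, pairing (ξ.vec j) ((realMatrix ξ.vec)⁻¹.mulVec Y) = Y j := by
    intro j
    rw [← realMatrix_mulVec, Matrix.mulVec_mulVec,
      Matrix.mul_nonsing_inv _ (isUnit_det_realMatrix ξ.det_ne_zero), Matrix.one_mulVec]
  have hb := R.bound_pos
  refine ⟨⟨(realMatrix ξ.vec)⁻¹.mulVec Y, R.mem_polytope_of_level_eq (fun j => ?_) ?_⟩⟩
  · rw [h1]
    simp only [Y]
    positivity
  · simp only [level, h1, Y, Finset.sum_const, Finset.card_univ, Fintype.card_fin, nsmul_eq_mul]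
    push_cast
    field_simp

/-- The isotropy group of the points of the filling over `y`. -/
def isotropy (y : Fin (n + 1) → ℝ) : Subgroup (Torus n) :=
  Subgroup.closure {t | ∃ k ∈ activeSet R.facets y, ∃ s : Circle, t = fun i => s ^ k.1 i}

/-- The relation `(t, y) ∼ (s, x)` iff `y = x` and `t⁻¹ s` lies in the isotropy group. -/
def gluing : Setoid (Torus n × R.polytope) where
  r a b := a.2 = b.2 ∧ a.1⁻¹ * b.1 ∈ R.isotropy a.2
  iseqv :=
    { refl := fun a => ⟨rfl, by
        rw [inv_mul_cancel]
        exact one_mem _⟩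
      symm := by
        rintro ⟨t, p⟩ ⟨s, q⟩ ⟨h, h'⟩
        obtain rfl : p = q := h
        exact ⟨rfl, by simpa using inv_mem h'⟩
      trans := by
        rintro ⟨t, p⟩ ⟨s, q⟩ ⟨r, o⟩ ⟨h, hts⟩ ⟨k, hsr⟩
        obtain rfl : p = q := h
        obtain rfl : p = o := k
        exact ⟨rfl, by simpa [mul_assoc] using mul_mem hts hsr⟩ }

/-- The compact manifold bounded by the lens space. -/
def Filling : Type := Quotient R.gluing

instance : TopologicalSpace R.Filling := inferInstanceAs (TopologicalSpace (Quotient R.gluing))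

instance : CompactSpace R.Filling := inferInstanceAs (CompactSpace (Quotient R.gluing))

/-- The class of `(t, y)`. -/
def toFilling (t : Torus n) (y : R.polytope) : R.Filling := Quotient.mk R.gluing (t, y)

instance : Nonempty R.Filling := ⟨R.toFilling 1 (Classical.arbitrary _)⟩

theorem isQuotientMap_toFilling :
    Topology.IsQuotientMap fun a : Torus n × R.polytope => R.toFilling a.1 a.2 :=
  isQuotientMap_quotient_mk'

theorem toFilling_eq_toFilling {t s : Torus n} {y y' : R.polytope} :
    R.toFilling t y = R.toFilling s y' ↔ y = y' ∧ t⁻¹ * s ∈ R.isotropy y := Quotient.eq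

instance : MulAction (Torus n) R.Filling where
  smul t := Quotient.map (fun a => (t * a.1, a.2)) (by
    rintro ⟨s, p⟩ ⟨r, q⟩ ⟨h, h'⟩
    refine ⟨h, ?_⟩
    change (t * s)⁻¹ * (t * r) ∈ R.isotropy p
    rw [mul_inv_rev, mul_assoc, inv_mul_cancel_left]
    exact h')
  one_smul x := by
    induction x using Quotient.inductionOn with
    | h a => exact congrArg (Quotient.mk _) (Prod.ext (one_mul a.1) rfl)
  mul_smul s t x := by
    induction x using Quotient.inductionOn with
    | h a => exact congrArg (Quotient.mk _) (Prod.ext (mul_assoc s t a.1) rfl)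

/-- The projection to the orbit space. -/
def moment : R.Filling → R.polytope :=
  Quotient.lift (fun a => a.2) fun _ _ h => h.1

@[simp]
theorem moment_toFilling (t : Torus n) (y : R.polytope) : R.moment (R.toFilling t y) = y := rfl

theorem continuous_moment : Continuous R.moment := continuous_snd.quotient_lift _

/-! ### Toric coordinates -/

/-- The data of a toric coordinate system: `n + 1` affine functions with integral linear
parts `Vᵢ`, whose square roots are the moduli of the coordinates up to the factor `scale`. -/
structure Frame (n : ℕ) where
  V : Fin (n + 1) → Fin (n + 1) → ℤ
  shift : Fin (n + 1) → ℝ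
  scale : ℝ
  lower : ℝ
  upper : ℝ
  det_ne_zero : (Matrix.of V).det ≠ 0
  scale_pos : 0 < scale

end LensCharacteristic.Resolution

open LensCharacteristic.Resolution

namespace LensCharacteristic.Resolution.Frame

variable (P : Frame n)

/-- The `i`-th affine function of a frame, as a facet. -/
def row (i : Fin (n + 1)) : Facet n := (P.V i, P.shift i)

/-- The point of the orbit space with given coordinates. -/
def base (w : EuclideanSpace ℂ (Fin (n + 1))) : Fin (n + 1) → ℝ :=
  (realMatrix P.V)⁻¹.mulVec fun i => P.scale ^ 2 * ‖w i‖ ^ 2 + P.shift i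

theorem height_base (w : EuclideanSpace ℂ (Fin (n + 1))) (i : Fin (n + 1)) :
    (P.row i).height (P.base w) = P.scale ^ 2 * ‖w i‖ ^ 2 := by
  rw [Facet.height, row, base, ← realMatrix_mulVec, Matrix.mulVec_mulVec,
    Matrix.mul_nonsing_inv _ (isUnit_det_realMatrix P.det_ne_zero), Matrix.one_mulVec]
  ring

theorem continuous_base : Continuous P.base := by
  unfold base Matrix.mulVec dotProduct
  fun_prop

theorem base_rotate (t : Torus n) (w : EuclideanSpace ℂ (Fin (n + 1))) :
    P.base (rotate t w) = P.base w := by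
  simp only [base, rotate, norm_mul, Circle.norm_coe, one_mul]

/-- A point with prescribed phases over a point of the orbit space. -/
def lift (s : Torus n) (y : Fin (n + 1) → ℝ) : EuclideanSpace ℂ (Fin (n + 1)) :=
  WithLp.toLp 2 fun i => (s i : ℂ) * ((P.scale⁻¹ * √((P.row i).height y) : ℝ) : ℂ)

theorem lift_apply (s : Torus n) (y : Fin (n + 1) → ℝ) (i : Fin (n + 1)) :
    P.lift s y i = (s i : ℂ) * ((P.scale⁻¹ * √((P.row i).height y) : ℝ) : ℂ) := rfl

theorem norm_lift (s : Torus n) (y : Fin (n + 1) → ℝ) (i : Fin (n + 1)) :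
    ‖P.lift s y i‖ = P.scale⁻¹ * √((P.row i).height y) := by
  rw [lift_apply, norm_mul, Circle.norm_coe, one_mul, Complex.norm_real, Real.norm_eq_abs,
    abs_of_nonneg (mul_nonneg (inv_nonneg.mpr P.scale_pos.le) (Real.sqrt_nonneg _))]

theorem continuous_lift :
    Continuous fun a : Torus n × (Fin (n + 1) → ℝ) => P.lift a.1 a.2 := by
  refine (PiLp.continuous_toLp 2 _).comp (continuous_pi fun i => ?_)
  refine (continuous_subtype_val.comp ((continuous_apply i).comp continuous_fst)).mul
    (Complex.continuous_ofReal.comp (continuous_const.mul (Real.continuous_sqrt.comp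
      ((continuous_height _).comp continuous_snd))))

theorem rotate_lift (t s : Torus n) (y : Fin (n + 1) → ℝ) :
    rotate t (P.lift s y) = P.lift (t * s) y := by
  ext i
  change (t i : ℂ) * ((s i : ℂ) * _) = ((t i * s i : Circle) : ℂ) * _
  rw [Circle.coe_mul, mul_assoc]

/-- Nonnegativity matters: the real square root is 0 at negative arguments, so a negative affine
function would be forgotten by `lift`. -/
theorem base_lift {s : Torus n} {y : Fin (n + 1) → ℝ} (hy : ∀ i, 0 ≤ (P.row i).height y) :
    P.base (P.lift s y) = y := by
  have h1 : (realMatrix P.V).mulVec y =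
      fun i => P.scale ^ 2 * ‖P.lift s y i‖ ^ 2 + P.shift i := by
    funext i
    rw [norm_lift, mul_pow, Real.sq_sqrt (hy i), inv_pow,
      mul_inv_cancel_left₀ (pow_ne_zero 2 P.scale_pos.ne')]
    simp [Facet.height, row, realMatrix_mulVec]
  rw [base, ← h1, Matrix.mulVec_mulVec,
    Matrix.nonsing_inv_mul _ (isUnit_det_realMatrix P.det_ne_zero), Matrix.one_mulVec]

theorem lift_phase_base (w : EuclideanSpace ℂ (Fin (n + 1))) :
    P.lift (phase w) (P.base w) = w := by
  ext i
  rw [lift_apply, height_base, ← mul_pow, Real.sqrt_sq (by have := P.scale_pos; positivity),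
    inv_mul_cancel_left₀ P.scale_pos.ne', phase_mul_norm]

end LensCharacteristic.Resolution.Frame

end

end GenLens

/-! ### Toric parametrizations of the filling. -/

namespace GenLens

noncomputable section

variable {n : ℕ}

namespace LensCharacteristic.Resolution

variable {ξ : LensCharacteristic n} (R : ξ.Resolution)

/-- The part of the orbit space where the coordinates of a frame are defined. -/
def cell (P : Frame n) : Set (Fin (n + 1) → ℝ) :=
  {y | (∀ k ∈ R.facets, (∃ i, P.row i = k) ∨ 0 < k.height y) ∧
    (∀ i, P.row i ∈ R.facets ∨ 0 < (P.row i).height y) ∧ P.lower < R.level y ∧ R.level y < P.upper}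

/-- The coordinate domain of a frame. -/
def domain (P : Frame n) : Set (EuclideanSpace ℂ (Fin (n + 1))) := {w | P.base w ∈ R.cell P}

theorem isOpen_cell (P : Frame n) : IsOpen (R.cell P) := by
  have h1 : IsOpen {y : Fin (n + 1) → ℝ | ∀ k ∈ R.facets, (∃ i, P.row i = k) ∨ 0 < k.height y} := by
    have : {y : Fin (n + 1) → ℝ | ∀ k ∈ R.facets, (∃ i, P.row i = k) ∨ 0 < k.height y} =
        ⋂ k ∈ R.facets, {y | (∃ i, P.row i = k) ∨ 0 < k.height y} := by
      ext y
      simp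
    rw [this]
    exact isOpen_biInter_finset fun k _ =>
      isOpen_const.union (isOpen_lt continuous_const (continuous_height k))
  have h2 : IsOpen {y : Fin (n + 1) → ℝ | ∀ i, P.row i ∈ R.facets ∨ 0 < (P.row i).height y} := by
    have : {y : Fin (n + 1) → ℝ | ∀ i, P.row i ∈ R.facets ∨ 0 < (P.row i).height y} =
        ⋂ i, {y | P.row i ∈ R.facets ∨ 0 < (P.row i).height y} := by
      ext y
      simp
    rw [this]
    exact isOpen_iInter_of_finite fun i =>
      isOpen_const.union (isOpen_lt continuous_const (continuous_height _))
  exact h1.inter (h2.inter ((isOpen_lt continuous_const R.continuous_level).inter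
    (isOpen_lt R.continuous_level continuous_const)))

theorem isOpen_domain (P : Frame n) : IsOpen (R.domain P) :=
  (R.isOpen_cell P).preimage P.continuous_base

theorem rotate_mem_domain {P : Frame n} (t : Torus n) {w : EuclideanSpace ℂ (Fin (n + 1))}
    (hw : w ∈ R.domain P) : rotate t w ∈ R.domain P := by
  change P.base (rotate t w) ∈ R.cell P
  rw [P.base_rotate]
  exact hw

theorem base_mem_polyhedron {P : Frame n} {w : EuclideanSpace ℂ (Fin (n + 1))}
    (hw : w ∈ R.domain P) : P.base w ∈ polyhedron R.facets := by
  intro k hk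
  rcases hw.1 k hk with ⟨i, rfl⟩ | h
  · rw [P.height_base]
    positivity
  · exact h.le

theorem height_row_nonneg {P : Frame n} {y : Fin (n + 1) → ℝ} (hy : y ∈ polyhedron R.facets)
    (hyP : y ∈ R.cell P) (i : Fin (n + 1)) : 0 ≤ (P.row i).height y := by
  rcases hyP.2.1 i with h | h
  · exact hy _ h
  · exact h.le

/-- The isotropy groups over the cell of a frame. -/
theorem isotropy_eq_map {P : Frame n} {y : Fin (n + 1) → ℝ} (hyP : y ∈ R.cell P) {t : Torus n} :
    t ∈ R.isotropy y ↔
      ∃ s : Torus n, (∀ i, (P.row i).height y ≠ 0 → s i = 1) ∧ torusHom P.V s = t := by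
  let S : Subgroup (Torus n) :=
    { carrier := {s | ∀ i, (P.row i).height y ≠ 0 → s i = 1}
      one_mem' := fun _ _ => rfl
      mul_mem' := fun {a b} ha hb i hi => by simp [ha i hi, hb i hi]
      inv_mem' := fun {a} ha i hi => by simp [ha i hi] }
  constructor
  · intro ht
    have hle : R.isotropy y ≤ S.map (torusHom P.V) := by
      refine (Subgroup.closure_le _).mpr ?_
      rintro _ ⟨k, hk, s, rfl⟩
      obtain ⟨hkF, hk0⟩ := mem_activeSet.mp hk
      rcases hyP.1 k hkF with ⟨i, rfl⟩ | h
      · refine ⟨Pi.mulSingle i s, fun j hj => ?_, torusHom_mulSingle _ _ _⟩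
        have : j ≠ i := by
          rintro rfl
          exact hj hk0
        exact Pi.mulSingle_eq_of_ne (M := fun _ => Circle) this s
      · exact absurd hk0 h.ne'
    exact hle ht
  · rintro ⟨s, hs, rfl⟩
    have h1 : s = ∏ i, Pi.mulSingle i (s i) := (Finset.univ_prod_mulSingle s).symm
    rw [h1, map_prod]
    refine Subgroup.prod_mem _ fun i _ => ?_
    rw [torusHom_mulSingle]
    by_cases hi : (P.row i).height y = 0
    · rcases hyP.2.1 i with h | h
      · exact Subgroup.subset_closure ⟨P.row i, mem_activeSet.mpr ⟨h, hi⟩, s i, rfl⟩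
      · exact absurd hi h.ne'
    · rw [hs i hi]
      simp only [one_zpow]
      exact one_mem (R.isotropy y)

open Classical in
/-- The map from the coordinate domain of a frame to the filling. -/
def param (P : Frame n) (w : EuclideanSpace ℂ (Fin (n + 1))) : R.Filling :=
  if h : P.base w ∈ R.polytope then R.toFilling (torusHom P.V (phase w)) ⟨P.base w, h⟩
  else Classical.arbitrary _

theorem param_of_mem {P : Frame n} {w : EuclideanSpace ℂ (Fin (n + 1))}
    (h : P.base w ∈ R.polytope) :
    R.param P w = R.toFilling (torusHom P.V (phase w)) ⟨P.base w, h⟩ := dif_pos h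

theorem moment_param {P : Frame n} {w : EuclideanSpace ℂ (Fin (n + 1))}
    (h : P.base w ∈ R.polytope) : (R.moment (R.param P w) : Fin (n + 1) → ℝ) = P.base w := by
  rw [R.param_of_mem h, moment_toFilling]

/-- The isotropy over the cell is the image of the tuples supported on vanishing coordinates. So the
phases of those coordinates are immaterial, and the remaining ones are known up to the kernel. -/
theorem toFilling_torusHom_congr {P : Frame n} {y : R.polytope}
    (hy : (y : Fin (n + 1) → ℝ) ∈ R.cell P)
    {s s' : Torus n} : R.toFilling (torusHom P.V s) y = R.toFilling (torusHom P.V s') y ↔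
      ∃ g ∈ (torusHom P.V).ker, ∀ i, (P.row i).height y ≠ 0 → s' i = g i * s i := by
  rw [toFilling_eq_toFilling, R.isotropy_eq_map hy]
  simp only [true_and]
  constructor
  · rintro ⟨a, ha, h⟩
    refine ⟨s⁻¹ * s' * a⁻¹, ?_, fun i hi => ?_⟩
    · rw [MonoidHom.mem_ker, map_mul, map_mul, map_inv, map_inv, h, mul_inv_cancel]
    · simp [ha i hi]
  · rintro ⟨g, hg, h⟩
    refine ⟨g⁻¹ * s⁻¹ * s', fun i hi => ?_, ?_⟩
    · simp only [Pi.mul_apply, Pi.inv_apply, h i hi]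
      rw [← mul_inv, inv_mul_cancel]
    · rw [map_mul, map_mul, map_inv, map_inv, MonoidHom.mem_ker.mp hg, inv_one, one_mul]

/-- The phases of the lift agree with `s` only at nonzero coordinates; the discrepancy at the others
is absorbed by the isotropy group. -/
theorem param_lift {P : Frame n} (s : Torus n) {y : R.polytope}
    (hy : (y : Fin (n + 1) → ℝ) ∈ R.cell P) :
    R.param P (P.lift s y) = R.toFilling (torusHom P.V s) y := by
  have h0 := R.height_row_nonneg y.2.1 hy
  have h1 : P.base (P.lift s y) = y := P.base_lift h0
  have h2 : P.base (P.lift s y) ∈ R.polytope := by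
    rw [h1]
    exact y.2
  rw [R.param_of_mem h2]
  have h3 : (⟨P.base (P.lift s y), h2⟩ : R.polytope) = y := Subtype.ext h1
  rw [h3, R.toFilling_torusHom_congr hy]
  refine ⟨1, one_mem _, fun i hi => ?_⟩
  have h4 := phase_mul_norm (P.lift s y) i
  rw [P.norm_lift, P.lift_apply] at h4
  have h5 : ((P.scale⁻¹ * √((P.row i).height y) : ℝ) : ℂ) ≠ 0 := by
    have := P.scale_pos
    have := Real.sqrt_pos.mpr (lt_of_le_of_ne (h0 i) hi.symm)
    exact_mod_cast (by positivity : (0 : ℝ) < P.scale⁻¹ * √((P.row i).height y)).ne'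
  rw [Pi.one_apply, one_mul]
  exact (Circle.ext (mul_right_cancel₀ h5 h4)).symm

theorem exists_param_eq (P : Frame n) (m : R.Filling)
    (hm : (R.moment m : Fin (n + 1) → ℝ) ∈ R.cell P) :
    ∃ w ∈ R.domain P, P.base w = R.moment m ∧ R.param P w = m := by
  obtain ⟨⟨t, y⟩, rfl⟩ := R.isQuotientMap_toFilling.surjective m
  obtain ⟨s, rfl⟩ := torusHom_surjective_of_det P.det_ne_zero t
  have h := P.base_lift (s := s) (R.height_row_nonneg y.2.1 hm)
  refine ⟨P.lift s y, ?_, h, R.param_lift s hm⟩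
  change P.base _ ∈ R.cell P
  rw [h]
  exact hm

/-- This makes `param` a quotient map by rotations: by none but the identity for a unimodular frame,
and by $G_\xi$ for the vectors $\xi_j$. -/
theorem param_eq_param_iff {P : Frame n} {w w' : EuclideanSpace ℂ (Fin (n + 1))}
    (hw : w ∈ R.domain P) (hwp : P.base w ∈ R.polytope) (hwp' : P.base w' ∈ R.polytope) :
    R.param P w = R.param P w' ↔ ∃ g ∈ (torusHom P.V).ker, w' = rotate g w := by
  constructor
  · intro h
    have hb : P.base w = P.base w' := by rw [← R.moment_param hwp, ← R.moment_param hwp', h]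
    rw [R.param_of_mem hwp, R.param_of_mem hwp'] at h
    have h3 : (⟨P.base w', hwp'⟩ : R.polytope) = ⟨P.base w, hwp⟩ := Subtype.ext hb.symm
    rw [h3, R.toFilling_torusHom_congr (y := ⟨P.base w, hwp⟩) hw] at h
    obtain ⟨g, hg, h⟩ := h
    refine ⟨g, hg, ?_⟩
    rw [← P.lift_phase_base w, ← P.lift_phase_base w', P.rotate_lift, ← hb]
    ext i
    rw [P.lift_apply, P.lift_apply]
    by_cases hi : (P.row i).height (P.base w) = 0
    · rw [hi]
      simp
    · rw [h i hi]
      rfl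
  · rintro ⟨g, hg, rfl⟩
    conv_lhs => rw [← P.lift_phase_base w]
    conv_rhs => rw [← P.lift_phase_base w, P.rotate_lift]
    rw [R.param_lift (y := ⟨P.base w, hwp⟩) _ hw, R.param_lift (y := ⟨P.base w, hwp⟩) _ hw, map_mul,
      MonoidHom.mem_ker.mp hg, one_mul]

theorem torusHom_smul_param {P : Frame n} (t : Torus n) {w : EuclideanSpace ℂ (Fin (n + 1))}
    (hw : w ∈ R.domain P) (hwp : P.base w ∈ R.polytope) :
    torusHom P.V t • R.param P w = R.param P (rotate t w) := by
  conv_lhs => rw [← P.lift_phase_base w]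
  conv_rhs => rw [← P.lift_phase_base w, P.rotate_lift]
  rw [R.param_lift (y := ⟨P.base w, hwp⟩) _ hw, R.param_lift (y := ⟨P.base w, hwp⟩) _ hw, map_mul]
  rfl

end LensCharacteristic.Resolution

end

end GenLens

/-! ### Local inverses of the parametrizations. -/

open scoped Topology

namespace GenLens

noncomputable section

variable {n : ℕ}

theorem continuous_rotate (t : Torus n) :
    Continuous (rotate t : EuclideanSpace ℂ (Fin (n + 1)) → _) := by
  unfold rotate
  fun_prop

/-- The closed unit ball of `ℂ^{n+1}`. -/
abbrev Ball (n : ℕ) : Type := Metric.closedBall (0 : EuclideanSpace ℂ (Fin (n + 1))) 1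

instance : Nonempty (Ball n) := ⟨⟨0, by simp⟩⟩

namespace LensCharacteristic.Resolution

variable {ξ : LensCharacteristic n} (R : ξ.Resolution)

/-- The coordinates near the boundary, with values in the quotient of the unit ball by `G_ξ`. -/
def boundaryFrame : Frame n where
  V := ξ.vec
  shift := 0
  scale := √R.bound
  lower := 0
  upper := R.bound + 1
  det_ne_zero := ξ.det_ne_zero
  scale_pos := Real.sqrt_pos.mpr R.bound_pos

/-- A frame whose coordinates take their values in the closed unit ball, with the unit sphere
corresponding to the boundary of the filling. -/
structure IsPatch (P : Frame n) : Prop where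
  norm_le : ∀ w ∈ R.domain P, (‖w‖ ≤ 1 ↔ R.level (P.base w) ≤ R.bound)
  norm_lt : ∀ w ∈ R.domain P, (‖w‖ < 1 ↔ R.level (P.base w) < R.bound)
  free : ∀ g ∈ (torusHom P.V).ker, ∀ w ∈ R.domain P, rotate g w = w → g = 1
  finite : Finite (torusHom P.V).ker
  kind : IsUnit (Matrix.of P.V).det ∨ P = R.boundaryFrame

variable {R} {P : Frame n}

theorem IsPatch.base_mem (hP : R.IsPatch P) {w : EuclideanSpace ℂ (Fin (n + 1))}
    (hw : w ∈ R.domain P) (hw1 : ‖w‖ ≤ 1) : P.base w ∈ R.polytope :=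
  ⟨R.base_mem_polyhedron hw, (hP.norm_le w hw).mp hw1⟩

theorem lift_mem_domain {s : Torus n} {y : R.polytope} (hy : (y : Fin (n + 1) → ℝ) ∈ R.cell P) :
    P.lift s y ∈ R.domain P := by
  change P.base _ ∈ R.cell P
  rw [P.base_lift (R.height_row_nonneg y.2.1 hy)]
  exact hy

theorem IsPatch.norm_lift_le (hP : R.IsPatch P) {s : Torus n} {y : R.polytope}
    (hy : (y : Fin (n + 1) → ℝ) ∈ R.cell P) : ‖P.lift s y‖ ≤ 1 := by
  rw [hP.norm_le _ (lift_mem_domain hy), P.base_lift (R.height_row_nonneg y.2.1 hy)]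
  exact y.2.2

variable (R P) in
theorem isQuotientMap_toFilling_torusHom :
    Topology.IsQuotientMap fun a : Torus n × R.polytope => R.toFilling (torusHom P.V a.1) a.2 := by
  have hc : Continuous fun a : Torus n × R.polytope => (torusHom P.V a.1, a.2) :=
    ((continuous_torusHom P.V).comp continuous_fst).prodMk continuous_snd
  have h1 : Topology.IsQuotientMap fun a : Torus n × R.polytope => (torusHom P.V a.1, a.2) :=
    hc.isClosedMap.isQuotientMap hc
      ((torusHom_surjective_of_det P.det_ne_zero).prodMap Function.surjective_id)
  exact R.isQuotientMap_toFilling.comp h1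

/-- Nothing places `y` in the cell beforehand. A row that is not a facet is positive at the base of
the lift; if it were negative at `y`, the square root, being 0 there, would make it vanish at that
base. -/
theorem eq_base_of_lift_mem_domain {s : Torus n} {y : R.polytope}
    (h : P.lift s y ∈ R.domain P) : P.base (P.lift s y) = y := by
  refine P.base_lift fun i => ?_
  rcases h.2.1 i with h1 | h1
  · exact y.2.1 _ h1
  · rw [P.height_base, P.norm_lift] at h1
    by_contra! hlt
    rw [Real.sqrt_eq_zero_of_nonpos hlt.le] at h1
    simp at h1

/-- The function `phase` jumps, so the formula does not show continuity. Instead, within the domain,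
the preimage of a closed set is the image under the continuous map `lift` of a closed subset of a
compact space. -/
theorem IsPatch.continuousOn_param (hP : R.IsPatch P) :
    ContinuousOn (R.param P) (R.domain P ∩ Metric.closedBall 0 1) := by
  rw [continuousOn_iff_isClosed]
  intro C hC
  let K : Set (Torus n × R.polytope) := {a | R.toFilling (torusHom P.V a.1) a.2 ∈ C}
  have hK : IsClosed K := hC.preimage (R.isQuotientMap_toFilling_torusHom P).continuous
  have hcl : Continuous fun a : Torus n × R.polytope => P.lift a.1 a.2 :=
    P.continuous_lift.comp (continuous_fst.prodMk (continuous_subtype_val.comp continuous_snd))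
  refine ⟨(fun a : Torus n × R.polytope => P.lift a.1 a.2) '' K,
    (hK.isCompact.image hcl).isClosed, ?_⟩
  ext w
  constructor
  · rintro ⟨hwC, hw, hw1⟩
    refine ⟨⟨(phase w, ⟨P.base w, hP.base_mem hw (mem_closedBall_zero_iff.mp hw1)⟩), ?_,
      P.lift_phase_base w⟩, hw, hw1⟩
    have h1 : R.param P w ∈ C := hwC
    rwa [R.param_of_mem (hP.base_mem hw (mem_closedBall_zero_iff.mp hw1))] at h1
  · rintro ⟨⟨⟨s, y⟩, hK, rfl⟩, hw, hw1⟩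
    refine ⟨?_, hw, hw1⟩
    have hy : (y : Fin (n + 1) → ℝ) ∈ R.cell P := by
      rw [← eq_base_of_lift_mem_domain hw]
      exact hw
    change R.param P (P.lift s y) ∈ C
    rw [R.param_lift s hy]
    exact hK

/-- Pulled back to pairs of phases and points of the polytope, the image becomes the union over the
kernel of the open conditions that a rotated lift lies in `O`. -/
theorem IsPatch.isOpen_image_param (hP : R.IsPatch P) {O : Set (EuclideanSpace ℂ (Fin (n + 1)))}
    (hO : IsOpen O) : IsOpen (R.param P '' (O ∩ (R.domain P ∩ Metric.closedBall 0 1))) := by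
  rw [← (R.isQuotientMap_toFilling_torusHom P).isOpen_preimage]
  have hcl : Continuous fun a : Torus n × R.polytope => P.lift a.1 a.2 :=
    P.continuous_lift.comp (continuous_fst.prodMk (continuous_subtype_val.comp continuous_snd))
  have hset : (fun a : Torus n × R.polytope => R.toFilling (torusHom P.V a.1) a.2) ⁻¹'
      (R.param P '' (O ∩ (R.domain P ∩ Metric.closedBall 0 1))) =
      {a | (a.2 : Fin (n + 1) → ℝ) ∈ R.cell P} ∩
        ⋃ g ∈ (torusHom P.V).ker, {a | rotate g (P.lift a.1 a.2) ∈ O} := by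
    ext ⟨s, y⟩
    simp only [Set.mem_preimage, Set.mem_inter_iff, Set.mem_ofPred_eq, Set.mem_iUnion]
    constructor
    · rintro ⟨w, ⟨hwO, hw, hw1⟩, h⟩
      have hwp := hP.base_mem hw (mem_closedBall_zero_iff.mp hw1)
      have hyb : P.base w = y := by
        rw [← R.moment_param hwp, h, moment_toFilling]
      have hy : (y : Fin (n + 1) → ℝ) ∈ R.cell P := by
        rw [← hyb]
        exact hw
      rw [← R.param_lift s hy, eq_comm, R.param_eq_param_iff (lift_mem_domain hy)
        (hP.base_mem (lift_mem_domain hy) (hP.norm_lift_le hy)) hwp] at h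
      obtain ⟨g, hg, rfl⟩ := h
      exact ⟨hy, g, hg, hwO⟩
    · rintro ⟨hy, g, hg, hgO⟩
      rw [P.rotate_lift] at hgO
      refine ⟨P.lift (g * s) y, ⟨hgO, lift_mem_domain hy,
        mem_closedBall_zero_iff.mpr (hP.norm_lift_le hy)⟩, ?_⟩
      rw [R.param_lift _ hy, map_mul, MonoidHom.mem_ker.mp hg, one_mul]
  rw [hset]
  refine ((R.isOpen_cell P).preimage (continuous_subtype_val.comp continuous_snd)).inter
    (isOpen_biUnion fun g _ => hO.preimage ((continuous_rotate g).comp hcl))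

/-- The kernel is finite and acts freely, so `z` can be separated from each of its nontrivial
translates and the neighbourhoods intersected. -/
theorem IsPatch.exists_free_nhds (hP : R.IsPatch P) {z : EuclideanSpace ℂ (Fin (n + 1))}
    (hz : z ∈ R.domain P) : ∃ O, IsOpen O ∧ z ∈ O ∧ O ⊆ R.domain P ∧
      ∀ w ∈ O, ∀ g ∈ (torusHom P.V).ker, rotate g w ∈ O → g = 1 := by
  have hfin := hP.finite
  have hex : ∀ g : (torusHom P.V).ker, ∃ O, IsOpen O ∧ z ∈ O ∧
      ∀ w ∈ O, rotate g w ∈ O → (g : Torus n) = 1 := by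
    intro g
    by_cases hg : (g : Torus n) = 1
    · exact ⟨Set.univ, isOpen_univ, Set.mem_univ _, fun _ _ _ => hg⟩
    · have hne : z ≠ rotate g z := fun h => hg (hP.free g g.2 z hz h.symm)
      obtain ⟨A, A', hA, hA', hzA, hzA', hd⟩ := t2_separation hne
      refine ⟨A ∩ rotate (g : Torus n) ⁻¹' A', hA.inter (hA'.preimage (continuous_rotate _)),
        ⟨hzA, hzA'⟩, fun w hw hgw => ?_⟩
      exact absurd hw.2 (Set.disjoint_left.mp hd hgw.1)
  choose O hO hzO hfree using hex
  refine ⟨R.domain P ∩ ⋂ g, O g, (R.isOpen_domain P).inter (isOpen_iInter_of_finite hO),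
    ⟨hz, Set.mem_iInter.mpr hzO⟩, Set.inter_subset_left, fun w hw g hg hgw => ?_⟩
  exact hfree ⟨g, hg⟩ w (Set.mem_iInter.mp hw.2 _) (Set.mem_iInter.mp hgw.2 _)

/-- The local inverses of the parametrizations. -/
def IsSection (R : ξ.Resolution) (P : Frame n) (s : OpenPartialHomeomorph R.Filling (Ball n)) :
    Prop :=
  ∀ z ∈ s.target, (z : EuclideanSpace ℂ (Fin (n + 1))) ∈ R.domain P ∧ s.symm z = R.param P z

theorem IsPatch.exists_section (hP : R.IsPatch P) {z : Ball n}
    (hz : (z : EuclideanSpace ℂ (Fin (n + 1))) ∈ R.domain P) :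
    ∃ s : OpenPartialHomeomorph R.Filling (Ball n), R.IsSection P s ∧ z ∈ s.target := by
  obtain ⟨O, hO, hzO, hOd, hfree⟩ := hP.exists_free_nhds hz
  let f : Ball n → R.Filling := fun w => R.param P w
  let S : Set (Ball n) := Subtype.val ⁻¹' O
  have hball : ∀ w : Ball n, ‖(w : EuclideanSpace ℂ (Fin (n + 1)))‖ ≤ 1 := fun w =>
    mem_closedBall_zero_iff.mp w.2
  have hinj : Set.InjOn f S := by
    intro w hw w' hw' h
    have h1 := (R.param_eq_param_iff (hOd hw) (hP.base_mem (hOd hw) (hball w))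
      (hP.base_mem (hOd hw') (hball w'))).mp h
    obtain ⟨g, hg, h2⟩ := h1
    have h3 : g = 1 := hfree w hw g hg (h2 ▸ hw')
    apply Subtype.ext
    rw [h2, h3]
    ext i
    simp [rotate]
  have hS : IsOpen S := hO.preimage continuous_subtype_val
  have hcont : ContinuousOn f S := hP.continuousOn_param.comp continuous_subtype_val.continuousOn
    fun w hw => ⟨hOd hw, w.2⟩
  have hopen : ∀ U : Set (Ball n), IsOpen U → IsOpen (f '' (U ∩ S)) := by
    intro U hU
    obtain ⟨U', hU', rfl⟩ := isOpen_induced_iff.mp hU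
    have : f '' (Subtype.val ⁻¹' U' ∩ S) =
        R.param P '' ((U' ∩ O) ∩ (R.domain P ∩ Metric.closedBall 0 1)) := by
      ext m
      constructor
      · rintro ⟨w, hw, rfl⟩
        exact ⟨w, ⟨hw, hOd hw.2, w.2⟩, rfl⟩
      · rintro ⟨w, ⟨hw, -, hw1⟩, rfl⟩
        exact ⟨⟨w, hw1⟩, hw, rfl⟩
    rw [this]
    exact hP.isOpen_image_param (hU'.inter hO)
  let e : PartialEquiv (Ball n) R.Filling := hinj.toPartialEquiv
  have he : IsOpenMap (e.source.domRestrict e) := by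
    intro U hU
    obtain ⟨U', hU', rfl⟩ := isOpen_induced_iff.mp hU
    have : e.source.domRestrict e '' (Subtype.val ⁻¹' U') = f '' (U' ∩ S) := by
      ext m
      constructor
      · rintro ⟨w, hw, rfl⟩
        exact ⟨w, ⟨hw, w.2⟩, rfl⟩
      · rintro ⟨w, hw, rfl⟩
        exact ⟨⟨w, hw.2⟩, hw.1, rfl⟩
    rw [this]
    exact hopen U' hU'
  let s := (OpenPartialHomeomorph.ofContinuousOpenRestrict e hcont he hS).symm
  exact ⟨s, fun w hw => ⟨hOd hw, rfl⟩, hzO⟩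

end LensCharacteristic.Resolution

end

end GenLens

/-! ### Covering by patches and the Hausdorff property. -/

open scoped Topology

namespace GenLens

noncomputable section

variable {n : ℕ}

theorem torusHom_torusHom (m V : Matrix (Fin (n + 1)) (Fin (n + 1)) ℤ) (s : Torus n) :
    torusHom V (torusHom m s) = torusHom (m * V) s := by
  funext i
  change ∏ l, (∏ j, s j ^ m j l) ^ V l i = ∏ j, s j ^ (m * V) j i
  simp only [← Finset.prod_zpow, ← zpow_mul]
  rw [Finset.prod_comm]
  refine Finset.prod_congr rfl fun j _ => ?_
  rw [Matrix.mul_apply]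
  induction (Finset.univ : Finset (Fin (n + 1))) using Finset.induction_on with
  | empty => simp
  | insert a u ha ih => rw [Finset.prod_insert ha, Finset.sum_insert ha, zpow_add, ih]

theorem torusHom_one (s : Torus n) : torusHom (1 : Matrix (Fin (n + 1)) (Fin (n + 1)) ℤ) s = s := by
  funext i
  change ∏ j, s j ^ (1 : Matrix (Fin (n + 1)) (Fin (n + 1)) ℤ) j i = s i
  rw [Finset.prod_eq_single i]
  · simp
  · intro j _ hj
    rw [Matrix.one_apply_ne hj, zpow_zero]
  · simp

theorem ker_torusHom_of_isUnit {V : Fin (n + 1) → Fin (n + 1) → ℤ} (hV : IsUnit (Matrix.of V).det)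
    {s : Torus n} (hs : s ∈ (torusHom V).ker) : s = 1 := by
  have h := torusHom_torusHom (Matrix.of V) (Matrix.of V)⁻¹ s
  rw [Matrix.mul_nonsing_inv _ hV, torusHom_one] at h
  have h1 : torusHom (Matrix.of V) s = 1 := hs
  rw [h1, map_one] at h
  exact h.symm

namespace LensCharacteristic.Resolution

variable {ξ : LensCharacteristic n} (R : ξ.Resolution)

theorem level_base_boundaryFrame (w : EuclideanSpace ℂ (Fin (n + 1))) :
    R.level (R.boundaryFrame.base w) = R.bound * ‖w‖ ^ 2 := by
  rw [EuclideanSpace.norm_sq_eq, Finset.mul_sum]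
  refine Finset.sum_congr rfl fun j _ => ?_
  have h := R.boundaryFrame.height_base w j
  simp only [Facet.height, Frame.row, boundaryFrame, Pi.zero_apply, sub_zero,
    Real.sq_sqrt R.bound_pos.le] at h ⊢
  exact h

theorem isPatch_boundaryFrame : R.IsPatch R.boundaryFrame where
  norm_le w _ := by
    rw [level_base_boundaryFrame, mul_le_iff_le_one_right R.bound_pos,
      sq_le_one_iff₀ (norm_nonneg w)]
  norm_lt w _ := by
    rw [level_base_boundaryFrame, mul_lt_iff_lt_one_right R.bound_pos,
      sq_lt_one_iff₀ (norm_nonneg w)]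
  free g hg w hw h := by
    -- The condition `lower = 0` on the level excludes the origin; any other point can be scaled to
    -- the sphere, where $G_\xi$ acts freely.
    have hw0 : w ≠ 0 := by
      rintro rfl
      have := hw.2.2.1
      rw [level_base_boundaryFrame] at this
      simp [boundaryFrame] at this
    let z : OddSphere n := ⟨(‖w‖⁻¹ : ℝ) • w, by
      rw [mem_sphere_zero_iff_norm, norm_smul, norm_inv, norm_norm,
        inv_mul_cancel₀ (norm_ne_zero_iff.mpr hw0)]⟩
    refine ξ.free g hg z (Subtype.ext ?_)
    ext i
    have h1 : (g i : ℂ) * w i = w i := congrFun (congrArg WithLp.ofLp h) i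
    rw [smul_coord]
    change (g i : ℂ) * ((‖w‖⁻¹ : ℝ) • w i) = (‖w‖⁻¹ : ℝ) • w i
    rw [mul_smul_comm, h1]
  finite := ξ.finite_group
  kind := Or.inr rfl

theorem mem_cell_boundaryFrame {y : Fin (n + 1) → ℝ} (hy : y ∈ R.polytope)
    (h : R.level y = R.bound) : y ∈ R.cell R.boundaryFrame := by
  refine ⟨fun k hk => ?_, fun i => Or.inl (R.mem i), ?_, ?_⟩
  · rcases R.strict k hk with ⟨j, rfl⟩ | h1
    · exact Or.inl ⟨j, rfl⟩
    · exact Or.inr (h1 y (R.pairing_nonneg hy.1) h)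
  · rw [h]
    exact R.bound_pos
  · rw [h]
    exact lt_add_one _

theorem exists_interior_patch {y : Fin (n + 1) → ℝ} (hy : y ∈ R.polytope)
    (h : R.level y < R.bound) : ∃ P, R.IsPatch P ∧ y ∈ R.cell P ∧ ∀ w ∈ R.domain P, ‖w‖ < 1 := by
  obtain ⟨V, β, hV, hact, hrow⟩ := R.unimodular y hy.1
  obtain ⟨K, hK⟩ := (R.isCompact_polytope.image (f := fun y => ∑ i, Facet.height (V i, β i) y)
    (continuous_finsetSum _ fun i _ => continuous_height _)).bddAbove
  -- The scale forces the coordinates into the open unit ball: the heights sum to at most `K`, which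
  -- is less than `(|K| + 1) ^ 2`. The lower bound `-1` is void on the polyhedron, where the level
  -- is nonnegative.
  let P : Frame n :=
    { V := V
      shift := β
      scale := |K| + 1
      lower := -1
      upper := R.bound
      det_ne_zero := hV.ne_zero
      scale_pos := by positivity }
  have hnorm : ∀ w ∈ R.domain P, ‖w‖ < 1 := by
    intro w hw
    have h1 : P.base w ∈ R.polytope := ⟨R.base_mem_polyhedron hw, hw.2.2.2.le⟩
    have h2 : ∑ i, Facet.height (V i, β i) (P.base w) ≤ K := hK ⟨_, h1, rfl⟩
    have h3 : ∑ i, Facet.height (V i, β i) (P.base w) = (|K| + 1) ^ 2 * ‖w‖ ^ 2 := by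
      rw [EuclideanSpace.norm_sq_eq, Finset.mul_sum]
      exact Finset.sum_congr rfl fun i _ => P.height_base w i
    rw [← sq_lt_one_iff₀ (norm_nonneg w)]
    by_contra! h4
    have h5 : (|K| + 1) ^ 2 ≤ (|K| + 1) ^ 2 * ‖w‖ ^ 2 := le_mul_of_one_le_right (by positivity) h4
    nlinarith [le_abs_self K, abs_nonneg K]
  refine ⟨P, ⟨fun w hw => ?_, fun w hw => ?_, fun g hg _ _ _ => ker_torusHom_of_isUnit hV hg, ?_,
    Or.inl hV⟩, ⟨fun k hk => ?_, hrow, ?_, h⟩, hnorm⟩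
  · exact iff_of_true (hnorm w hw).le hw.2.2.2.le
  · exact iff_of_true (hnorm w hw) hw.2.2.2
  · have : (torusHom P.V).ker = ⊥ :=
      (Subgroup.eq_bot_iff_forall _).mpr fun s hs => ker_torusHom_of_isUnit hV hs
    rw [this]
    infer_instance
  · by_cases hk0 : k.height y = 0
    · exact Or.inl (hact k (mem_activeSet.mpr ⟨hk, hk0⟩))
    · exact Or.inr (lt_of_le_of_ne (hy.1 k hk) (Ne.symm hk0))
  · have : 0 ≤ R.level y := Finset.sum_nonneg fun j _ => R.pairing_nonneg hy.1 j
    change (-1 : ℝ) < R.level y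
    linarith

/-- Every point of the filling has coordinates in the closed unit ball. -/
theorem exists_patch (m : R.Filling) : ∃ (P : Frame n) (z : Ball n), R.IsPatch P ∧
    (z : EuclideanSpace ℂ (Fin (n + 1))) ∈ R.domain P ∧ R.param P z = m ∧
    (‖(z : EuclideanSpace ℂ (Fin (n + 1)))‖ = 1 ↔ R.level (R.moment m) = R.bound) := by
  have key : ∀ P, R.IsPatch P → (R.moment m : Fin (n + 1) → ℝ) ∈ R.cell P → ∃ z : Ball n,
      (z : EuclideanSpace ℂ (Fin (n + 1))) ∈ R.domain P ∧ R.param P z = m ∧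
      (‖(z : EuclideanSpace ℂ (Fin (n + 1)))‖ = 1 ↔ R.level (R.moment m) = R.bound) := by
    intro P hP hm
    obtain ⟨w, hw, hb, rfl⟩ := R.exists_param_eq P m hm
    have h1 := hP.norm_le w hw
    have h2 := hP.norm_lt w hw
    rw [hb] at h1 h2
    have h3 : ‖w‖ ≤ 1 := h1.mpr (R.moment _).2.2
    refine ⟨⟨w, mem_closedBall_zero_iff.mpr h3⟩, hw, rfl, ?_⟩
    have h4 := (R.moment (R.param P w)).2.2
    change ‖w‖ = 1 ↔ _
    rw [eq_iff_le_not_lt, h2, eq_iff_le_not_lt, h1]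
  by_cases h : R.level (R.moment m) = R.bound
  · obtain ⟨z, hz⟩ := key _ R.isPatch_boundaryFrame (R.mem_cell_boundaryFrame (R.moment m).2 h)
    exact ⟨_, z, R.isPatch_boundaryFrame, hz⟩
  · obtain ⟨P, hP, hc, -⟩ := R.exists_interior_patch (R.moment m).2
      (lt_of_le_of_ne (R.moment m).2.2 h)
    obtain ⟨z, hz⟩ := key P hP hc
    exact ⟨P, z, hP, hz⟩

/-- Points over different points of the polytope are separated by `moment`. Points over the same one
lie in a common patch, where two distinct orbits of a finite group of rotations have disjoint
neighbourhoods. -/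
instance : T2Space R.Filling := by
  refine ⟨fun m m' hne => ?_⟩
  by_cases h : R.moment m = R.moment m'
  · obtain ⟨P, z, hP, hz, rfl, -⟩ := R.exists_patch m
    have hz1 := mem_closedBall_zero_iff.mp z.2
    have hzp := hP.base_mem hz hz1
    have hm' : (R.moment m' : Fin (n + 1) → ℝ) ∈ R.cell P := by
      rw [← h, R.moment_param hzp]
      exact hz
    obtain ⟨w, hw, hb, rfl⟩ := R.exists_param_eq P m' hm'
    have hwp : P.base w ∈ R.polytope := by
      rw [hb]
      exact (R.moment _).2
    have hw1 := (hP.norm_le w hw).mpr hwp.2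
    have hfin := hP.finite
    have hex : ∀ g : (torusHom P.V).ker, ∃ A A', IsOpen A ∧ IsOpen A' ∧
        (z : EuclideanSpace ℂ _) ∈ A ∧
        w ∈ A' ∧ ∀ a ∈ A, rotate (g : Torus n) a ∉ A' := by
      intro g
      have h1 : rotate (g : Torus n) (z : EuclideanSpace ℂ (Fin (n + 1))) ≠ w := fun h2 =>
        hne ((R.param_eq_param_iff hz hzp hwp).mpr ⟨g, g.2, h2.symm⟩)
      obtain ⟨A, A', hA, hA', hzA, hwA, hd⟩ := t2_separation h1
      exact ⟨rotate (g : Torus n) ⁻¹' A, A', hA.preimage (continuous_rotate _), hA', hzA, hwA,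
        fun a ha ha' => Set.disjoint_left.mp hd ha ha'⟩
    choose A A' hA hA' hzA hwA hd using hex
    refine ⟨_, _, hP.isOpen_image_param (isOpen_iInter_of_finite hA),
      hP.isOpen_image_param (isOpen_iInter_of_finite hA'),
      ⟨z, ⟨Set.mem_iInter.mpr hzA, hz, z.2⟩, rfl⟩,
      ⟨w, ⟨Set.mem_iInter.mpr hwA, hw, mem_closedBall_zero_iff.mpr hw1⟩, rfl⟩, ?_⟩
    rw [Set.disjoint_left]
    rintro _ ⟨a, ⟨ha, had, ha1⟩, rfl⟩ ⟨a', ⟨ha', had', ha1'⟩, haa⟩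
    obtain ⟨g, hg, rfl⟩ := (R.param_eq_param_iff had
      (hP.base_mem had (mem_closedBall_zero_iff.mp ha1))
      (hP.base_mem had' (mem_closedBall_zero_iff.mp ha1'))).mp haa.symm
    exact hd ⟨g, hg⟩ a (Set.mem_iInter.mp ha _) (Set.mem_iInter.mp ha' _)
  · exact separated_by_continuous R.continuous_moment h

end LensCharacteristic.Resolution

end

end GenLens

open scoped Topology

namespace GenLens

noncomputable section

variable {n : ℕ}

/-! ### Changes of toric coordinates -/

/-- Coordinatewise multiplication by complex numbers, as a real linear map. -/
def mulCoord (c : Fin (n + 1) → ℂ) :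
    EuclideanSpace ℂ (Fin (n + 1)) →L[ℝ] EuclideanSpace ℂ (Fin (n + 1)) :=
  LinearMap.toContinuousLinearMap
    { toFun := fun w => WithLp.toLp 2 fun i => c i * w i
      map_add' := fun v w => by
        ext i
        simp [mul_add]
      map_smul' := fun r w => by
        ext i
        simp [mul_left_comm] }

theorem rotate_eq_mulCoord (g : Torus n) : rotate g = mulCoord fun i => (g i : ℂ) := rfl

theorem det_mulCoord (c : Fin (n + 1) → ℂ) : (mulCoord c).det = ∏ i, ‖c i‖ ^ 2 := by
  let f : (Fin (n + 1) → ℂ) →ₗ[ℝ] (Fin (n + 1) → ℂ) :=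
    LinearMap.pi fun i => (Algebra.lmul ℝ ℂ (c i)).comp (LinearMap.proj i)
  have h1 : LinearMap.det f = ∏ i, ‖c i‖ ^ 2 := by
    rw [LinearMap.det_pi]
    refine Finset.prod_congr rfl fun i _ => ?_
    have := Algebra.norm_complex_apply (c i)
    rw [Algebra.norm_apply, Complex.normSq_eq_norm_sq] at this
    exact this
  rw [← h1, ← LinearMap.det_conj f (WithLp.linearEquiv 2 ℝ (Fin (n + 1) → ℂ)).symm]
  rfl

/-- Logarithmic polar coordinates. -/
def polarEquiv (n : ℕ) :
    ((Fin (n + 1) → ℝ) × (Fin (n + 1) → ℝ)) ≃ₗ[ℝ] EuclideanSpace ℂ (Fin (n + 1)) where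
  toFun a := WithLp.toLp 2 fun i => (a.1 i : ℂ) + a.2 i * Complex.I
  invFun w := (fun i => (w i).re, fun i => (w i).im)
  map_add' a b := by
    ext i
    simp
    ring
  map_smul' r a := by
    ext i
    simp
    ring
  left_inv a := by simp
  right_inv w := by
    ext i
    simp

/-- The coordinatewise exponential in logarithmic polar coordinates. -/
def polarExp (a : (Fin (n + 1) → ℝ) × (Fin (n + 1) → ℝ)) : EuclideanSpace ℂ (Fin (n + 1)) :=
  WithLp.toLp 2 fun i => Complex.exp (polarEquiv n a i)

theorem polarExp_apply (a : (Fin (n + 1) → ℝ) × (Fin (n + 1) → ℝ)) (i : Fin (n + 1)) :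
    polarExp a i = Complex.exp ((a.1 i : ℂ) + a.2 i * Complex.I) := rfl

theorem hasFDerivAt_polarExp (a : (Fin (n + 1) → ℝ) × (Fin (n + 1) → ℝ)) :
    HasFDerivAt (𝕜 := ℝ) polarExp
      (mulCoord (polarExp a) ∘L LinearMap.toContinuousLinearMap (polarEquiv n).toLinearMap) a := by
  rw [← hasFDerivWithinAt_univ, hasFDerivWithinAt_piLp]
  intro i
  rw [hasFDerivWithinAt_univ]
  have h1 : HasFDerivAt (𝕜 := ℝ) (fun b => polarEquiv n b i)
      ((PiLp.proj 2 (fun _ : Fin (n + 1) => ℂ) i : _ →L[ℝ] ℂ) ∘L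
        LinearMap.toContinuousLinearMap (polarEquiv n).toLinearMap) a :=
    ((PiLp.proj 2 (fun _ : Fin (n + 1) => ℂ) i : _ →L[ℝ] ℂ) ∘L
      LinearMap.toContinuousLinearMap (polarEquiv n).toLinearMap).hasFDerivAt
  have h2 := (Complex.hasDerivAt_exp (polarEquiv n a i)).complexToReal_fderiv.comp a h1
  refine h2.congr_fderiv ?_
  ext b <;> rfl

theorem norm_polarExp (a : (Fin (n + 1) → ℝ) × (Fin (n + 1) → ℝ)) (i : Fin (n + 1)) :
    ‖polarExp a i‖ = Real.exp (a.1 i) := by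
  rw [polarExp_apply, Complex.norm_exp]
  simp

theorem phase_polarExp (a : (Fin (n + 1) → ℝ) × (Fin (n + 1) → ℝ)) :
    phase (polarExp a) = fun i => Circle.exp (a.2 i) := by
  funext i
  apply Circle.ext
  have h := phase_mul_norm (polarExp a) i
  rw [norm_polarExp, polarExp_apply, Complex.exp_add, mul_comm, Complex.ofReal_exp] at h
  rw [Circle.coe_exp]
  exact mul_left_cancel₀ (Complex.exp_ne_zero _) h

theorem exists_polarExp {u : EuclideanSpace ℂ (Fin (n + 1))} (hu : ∀ i, u i ≠ 0) :
    ∃ a, polarExp a = u := by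
  refine ⟨(fun i => Real.log ‖u i‖, fun i => Complex.arg (u i)), ?_⟩
  ext i
  rw [polarExp_apply, Complex.exp_add, ← Complex.ofReal_exp, Real.exp_log (norm_pos_iff.mpr (hu i))]
  exact Complex.norm_mul_exp_arg_mul_I (u i)

namespace LensCharacteristic.Resolution.Frame

variable (P Q : Frame n)

/-- The integral matrix expressing the rows of `P` through those of `Q`, if `Q` is unimodular. -/
def changeMatrix : Fin (n + 1) → Fin (n + 1) → ℤ :=
  Matrix.of.symm (Matrix.of P.V * (Matrix.of Q.V)⁻¹)

theorem changeMatrix_mul (hQ : IsUnit (Matrix.of Q.V).det) :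
    Matrix.of (changeMatrix P Q) * Matrix.of Q.V = Matrix.of P.V := by
  rw [changeMatrix, Equiv.apply_symm_apply, Matrix.mul_assoc, Matrix.nonsing_inv_mul _ hQ,
    Matrix.mul_one]

/-- The change of toric coordinates from `P` to `Q`. -/
def change (u : EuclideanSpace ℂ (Fin (n + 1))) : EuclideanSpace ℂ (Fin (n + 1)) :=
  Q.lift (torusHom (changeMatrix P Q) (phase u)) (P.base u)

theorem height_base_polarExp (k : Facet n) (a : (Fin (n + 1) → ℝ) × (Fin (n + 1) → ℝ)) :
    k.height (P.base (polarExp a)) =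
      ∑ j, (Matrix.vecMul (realVec k.1) (realMatrix P.V)⁻¹ j) *
        (P.scale ^ 2 * Real.exp (a.1 j) ^ 2 + P.shift j) - k.2 := by
  have h : pairing k.1 (P.base (polarExp a)) = dotProduct (realVec k.1) (P.base (polarExp a)) := rfl
  rw [Facet.height, h, base, Matrix.dotProduct_mulVec]
  simp only [norm_polarExp, dotProduct]

/-- In logarithmic polar coordinates the new phases are linear in the old phases and the new moduli
depend on the old moduli alone, so the derivative is block diagonal. -/
theorem change_polarExp {a : (Fin (n + 1) → ℝ) × (Fin (n + 1) → ℝ)}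
    (ha : ∀ i, 0 < (Q.row i).height (P.base (polarExp a))) :
    change P Q (polarExp a) = polarExp
      (fun i => 2⁻¹ * Real.log ((Q.row i).height (P.base (polarExp a))) - Real.log Q.scale,
        Matrix.vecMul a.2 (realMatrix (changeMatrix P Q))) := by
  ext i
  rw [change, phase_polarExp, torusHom_exp, lift_apply, polarExp_apply, Complex.exp_add,
    Circle.coe_exp, mul_comm, ← Complex.ofReal_exp, Real.exp_sub, Real.exp_log Q.scale_pos,
    ← Real.log_rpow (ha i), Real.exp_log (Real.rpow_pos_of_pos (ha i) _), Real.sqrt_eq_rpow]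
  congr 2
  rw [one_div, div_eq_inv_mul]

/-- The heights transform by $V_QV_P^{-1}$ and the phases by $V_PV_Q^{-1}$, so these determinants
cancel, whatever their signs, and only the scales survive. This is why no choice of orientation of
the frames is needed. -/
theorem det_fderiv_change {u : EuclideanSpace ℂ (Fin (n + 1))} (hu : ∀ i, u i ≠ 0)
    (hQ : IsUnit (Matrix.of Q.V).det) (hpos : ∀ i, 0 < (Q.row i).height (P.base u))
    {D : EuclideanSpace ℂ (Fin (n + 1)) →L[ℝ] EuclideanSpace ℂ (Fin (n + 1))}
    (hD : HasFDerivAt (change P Q) D u) :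
    D.det = ∏ _i : Fin (n + 1), (P.scale ^ 2 / Q.scale ^ 2) := by
  obtain ⟨a, rfl⟩ := exists_polarExp hu
  set C := realMatrix Q.V * (realMatrix P.V)⁻¹ with hC
  set M := realMatrix (changeMatrix P Q) with hM
  set h : Fin (n + 1) → ((Fin (n + 1) → ℝ) × (Fin (n + 1) → ℝ)) → ℝ :=
    fun i b => (Q.row i).height (P.base (polarExp b)) with hh
  -- The derivative of the logarithmic moduli: the factor $1/2$ from the logarithm of a square root
  -- cancels the 2 from differentiating squares.
  let N : Matrix (Fin (n + 1)) (Fin (n + 1)) ℝ := Matrix.diagonal (fun i => (h i a)⁻¹) * C *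
    Matrix.diagonal fun j => P.scale ^ 2 * Real.exp (a.1 j) ^ 2
  let F : ((Fin (n + 1) → ℝ) × (Fin (n + 1) → ℝ)) → ((Fin (n + 1) → ℝ) × (Fin (n + 1) → ℝ)) :=
    fun b => (fun i => 2⁻¹ * Real.log (h i b) - Real.log Q.scale, Matrix.vecMul b.2 M)
  let F' := (Matrix.toLin' N).prodMap (Matrix.toLin' M.transpose)
  have hF : HasFDerivAt F (LinearMap.toContinuousLinearMap F') a := by
    have hd1 : HasFDerivAt (fun b : (Fin (n + 1) → ℝ) × (Fin (n + 1) → ℝ) =>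
        fun i => 2⁻¹ * Real.log (h i b) - Real.log Q.scale)
        (LinearMap.toContinuousLinearMap ((Matrix.toLin' N) ∘ₗ LinearMap.fst ℝ _ _)) a := by
      rw [hasFDerivAt_pi']
      intro i
      have hproj : ∀ j, HasFDerivAt (fun b : (Fin (n + 1) → ℝ) × (Fin (n + 1) → ℝ) => b.1 j)
          ((ContinuousLinearMap.proj j : (Fin (n + 1) → ℝ) →L[ℝ] ℝ) ∘L
            ContinuousLinearMap.fst ℝ _ _) a := fun j =>
        ((ContinuousLinearMap.proj j : (Fin (n + 1) → ℝ) →L[ℝ] ℝ) ∘L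
          ContinuousLinearMap.fst ℝ (Fin (n + 1) → ℝ) (Fin (n + 1) → ℝ)).hasFDerivAt
      have hi : HasFDerivAt (h i) (∑ j, C i j • (P.scale ^ 2 • ((2 * Real.exp (a.1 j) ^ (2 - 1)) •
          (Real.exp (a.1 j) • ((ContinuousLinearMap.proj j : (Fin (n + 1) → ℝ) →L[ℝ] ℝ) ∘L
            ContinuousLinearMap.fst ℝ (Fin (n + 1) → ℝ) (Fin (n + 1) → ℝ)))))) a := by
        have e1 : h i = fun b => ∑ j, C i j *
            (P.scale ^ 2 * Real.exp (b.1 j) ^ 2 + P.shift j) - Q.shift i := by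
          funext b
          exact P.height_base_polarExp (Q.row i) b
        rw [e1]
        refine HasFDerivAt.sub_const _ (HasFDerivAt.fun_sum fun j _ => ?_)
        refine HasFDerivAt.const_mul (HasFDerivAt.add_const _ (HasFDerivAt.const_mul ?_ _)) _
        have := ((hproj j).exp).pow 2
        simpa using this
      have hi' := ((hi.log (hpos i).ne').const_mul (2⁻¹ : ℝ)).sub_const (Real.log Q.scale)
      refine hi'.congr_fderiv ?_
      refine ContinuousLinearMap.ext fun b => ?_
      simp only [smul_apply, sum_apply, smul_eq_mul,
        ContinuousLinearMap.comp_apply, ContinuousLinearMap.coe_fst',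
        ContinuousLinearMap.proj_apply,
        LinearMap.coe_toContinuousLinearMap', LinearMap.comp_apply, LinearMap.fst_apply,
        Matrix.toLin'_apply, Matrix.mulVec, dotProduct, N, Matrix.mul_diagonal,
        Matrix.diagonal_mul, Finset.mul_sum]
      refine Finset.sum_congr rfl fun j _ => ?_
      change _ = (h i a)⁻¹ * C i j * _ * _
      simp only [hh]
      ring
    have hd2 : HasFDerivAt (fun b : (Fin (n + 1) → ℝ) × (Fin (n + 1) → ℝ) => Matrix.vecMul b.2 M)
        (LinearMap.toContinuousLinearMap
          ((Matrix.toLin' M.transpose) ∘ₗ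
            LinearMap.snd ℝ (Fin (n + 1) → ℝ) (Fin (n + 1) → ℝ))) a := by
      have e : (fun b : (Fin (n + 1) → ℝ) × (Fin (n + 1) → ℝ) => Matrix.vecMul b.2 M) =
          LinearMap.toContinuousLinearMap
          ((Matrix.toLin' M.transpose) ∘ₗ
            LinearMap.snd ℝ (Fin (n + 1) → ℝ) (Fin (n + 1) → ℝ)) := by
        funext b
        simp [Matrix.mulVec_transpose]
      rw [e]
      exact ContinuousLinearMap.hasFDerivAt _
    exact (hd1.prodMk hd2).congr_fderiv (by ext <;> rfl)
  have hcont : ∀ i, Continuous (h i) := fun i => (continuous_height _).comp (P.continuous_base.comp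
    (continuous_iff_continuousAt.mpr fun b => (hasFDerivAt_polarExp b).continuousAt))
  have hev : change P Q ∘ polarExp =ᶠ[𝓝 a] polarExp ∘ F := by
    have : ∀ᶠ b in 𝓝 a, ∀ i, 0 < h i b := by
      rw [Filter.eventually_all]
      exact fun i => (hcont i).continuousAt.eventually (lt_mem_nhds (hpos i))
    filter_upwards [this] with b hb
    exact P.change_polarExp Q hb
  have hFa : polarExp (F a) = change P Q (polarExp a) := (P.change_polarExp Q hpos).symm
  have heq := ((hD.comp a (hasFDerivAt_polarExp a)).congr_of_eventuallyEq hev.symm).unique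
    ((hasFDerivAt_polarExp (F a)).comp a hF)
  have hdet : D.det * (mulCoord (polarExp a)).det =
      (mulCoord (change P Q (polarExp a))).det * LinearMap.det F' := by
    have h1 : (D.toLinearMap ∘ₗ (mulCoord (polarExp a)).toLinearMap) =
        (mulCoord (polarExp (F a))).toLinearMap ∘ₗ
          ((polarEquiv n).toLinearMap ∘ₗ F' ∘ₗ (polarEquiv n).symm.toLinearMap) := by
      refine LinearMap.ext fun w => ?_
      have := congrArg (fun L => L ((polarEquiv n).symm w)) heq
      simpa using this
    have h2 := congrArg LinearMap.det h1
    rw [LinearMap.det_comp, LinearMap.det_comp, LinearMap.det_conj, hFa] at h2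
    exact h2
  have hnorm : ∀ i, ‖change P Q (polarExp a) i‖ ^ 2 = (Q.scale ^ 2)⁻¹ * h i a := by
    intro i
    rw [change, norm_lift, mul_pow, Real.sq_sqrt (hpos i).le, inv_pow]
  have hCM : C.det * M.det = 1 := by
    have e1 : M.det * (realMatrix Q.V).det = (realMatrix P.V).det := by
      rw [hM, det_realMatrix, det_realMatrix, det_realMatrix,
        ← P.changeMatrix_mul Q hQ, Matrix.det_mul]
      push_cast
      rfl
    have e2 : (realMatrix P.V).det ≠ 0 := (isUnit_det_realMatrix P.det_ne_zero).ne_zero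
    rw [hC, Matrix.det_mul, Matrix.det_nonsing_inv, Ring.inverse_eq_inv', mul_right_comm,
      mul_comm _ M.det, e1,
      mul_inv_cancel₀ e2]
  have hF'det : LinearMap.det F' =
      (∏ i, (h i a)⁻¹) * (∏ j, P.scale ^ 2 * Real.exp (a.1 j) ^ 2) := by
    rw [LinearMap.det_prodMap, LinearMap.det_toLin', LinearMap.det_toLin', Matrix.det_transpose,
      Matrix.det_mul, Matrix.det_mul, Matrix.det_diagonal, Matrix.det_diagonal]
    linear_combination (∏ i, (h i a)⁻¹) * (∏ j, P.scale ^ 2 * Real.exp (a.1 j) ^ 2) * hCM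
  rw [det_mulCoord, det_mulCoord, hF'det] at hdet
  simp only [hnorm, norm_polarExp] at hdet
  have hne : (∏ i, Real.exp (a.1 i) ^ 2) ≠ 0 :=
    Finset.prod_ne_zero_iff.mpr fun i _ => pow_ne_zero _ (Real.exp_pos _).ne'
  apply mul_right_cancel₀ hne
  rw [hdet, ← Finset.prod_mul_distrib, ← Finset.prod_mul_distrib, ← Finset.prod_mul_distrib]
  refine Finset.prod_congr rfl fun i _ => ?_
  have h1 := (hpos i).ne'
  have h2 := Q.scale_pos.ne'
  change _ * h i a * _ = _
  have h3 : h i a ≠ 0 := h1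
  field_simp

end LensCharacteristic.Resolution.Frame

end

end GenLens

/-! ### Smoothness and orientation of the coordinate changes. -/

open scoped Topology

namespace GenLens

noncomputable section

variable {n : ℕ}

theorem contDiff_coord (i : Fin (n + 1)) :
    ContDiff ℝ ∞ fun u : EuclideanSpace ℂ (Fin (n + 1)) => u i :=
  (PiLp.proj 2 (fun _ : Fin (n + 1) => ℂ) i : _ →L[ℝ] ℂ).contDiff

theorem contDiffAt_toLp {F : Type*} [NormedAddCommGroup F] [NormedSpace ℝ F] {k : WithTop ℕ∞}
    {f : F → Fin (n + 1) → ℂ} {x : F} (h : ∀ i, ContDiffAt ℝ k (fun u => f u i) x) :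
    ContDiffAt ℝ k (fun u => (WithLp.toLp 2 (f u) : EuclideanSpace ℂ (Fin (n + 1)))) x :=
  (contDiffAt_piLp 2).mpr h

theorem contDiffAt_zpow_comp {F : Type*} [NormedAddCommGroup F] [NormedSpace ℝ F] {k : WithTop ℕ∞}
    {f : F → ℂ} {x : F} (hf : ContDiffAt ℝ k f x) (h0 : f x ≠ 0) (m : ℤ) :
    ContDiffAt ℝ k (fun u => f u ^ m) x := by
  obtain ⟨m, rfl | rfl⟩ := m.eq_nat_or_neg
  · simpa using hf.pow m
  · simp only [zpow_neg, zpow_natCast]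
    exact (hf.pow m).inv (pow_ne_zero _ h0)

/-- Where the coordinate vanishes its phase is discontinuous, and only the exponent 0 is harmless.
-/
theorem contDiffAt_phase {z : EuclideanSpace ℂ (Fin (n + 1))} {i : Fin (n + 1)} {m : ℤ}
    (h : z i ≠ 0 ∨ m = 0) : ContDiffAt ℝ ∞ (fun u => ((phase u i : Circle) : ℂ) ^ m) z := by
  rcases h with h | rfl
  · have hc := (contDiff_coord (n := n) i).contDiffAt (x := z)
    have hn : ContDiffAt ℝ ∞ (fun u : EuclideanSpace ℂ (Fin (n + 1)) => ((‖u i‖ : ℝ) : ℂ)) z :=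
      Complex.ofRealCLM.contDiff.contDiffAt.comp z (hc.norm ℝ h)
    have hn0 : ((‖z i‖ : ℝ) : ℂ) ≠ 0 := by exact_mod_cast norm_ne_zero_iff.mpr h
    refine contDiffAt_zpow_comp (f := fun u => ((phase u i : Circle) : ℂ)) ?_
      (Circle.coe_ne_zero _) m
    refine (hc.mul (hn.inv hn0)).congr_of_eventuallyEq ?_
    filter_upwards [hc.continuousAt.eventually_ne h] with u hu
    have : ((‖u i‖ : ℝ) : ℂ) ≠ 0 := by exact_mod_cast norm_ne_zero_iff.mpr hu
    change ((phase u i : Circle) : ℂ) = u i * ((‖u i‖ : ℝ) : ℂ)⁻¹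
    rw [← div_eq_mul_inv, eq_div_iff this, phase_mul_norm]
  · simpa using contDiffAt_const

theorem contDiff_norm_sq_coord (i : Fin (n + 1)) :
    ContDiff ℝ ∞ fun u : EuclideanSpace ℂ (Fin (n + 1)) => ‖u i‖ ^ 2 :=
  (contDiff_coord i).norm_sq ℝ

namespace LensCharacteristic.Resolution

theorem Frame.contDiff_height_base (P : Frame n) (k : Facet n) :
    ContDiff ℝ ∞ fun u => k.height (P.base u) := by
  have h : ∀ j, ContDiff ℝ ∞ fun u => P.base u j := by
    intro j
    unfold Frame.base Matrix.mulVec dotProduct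
    refine ContDiff.sum fun i _ => ?_
    exact contDiff_const.mul ((contDiff_const.mul (contDiff_norm_sq_coord i)).add contDiff_const)
  unfold Facet.height
  refine ContDiff.sub ?_ contDiff_const
  change ContDiff ℝ ∞ fun u => ∑ i, realVec k.1 i * P.base u i
  exact ContDiff.sum fun i _ => contDiff_const.mul (h i)

theorem Frame.row_injective (P : Frame n) : Function.Injective P.row := by
  intro i j h
  by_contra hij
  have h1 : P.V i = P.V j := congrArg Prod.fst h
  exact P.det_ne_zero (Matrix.det_zero_of_row_eq hij h1)

/-- A common row of the frames gives a unit vector as row of the matrix. Hence the phase of a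
vanishing coordinate enters a single new coordinate, with exponent 1. -/
theorem Frame.changeMatrix_of_row_eq (P Q : Frame n) (hQ : IsUnit (Matrix.of Q.V).det)
    {i j : Fin (n + 1)} (h : P.row j = Q.row i) (l : Fin (n + 1)) :
    P.changeMatrix Q j l = if l = i then 1 else 0 := by
  have h1 : P.V j = Q.V i := congrArg Prod.fst h
  have h2 : (Matrix.of Q.V * (Matrix.of Q.V)⁻¹) i l = (1 : Matrix _ _ ℤ) i l := by
    rw [Matrix.mul_nonsing_inv _ hQ]
  rw [Matrix.one_apply] at h2
  change (Matrix.of P.V * (Matrix.of Q.V)⁻¹) j l = _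
  simp only [eq_comm (a := l)]
  rw [← h2, Matrix.mul_apply, Matrix.mul_apply]
  simp [h1]

variable {ξ : LensCharacteristic n} {R : ξ.Resolution} {P Q : Frame n}
  {z z' : EuclideanSpace ℂ (Fin (n + 1))}

/-- A vanishing coordinate signals an active facet, and a facet active at a point of the cell of `Q`
is one of the rows of `Q`. -/
theorem exists_row_eq (hz : z ∈ R.domain P) (hzQ : P.base z ∈ R.cell Q) {j : Fin (n + 1)}
    (hj : z j = 0) : ∃ i, P.row j = Q.row i := by
  have h0 : (P.row j).height (P.base z) = 0 := by simp [P.height_base, hj]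
  rcases hz.2.1 j with h | h
  · rcases hzQ.1 _ h with ⟨i, hi⟩ | h'
    · exact ⟨i, hi.symm⟩
    · exact absurd h0 h'.ne'
  · exact absurd h0 (ne_of_gt h)

/-- A change of toric coordinates is smooth. -/
theorem contDiffAt_change (hQ : IsUnit (Matrix.of Q.V).det) (hz : z ∈ R.domain P)
    (hzQ : P.base z ∈ R.cell Q) : ContDiffAt ℝ ∞ (P.change Q) z := by
  refine contDiffAt_toLp fun i => ?_
  have hcoe : ∀ u, ((torusHom (P.changeMatrix Q) (phase u) i : Circle) : ℂ) =
      ∏ j, ((phase u j : Circle) : ℂ) ^ P.changeMatrix Q j i := by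
    intro u
    refine (map_prod Circle.coeHom (fun j => phase u j ^ P.changeMatrix Q j i) Finset.univ).trans ?_
    exact Finset.prod_congr rfl fun j _ => Circle.coe_zpow _ _
  simp only [hcoe]
  by_cases hi : (Q.row i).height (P.base z) = 0
  · have hiF : Q.row i ∈ R.facets := by
      rcases hzQ.2.1 i with h | h
      · exact h
      · exact absurd hi h.ne'
    obtain ⟨j, hj⟩ : ∃ j, P.row j = Q.row i := by
      rcases hz.1 _ hiF with h | h
      · exact h
      · exact absurd hi h.ne'
    have hm1 : P.changeMatrix Q j i = 1 := by simp [P.changeMatrix_of_row_eq Q hQ hj]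
    -- The square root is a multiple of `‖u j‖`, which together with the phase of `u j` gives the
    -- smooth function `u j`. Each remaining phase either belongs to a coordinate that is nonzero at
    -- `z` or has exponent 0.
    have heq : (fun u => (∏ l, ((phase u l : Circle) : ℂ) ^ P.changeMatrix Q l i) *
        ((Q.scale⁻¹ * √((Q.row i).height (P.base u)) : ℝ) : ℂ)) = fun u =>
        ((Q.scale⁻¹ * P.scale : ℝ) : ℂ) * u j *
          ∏ l ∈ Finset.univ.erase j, ((phase u l : Circle) : ℂ) ^ P.changeMatrix Q l i := by
      funext u
      rw [← hj, P.height_base, ← mul_pow,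
        Real.sqrt_sq (mul_nonneg P.scale_pos.le (norm_nonneg _)),
        ← Finset.mul_prod_erase _ _ (Finset.mem_univ j), hm1, zpow_one]
      conv_rhs => rw [← phase_mul_norm u j]
      push_cast
      ring
    rw [heq]
    refine (contDiffAt_const.mul (contDiff_coord j).contDiffAt).mul
      (contDiffAt_prod fun l hl => contDiffAt_phase ?_)
    by_cases hl0 : z l = 0
    · right
      obtain ⟨i', hi'⟩ := exists_row_eq hz hzQ hl0
      rw [P.changeMatrix_of_row_eq Q hQ hi', if_neg]
      rintro rfl
      exact Finset.ne_of_mem_erase hl (P.row_injective (hi'.trans hj.symm))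
    · exact Or.inl hl0
  · refine (contDiffAt_prod fun l _ => contDiffAt_phase ?_).mul
      (Complex.ofRealCLM.contDiff.contDiffAt.comp z (contDiffAt_const.mul
        (ContDiffAt.sqrt (P.contDiff_height_base _).contDiffAt hi)))
    by_cases hl0 : z l = 0
    · right
      obtain ⟨i', hi'⟩ := exists_row_eq hz hzQ hl0
      rw [P.changeMatrix_of_row_eq Q hQ hi', if_neg]
      rintro rfl
      apply hi
      rw [← hi', P.height_base, hl0]
      simp
    · exact Or.inl hl0

theorem base_change {u : EuclideanSpace ℂ (Fin (n + 1))} (hu : u ∈ R.domain P)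
    (huQ : P.base u ∈ R.cell Q) : Q.base (P.change Q u) = P.base u :=
  Q.base_lift (R.height_row_nonneg (R.base_mem_polyhedron hu) huQ)

theorem param_change (hQ : IsUnit (Matrix.of Q.V).det) {u : EuclideanSpace ℂ (Fin (n + 1))}
    (hup : P.base u ∈ R.polytope) (huQ : P.base u ∈ R.cell Q) :
    R.param Q (P.change Q u) = R.param P u := by
  have h := R.param_lift (torusHom (P.changeMatrix Q) (phase u)) (y := ⟨P.base u, hup⟩) huQ
  rw [Frame.change, h, R.param_of_mem hup]
  congr 1
  refine (torusHom_torusHom (Matrix.of (P.changeMatrix Q)) (Matrix.of Q.V) (phase u)).trans ?_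
  rw [P.changeMatrix_mul Q hQ]
  rfl

/-- A change of toric coordinates preserves the orientation. -/
theorem det_fderiv_change_pos (hQ : IsUnit (Matrix.of Q.V).det) (hz : z ∈ R.domain P)
    (hzQ : P.base z ∈ R.cell Q) : 0 < (fderiv ℝ (P.change Q) z).det := by
  have hs := contDiffAt_change hQ hz hzQ
  have hc : ContinuousAt (fun u => (fderiv ℝ (P.change Q) u).det) z :=
    ContinuousLinearMap.continuous_det.continuousAt.comp
      (hs.fderiv_right (m := 0) (by simp)).continuousAt
  let c : ℝ := ∏ _i : Fin (n + 1), (P.scale ^ 2 / Q.scale ^ 2)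
  have hcpos : 0 < c := Finset.prod_pos fun _ _ => by
    have := P.scale_pos
    have := Q.scale_pos
    positivity
  have hdiff : ∀ᶠ u in 𝓝 z, DifferentiableAt ℝ (P.change Q) u :=
    ((hs.of_le (m := 1) (by simp)).eventually (by simp)).mono fun u hu =>
      hu.differentiableAt (by simp)
  have hdom : ∀ᶠ u in 𝓝 z, u ∈ R.domain P := (R.isOpen_domain P).mem_nhds hz
  have hcell : ∀ᶠ u in 𝓝 z, P.base u ∈ R.cell Q :=
    P.continuous_base.continuousAt.eventually ((R.isOpen_cell Q).mem_nhds hzQ)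
  have hfin : Set.Finite {ε : ℝ | ∃ i, z i + (ε : ℂ) = 0} := by
    refine (Set.finite_range fun i => -(z i).re).subset ?_
    rintro ε ⟨i, hi⟩
    refine ⟨i, ?_⟩
    have := congrArg Complex.re hi
    simp only [Complex.add_re, Complex.ofReal_re, Complex.zero_re] at this
    change -(z i).re = ε
    linarith
  have hne : ∀ᶠ ε : ℝ in 𝓝[≠] 0, ∀ i, z i + (ε : ℂ) ≠ 0 := by
    rw [eventually_nhdsWithin_iff]
    filter_upwards [((hfin.subset Set.sdiff_subset).isClosed (X := ℝ)).isOpen_compl.mem_nhds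
      (show (0 : ℝ) ∉ {ε : ℝ | ∃ i, z i + (ε : ℂ) = 0} \ {0} by simp)] with ε hε hε0 i hi
    exact hε ⟨⟨i, hi⟩, hε0⟩
  -- The determinant is known only where no coordinate vanishes. The curve
  -- $z+\varepsilon(1,\dots,1)$ avoids the coordinate hyperplanes for small $\varepsilon\ne 0$, and
  -- continuity carries the value to `z`.
  let γ : ℝ → EuclideanSpace ℂ (Fin (n + 1)) := fun ε => WithLp.toLp 2 fun i => z i + (ε : ℂ)
  have hγ : Filter.Tendsto γ (𝓝[≠] 0) (𝓝 z) := by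
    have h1 : Continuous γ := by
      unfold γ
      fun_prop
    have h2 := h1.tendsto 0
    have h3 : γ 0 = z := by
      ext i
      simp [γ]
    rw [h3] at h2
    exact h2.mono_left nhdsWithin_le_nhds
  have hlim : Filter.Tendsto (fun ε => (fderiv ℝ (P.change Q) (γ ε)).det) (𝓝[≠] 0) (𝓝 c) := by
    refine tendsto_const_nhds.congr' ?_
    filter_upwards [hne, hγ.eventually hdiff, hγ.eventually hdom, hγ.eventually hcell]
      with ε h1 h2 h3 h4
    refine (P.det_fderiv_change Q h1 hQ (fun i => ?_) h2.hasFDerivAt).symm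
    rcases h4.2.1 i with h5 | h5
    · rcases h3.1 _ h5 with ⟨j, hj⟩ | h6
      · rw [← hj, P.height_base]
        have := P.scale_pos
        have := norm_pos_iff.mpr (h1 j)
        change 0 < P.scale ^ 2 * ‖z j + (ε : ℂ)‖ ^ 2
        positivity
      · exact h6
    · exact h5
  rw [tendsto_nhds_unique (hc.tendsto.comp hγ) hlim]
  exact hcpos

theorem norm_eq_of_base_eq (hP : R.IsPatch P) (hQ : R.IsPatch Q) (hz : z ∈ R.domain P)
    (hz' : z' ∈ R.domain Q) (h : P.base z = Q.base z') :
    (‖z‖ ≤ 1 ↔ ‖z'‖ ≤ 1) ∧ (‖z‖ < 1 ↔ ‖z'‖ < 1) := by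
  rw [hP.norm_le z hz, hP.norm_lt z hz, hQ.norm_le z' hz', hQ.norm_lt z' hz', h]
  exact ⟨Iff.rfl, Iff.rfl⟩

/-- `W` is the germ at `z` of a change of coordinates from `P` to `Q`. -/
structure IsGerm (R : ξ.Resolution) (P Q : Frame n)
    (W : EuclideanSpace ℂ (Fin (n + 1)) → EuclideanSpace ℂ (Fin (n + 1)))
    (z : EuclideanSpace ℂ (Fin (n + 1))) : Prop where
  contDiffAt : ContDiffAt ℝ ∞ W z
  det_pos : 0 < (fderiv ℝ W z).det
  eventually : ∀ᶠ u in 𝓝 z, u ∈ R.domain P ∧ W u ∈ R.domain Q ∧ Q.base (W u) = P.base u ∧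
    (‖u‖ ≤ 1 → R.param Q (W u) = R.param P u)

theorem isGerm_change (hPp : R.IsPatch P) (hQ : IsUnit (Matrix.of Q.V).det) (hz : z ∈ R.domain P)
    (hzQ : P.base z ∈ R.cell Q) : R.IsGerm P Q (P.change Q) z where
  contDiffAt := contDiffAt_change hQ hz hzQ
  det_pos := det_fderiv_change_pos hQ hz hzQ
  eventually := by
    have hcell : ∀ᶠ u in 𝓝 z, P.base u ∈ R.cell Q :=
      P.continuous_base.continuousAt.eventually ((R.isOpen_cell Q).mem_nhds hzQ)
    filter_upwards [(R.isOpen_domain P).mem_nhds hz, hcell] with u h1 h2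
    refine ⟨h1, ?_, base_change h1 h2, fun h3 => param_change hQ (hPp.base_mem h1 h3) h2⟩
    change Q.base _ ∈ R.cell Q
    rw [base_change h1 h2]
    exact h2

theorem change_eq (hPp : R.IsPatch P) (hQp : R.IsPatch Q) (hQ : IsUnit (Matrix.of Q.V).det)
    (hz : z ∈ R.domain P) (hz' : z' ∈ R.domain Q) (hz1 : ‖z‖ ≤ 1) (hz1' : ‖z'‖ ≤ 1)
    (h : R.param P z = R.param Q z') : P.base z = Q.base z' ∧ P.change Q z = z' := by
  have hzp := hPp.base_mem hz hz1
  have hzp' := hQp.base_mem hz' hz1'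
  have hb : P.base z = Q.base z' := by rw [← R.moment_param hzp, ← R.moment_param hzp', h]
  have hzQ : P.base z ∈ R.cell Q := hb ▸ hz'
  refine ⟨hb, ?_⟩
  have h1 := (param_change hQ hzp hzQ).trans h
  obtain ⟨g, hg, h2⟩ := (R.param_eq_param_iff hz' hzp'
    (by rw [base_change hz hzQ]; exact hzp)).mp h1.symm
  rw [h2, ker_torusHom_of_isUnit hQ hg]
  ext i
  simp [rotate]

/-- Two patches that describe the same point of the filling differ by an orientation preserving
smooth change of coordinates. -/
theorem exists_isGerm (hP : R.IsPatch P) (hQ : R.IsPatch Q) (hz : z ∈ R.domain P)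
    (hz' : z' ∈ R.domain Q) (hz1 : ‖z‖ ≤ 1) (hz1' : ‖z'‖ ≤ 1) (h : R.param P z = R.param Q z') :
    ∃ W, W z = z' ∧ R.IsGerm P Q W z := by
  rcases hQ.kind with hQu | rfl
  · obtain ⟨h1, h2⟩ := change_eq hP hQ hQu hz hz' hz1 hz1' h
    exact ⟨_, h2, isGerm_change hP hQu hz (h1 ▸ hz')⟩
  -- The boundary frame need not be unimodular, so an integral matrix leading to it may not exist.
  -- The change out of it does, and the inverse function theorem inverts that one.
  rcases hP.kind with hPu | rfl
  · obtain ⟨h1, h2⟩ := change_eq hQ hP hPu hz' hz hz1' hz1 h.symm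
    set S := R.boundaryFrame.change P with hS
    obtain ⟨hs1, hs2, hs3⟩ : R.IsGerm R.boundaryFrame P S z' := isGerm_change hQ hPu hz' (h1 ▸ hz)
    let D : EuclideanSpace ℂ (Fin (n + 1)) ≃L[ℝ] EuclideanSpace ℂ (Fin (n + 1)) :=
      (fderiv ℝ S z').toContinuousLinearEquivOfDetNeZero hs2.ne'
    have hD : HasFDerivAt S (D : _ →L[ℝ] _) z' := by
      rw [ContinuousLinearMap.coe_toContinuousLinearEquivOfDetNeZero]
      exact (hs1.differentiableAt (by simp)).hasFDerivAt
    have h0 : (∞ : WithTop ℕ∞) ≠ 0 := by simp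
    let e := hs1.toOpenPartialHomeomorph S hD h0
    have hz'e : z' ∈ e.source := hs1.mem_toOpenPartialHomeomorph_source hD h0
    have heS : ∀ v, e v = S v := fun v => by rw [hs1.toOpenPartialHomeomorph_coe hD h0]
    have hze : z ∈ e.target := by
      rw [← h2, ← heS]
      exact e.map_source hz'e
    have hWz : e.symm z = z' := by rw [← h2, ← heS, e.left_inv hz'e]
    have hWs : ContDiffAt ℝ ∞ e.symm z := by
      have := hs1.to_localInverse hD h0
      rw [h2] at this
      exact this
    have hWe : ∀ᶠ u in 𝓝 z, S (e.symm u) = u := by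
      filter_upwards [e.open_target.mem_nhds hze] with u hu
      rw [← heS, e.right_inv hu]
    refine ⟨e.symm, hWz, hWs, ?_, ?_⟩
    · have hSd : HasFDerivAt S (fderiv ℝ S z') (e.symm z) := by
        rw [hWz]
        exact (hs1.differentiableAt (by simp)).hasFDerivAt
      have h3 := (hSd.comp z (hWs.differentiableAt (by simp)).hasFDerivAt).congr_of_eventuallyEq
        (hWe.mono fun u hu => hu.symm : id =ᶠ[𝓝 z] _)
      have h4 : (fderiv ℝ S z').det * (fderiv ℝ e.symm z).det = 1 := by
        have h5 := congrArg ContinuousLinearMap.det (h3.unique (hasFDerivAt_id z))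
        have h6 := LinearMap.det_comp (fderiv ℝ S z').toLinearMap (fderiv ℝ e.symm z).toLinearMap
        refine h6.symm.trans (h5.trans ?_)
        exact LinearMap.det_id
      exact pos_of_mul_pos_right (h4 ▸ one_pos) hs2.le
    · have hWc : Filter.Tendsto e.symm (𝓝 z) (𝓝 z') := by
        have := hWs.continuousAt.tendsto
        rwa [hWz] at this
      filter_upwards [hWe, hWc.eventually hs3, (R.isOpen_domain P).mem_nhds hz]
        with u hu ⟨h3, h4, h5, h6⟩ h7
      rw [hu] at h4 h5 h6
      refine ⟨h7, h3, h5.symm, fun hu1 => (h6 ?_).symm⟩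
      exact ((norm_eq_of_base_eq hP hQ h7 h3 h5).1).mp hu1
  -- Two points of the boundary patch with the same image differ by an element of $G_\xi$, whose
  -- rotation is the germ.
  · obtain ⟨g, hg, rfl⟩ := (R.param_eq_param_iff hz (hP.base_mem hz hz1)
      (hQ.base_mem hz' hz1')).mp h
    refine ⟨rotate g, rfl, ?_, ?_, ?_⟩
    · rw [rotate_eq_mulCoord]
      exact (mulCoord _).contDiff.contDiffAt
    · rw [rotate_eq_mulCoord, ContinuousLinearMap.fderiv, det_mulCoord]
      exact Finset.prod_pos fun i _ => by
        rw [Circle.norm_coe]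
        norm_num
    · filter_upwards [(R.isOpen_domain R.boundaryFrame).mem_nhds hz] with u hu
      refine ⟨hu, R.rotate_mem_domain g hu, Frame.base_rotate _ g u, fun hu1 => ?_⟩
      exact ((R.param_eq_param_iff hu (hP.base_mem hu hu1)
        (by rw [Frame.base_rotate]; exact hP.base_mem hu hu1)).mpr ⟨g, hg, rfl⟩).symm

end LensCharacteristic.Resolution

end

end GenLens

open scoped Topology

namespace GenLens

noncomputable section

variable {n : ℕ}

/-! ### Charts of the closed ball -/

/-- Splitting off the first coordinate. -/
def splitHead (d : ℕ) :
    EuclideanSpace ℝ (Fin (d + 1)) ≃L[ℝ] ℝ × EuclideanSpace ℝ (Fin d) :=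
  LinearEquiv.toContinuousLinearEquiv
    { toFun := fun x => (x 0, WithLp.toLp 2 fun i => x i.succ)
      invFun := fun a => WithLp.toLp 2 (Fin.cons a.1 a.2.ofLp)
      map_add' := fun _ _ => rfl
      map_smul' := fun _ _ => rfl
      left_inv := fun x => by
        ext i
        refine Fin.cases ?_ (fun i => ?_) i <;> simp
      right_inv := fun a => by simp }

theorem splitHead_symm_zero (d : ℕ) (a : ℝ × EuclideanSpace ℝ (Fin d)) :
    (splitHead d).symm a 0 = a.1 := rfl

section Collar

variable {E : Type*} [NormedAddCommGroup E] [InnerProductSpace ℝ E] {d : ℕ}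
  [Fact (Module.finrank ℝ E = d + 1)]

/-- The isometry used by the stereographic projection to a Euclidean space. -/
def stereoIsometry (d : ℕ) [Fact (Module.finrank ℝ E = d + 1)] (v : Metric.sphere (0 : E) 1) :
    (ℝ ∙ (v : E))ᗮ ≃ₗᵢ[ℝ] EuclideanSpace ℝ (Fin d) :=
  (OrthonormalBasis.fromOrthogonalSpanSingleton d (ne_zero_of_mem_unit_sphere v)).repr

/-- The radial projection of a nonzero vector to the sphere. -/
def radial (z : E) (hz : z ≠ 0) : Metric.sphere (0 : E) 1 :=
  ⟨‖z‖⁻¹ • z, by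
    rw [mem_sphere_zero_iff_norm, norm_smul, norm_inv, norm_norm,
      inv_mul_cancel₀ (norm_ne_zero_iff.mpr hz)]⟩

theorem ne_zero_of_inner_lt {v z : E} (h : innerSL ℝ v z < ‖z‖) : z ≠ 0 := by
  rintro rfl
  simp at h

theorem radial_ne {v : Metric.sphere (0 : E) 1} {z : E} (h : innerSL ℝ (v : E) z < ‖z‖) :
    innerSL ℝ (v : E) (‖z‖⁻¹ • z) ≠ 1 := by
  have h0 := norm_pos_iff.mpr (ne_zero_of_inner_lt h)
  rw [map_smul, smul_eq_mul]
  intro h1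
  rw [inv_mul_eq_iff_eq_mul₀ h0.ne', mul_one] at h1
  exact h.ne h1

/-- Coordinates near the sphere: the distance to the sphere and the stereographic projection from
`v` of the radial projection. -/
def collar (d : ℕ) [Fact (Module.finrank ℝ E = d + 1)] (v : Metric.sphere (0 : E) 1) :
    OpenPartialHomeomorph E (EuclideanSpace ℝ (Fin (d + 1))) where
  toFun z := (splitHead d).symm (1 - ‖z‖, stereoIsometry d v (stereoToFun (v : E) (‖z‖⁻¹ • z)))
  invFun x := (1 - x 0) • stereoInvFunAux (v : E) ((stereoIsometry d v).symm (splitHead d x).2 : E)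
  source := {z | innerSL ℝ (v : E) z < ‖z‖}
  target := {x | x 0 < 1}
  map_source' z hz := by
    have h0 := norm_pos_iff.mpr (ne_zero_of_inner_lt hz)
    change 1 - ‖z‖ < 1
    linarith
  map_target' x hx := by
    have hx' : 0 < 1 - x 0 := sub_pos.mpr hx
    have hv := norm_eq_of_mem_sphere v
    set w := (stereoIsometry d v).symm (splitHead d x).2 with hw
    have h1 := stereoInvFunAux_mem hv w.2
    rw [mem_sphere_zero_iff_norm] at h1
    have h2 : innerSL ℝ (v : E) (stereoInvFunAux (v : E) (w : E)) < 1 := by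
      have h3 := stereoInvFun_ne_north_pole hv w
      refine (inner_lt_one_iff_real_of_norm_eq_one hv h1).mpr fun h => h3 (Subtype.ext h.symm)
    change innerSL ℝ (v : E) ((1 - x 0) • _) < ‖(1 - x 0) • _‖
    rw [map_smul, norm_smul, h1, mul_one, Real.norm_eq_abs, abs_of_pos hx', smul_eq_mul]
    exact mul_lt_of_lt_one_right hx' h2
  left_inv' z hz := by
    have h0 := ne_zero_of_inner_lt hz
    have hv := norm_eq_of_mem_sphere v
    have h1 : ((radial z h0 : Metric.sphere (0 : E) 1) : E) ≠ v := by
      intro h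
      apply radial_ne hz
      change innerSL ℝ (v : E) (radial z h0 : E) = 1
      rw [h, innerSL_apply_apply, real_inner_self_eq_norm_sq, hv, one_pow]
    have h2 := congrArg Subtype.val (stereo_left_inv hv h1)
    change stereoInvFunAux (v : E) (stereoToFun (v : E) (‖z‖⁻¹ • z) : E) = ‖z‖⁻¹ • z at h2
    rw [ContinuousLinearEquiv.apply_symm_apply, LinearIsometryEquiv.symm_apply_apply, h2,
      splitHead_symm_zero, sub_sub_cancel, smul_inv_smul₀ (norm_ne_zero_iff.mpr h0)]
  right_inv' x hx := by
    have hx' : 0 < 1 - x 0 := sub_pos.mpr hx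
    have hv := norm_eq_of_mem_sphere v
    set w := (stereoIsometry d v).symm (splitHead d x).2 with hw
    have h1 := stereoInvFunAux_mem hv w.2
    rw [mem_sphere_zero_iff_norm] at h1
    have h2 : stereoToFun (v : E) (stereoInvFunAux (v : E) (w : E)) = w := stereo_right_inv hv w
    rw [norm_smul, h1, mul_one, Real.norm_eq_abs, abs_of_pos hx', inv_smul_smul₀ hx'.ne', h2, hw,
      LinearIsometryEquiv.apply_symm_apply, sub_sub_cancel]
    exact (splitHead d).symm_apply_apply x
  open_source := isOpen_lt (innerSL ℝ (v : E)).continuous continuous_norm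
  open_target := isOpen_lt (by fun_prop) continuous_const
  continuousOn_toFun := by
    refine (splitHead d).symm.continuous.comp_continuousOn ((continuous_const.sub
      continuous_norm).continuousOn.prodMk
      ((stereoIsometry d v).continuous.comp_continuousOn (continuousOn_stereoToFun.comp
        ((continuous_norm.continuousOn.inv₀ fun z hz =>
          norm_ne_zero_iff.mpr (ne_zero_of_inner_lt hz)).smul continuousOn_id)
        fun z hz => radial_ne hz)))
  continuousOn_invFun := by
    refine Continuous.continuousOn ((continuous_const.sub (by fun_prop)).smul
      ((contDiff_stereoInvFunAux (m := 0)).continuous.comp (continuous_subtype_val.comp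
        ((stereoIsometry d v).symm.continuous.comp
          (continuous_snd.comp (splitHead d).continuous)))))

theorem contDiffOn_collar (v : Metric.sphere (0 : E) 1) :
    ContDiffOn ℝ ∞ (collar d v) (collar d v).source := by
  have hn : ContDiffOn ℝ ∞ (fun z : E => ‖z‖) (collar d v).source := fun z hz =>
    (contDiffAt_norm ℝ (ne_zero_of_inner_lt hz)).contDiffWithinAt
  refine (splitHead d).symm.contDiff.comp_contDiffOn ((contDiffOn_const.sub hn).prodMk
    ((stereoIsometry d v).contDiff.comp_contDiffOn (contDiffOn_stereoToFun.comp
      ((hn.inv fun z hz => norm_ne_zero_iff.mpr (ne_zero_of_inner_lt hz)).smul contDiffOn_id)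
      fun z hz => radial_ne hz)))

theorem contDiff_collar_symm (v : Metric.sphere (0 : E) 1) :
    ContDiff ℝ ∞ (collar d v).symm := by
  have h : ContDiff ℝ ∞ fun x : EuclideanSpace ℝ (Fin (d + 1)) => x 0 :=
    (PiLp.proj 2 (fun _ : Fin (d + 1) => ℝ) 0 : _ →L[ℝ] ℝ).contDiff
  exact (contDiff_const.sub h).smul (contDiff_stereoInvFunAux.comp
    ((ℝ ∙ (v : E))ᗮ.subtypeL.contDiff.comp ((stereoIsometry d v).symm.contDiff.comp
      (contDiff_snd.comp (splitHead d).contDiff))))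

theorem mem_collar_source (z : Metric.sphere (0 : E) 1) : (z : E) ∈ (collar d (-z)).source := by
  have h := norm_eq_of_mem_sphere z
  change innerSL ℝ (-(z : E)) z < ‖(z : E)‖
  rw [innerSL_apply_apply, inner_neg_left, real_inner_self_eq_norm_sq, h]
  norm_num

/-- On the sphere, the collar coordinates are those of the sphere. -/
theorem splitHead_collar (v z : Metric.sphere (0 : E) 1) :
    splitHead d (collar d v z) = (0, stereographic' d v z) := by
  have h := norm_eq_of_mem_sphere z
  change splitHead d ((splitHead d).symm _) = _
  rw [ContinuousLinearEquiv.apply_symm_apply, h, inv_one, one_smul, sub_self]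
  rfl

end Collar

/-- A coordinate system of the space `ℂ^{n+1}` in which the closed unit ball is a half space. -/
structure HalfChart (n : ℕ) where
  toHomeo : OpenPartialHomeomorph (EuclideanSpace ℂ (Fin (n + 1)))
    (EuclideanSpace ℝ (Fin (2 * n + 2)))
  contDiffOn : ContDiffOn ℝ ∞ toHomeo toHomeo.source
  contDiffOn_symm : ContDiffOn ℝ ∞ toHomeo.symm toHomeo.target
  norm_le_iff : ∀ z ∈ toHomeo.source, ‖z‖ ≤ 1 ↔ 0 ≤ toHomeo z 0
  norm_lt_iff : ∀ z ∈ toHomeo.source, ‖z‖ < 1 ↔ 0 < toHomeo z 0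

/-- An isometry of `ℂ^{n+1}` with the Euclidean space. -/
def realIsometry (n : ℕ) :
    EuclideanSpace ℂ (Fin (n + 1)) ≃ₗᵢ[ℝ] EuclideanSpace ℝ (Fin (2 * n + 2)) :=
  ((stdOrthonormalBasis ℝ (EuclideanSpace ℂ (Fin (n + 1)))).reindex
    (finCongr (finrankFact n).out)).repr

theorem one_lt_realIsometry {z : EuclideanSpace ℂ (Fin (n + 1))} (hz : ‖z‖ < 1) :
    0 < (realIsometry n z + EuclideanSpace.single 0 2 : EuclideanSpace ℝ (Fin (2 * n + 2))) 0 := by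
  have h1 : ‖realIsometry n z 0‖ ≤ ‖realIsometry n z‖ := PiLp.norm_apply_le _ 0
  rw [LinearIsometryEquiv.norm_map, Real.norm_eq_abs] at h1
  have h2 := neg_abs_le (realIsometry n z 0)
  have h3 : (realIsometry n z + EuclideanSpace.single 0 2 : EuclideanSpace ℝ (Fin (2 * n + 2))) 0 =
      realIsometry n z 0 + 2 := by simp
  rw [h3]
  linarith

namespace HalfChart

/-- The translated standard coordinates, on the open unit ball. -/
def inner (n : ℕ) : HalfChart n where
  -- Adding 2 to the first coordinate moves the open unit ball into the open half space.
  toHomeo := (((realIsometry n).toHomeomorph.trans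
    (Homeomorph.addRight (EuclideanSpace.single 0 2))).toOpenPartialHomeomorph).restrOpen
      (Metric.ball 0 1) Metric.isOpen_ball
  contDiffOn := ((realIsometry n).contDiff.add contDiff_const).contDiffOn
  contDiffOn_symm := ((realIsometry n).symm.contDiff.comp
    (contDiff_id.add contDiff_const)).contDiffOn
  norm_le_iff z hz := by
    have h1 : ‖z‖ < 1 := mem_ball_zero_iff.mp hz.2
    exact iff_of_true h1.le (one_lt_realIsometry h1).le
  norm_lt_iff z hz := by
    have h1 : ‖z‖ < 1 := mem_ball_zero_iff.mp hz.2
    exact iff_of_true h1 (one_lt_realIsometry h1)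

theorem mem_inner_source {z : EuclideanSpace ℂ (Fin (n + 1))} (hz : ‖z‖ < 1) :
    z ∈ (inner n).toHomeo.source := ⟨Set.mem_univ _, mem_ball_zero_iff.mpr hz⟩

/-- The collar coordinates. -/
def outer (v : OddSphere n) : HalfChart n where
  toHomeo := collar (2 * n + 1) v
  contDiffOn := contDiffOn_collar v
  contDiffOn_symm := (contDiff_collar_symm v).contDiffOn
  norm_le_iff z _ := by
    change ‖z‖ ≤ 1 ↔ 0 ≤ 1 - ‖z‖
    rw [sub_nonneg]
  norm_lt_iff z _ := by
    change ‖z‖ < 1 ↔ 0 < 1 - ‖z‖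
    rw [sub_pos]

theorem exists_mem_source (z : Ball n) :
    ∃ κ : HalfChart n, (z : EuclideanSpace ℂ (Fin (n + 1))) ∈ κ.toHomeo.source := by
  rcases (mem_closedBall_zero_iff.mp z.2).lt_or_eq with h | h
  · exact ⟨inner n, mem_inner_source h⟩
  · exact ⟨outer (-(⟨z, mem_sphere_zero_iff_norm.mpr h⟩ : OddSphere n)),
      mem_collar_source (⟨z, mem_sphere_zero_iff_norm.mpr h⟩ : OddSphere n)⟩

variable (κ : HalfChart n)

theorem contDiffAt {z : EuclideanSpace ℂ (Fin (n + 1))} (hz : z ∈ κ.toHomeo.source) :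
    ContDiffAt ℝ ∞ κ.toHomeo z := κ.contDiffOn.contDiffAt (κ.toHomeo.open_source.mem_nhds hz)

theorem contDiffAt_symm {x : EuclideanSpace ℝ (Fin (2 * n + 2))} (hx : x ∈ κ.toHomeo.target) :
    ContDiffAt ℝ ∞ κ.toHomeo.symm x :=
  κ.contDiffOn_symm.contDiffAt (κ.toHomeo.open_target.mem_nhds hx)

/-- Restriction to an open subset. -/
def restr (O : Set (EuclideanSpace ℂ (Fin (n + 1)))) (hO : IsOpen O) : HalfChart n where
  toHomeo := κ.toHomeo.restrOpen O hO
  contDiffOn := κ.contDiffOn.mono fun _ h => h.1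
  contDiffOn_symm := κ.contDiffOn_symm.mono fun _ h => h.1
  norm_le_iff z hz := κ.norm_le_iff z hz.1
  norm_lt_iff z hz := κ.norm_lt_iff z hz.1

/-- The reflection in the last coordinate. -/
def reflection (n : ℕ) :
    EuclideanSpace ℝ (Fin (2 * n + 2)) ≃L[ℝ] EuclideanSpace ℝ (Fin (2 * n + 2)) :=
  LinearEquiv.toContinuousLinearEquiv
    { toFun := fun x => WithLp.toLp 2 fun i => (if i = Fin.last (2 * n + 1) then -1 else 1) * x i
      invFun := fun x => WithLp.toLp 2 fun i => (if i = Fin.last (2 * n + 1) then -1 else 1) * x i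
      map_add' := fun x y => by
        ext i
        simp [mul_add]
      map_smul' := fun r x => by
        ext i
        simp
      left_inv := fun x => by
        ext i
        by_cases h : i = Fin.last (2 * n + 1) <;> simp [h]
      right_inv := fun x => by
        ext i
        by_cases h : i = Fin.last (2 * n + 1) <;> simp [h] }

/-- The last index is not 0, the dimension being at least 2. So orientation can be reversed without
leaving the half space. -/
theorem reflection_zero (x : EuclideanSpace ℝ (Fin (2 * n + 2))) : reflection n x 0 = x 0 := by
  change (if (0 : Fin (2 * n + 2)) = Fin.last (2 * n + 1) then -1 else 1) * x 0 = x 0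
  rw [if_neg, one_mul]
  intro h
  have := congrArg Fin.val h
  simp at this

theorem det_reflection : (reflection n : EuclideanSpace ℝ (Fin (2 * n + 2)) →L[ℝ] _).det = -1 := by
  let f : (Fin (2 * n + 2) → ℝ) →ₗ[ℝ] (Fin (2 * n + 2) → ℝ) :=
    LinearMap.pi fun i => ((if i = Fin.last (2 * n + 1) then -1 else 1 : ℝ) •
      (LinearMap.id : ℝ →ₗ[ℝ] ℝ)).comp (LinearMap.proj i)
  have h1 : LinearMap.det f = -1 := by
    rw [LinearMap.det_pi]
    simp only [LinearMap.det_smul, Module.finrank_self, pow_one, LinearMap.det_id, mul_one]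
    exact Finset.prod_ite_eq' Finset.univ (Fin.last (2 * n + 1)) (fun _ => (-1 : ℝ)) |>.trans
      (if_pos (Finset.mem_univ _))
  rw [← h1, ← LinearMap.det_conj f (WithLp.linearEquiv 2 ℝ (Fin (2 * n + 2) → ℝ)).symm]
  rfl

/-- Composition with the reflection. -/
def reflect : HalfChart n where
  toHomeo := κ.toHomeo.trans (reflection n).toHomeomorph.toOpenPartialHomeomorph
  contDiffOn := (reflection n).contDiff.comp_contDiffOn (κ.contDiffOn.mono fun _ h => h.1)
  contDiffOn_symm := κ.contDiffOn_symm.comp (reflection n).symm.contDiff.contDiffOn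
    fun _ h => h.2
  norm_le_iff z hz := by
    rw [κ.norm_le_iff z hz.1]
    exact (congrArg (0 ≤ ·) (reflection_zero (κ.toHomeo z))).symm ▸ Iff.rfl
  norm_lt_iff z hz := by
    rw [κ.norm_lt_iff z hz.1]
    exact (congrArg (0 < ·) (reflection_zero (κ.toHomeo z))).symm ▸ Iff.rfl

/-- The Jacobian determinant of a half chart relative to the standard coordinates. -/
def jacobian (z : EuclideanSpace ℂ (Fin (n + 1))) : ℝ :=
  (((realIsometry n).symm.toContinuousLinearEquiv : EuclideanSpace ℝ (Fin (2 * n + 2)) →L[ℝ] _) ∘L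
    fderiv ℝ κ.toHomeo z).det

theorem det_comp {E : Type*} [AddCommGroup E] [TopologicalSpace E] [Module ℝ E] (f g : E →L[ℝ] E) :
    (f ∘L g).det = f.det * g.det := LinearMap.det_comp _ _

theorem fderiv_symm_comp {x : EuclideanSpace ℝ (Fin (2 * n + 2))} (hx : x ∈ κ.toHomeo.target) :
    fderiv ℝ κ.toHomeo.symm x ∘L fderiv ℝ κ.toHomeo (κ.toHomeo.symm x) =
      ContinuousLinearMap.id ℝ _ := by
  have hz := κ.toHomeo.map_target hx
  have h1 : HasFDerivAt κ.toHomeo.symm (fderiv ℝ κ.toHomeo.symm x)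
      (κ.toHomeo (κ.toHomeo.symm x)) := by
    rw [κ.toHomeo.right_inv hx]
    exact ((κ.contDiffAt_symm hx).differentiableAt (by simp)).hasFDerivAt
  have h2 := h1.comp _ ((κ.contDiffAt hz).differentiableAt (by simp)).hasFDerivAt
  refine h2.unique ((hasFDerivAt_id _).congr_of_eventuallyEq ?_)
  filter_upwards [κ.toHomeo.open_source.mem_nhds hz] with z hz
  exact κ.toHomeo.left_inv hz

theorem det_symm_mul_jacobian {x : EuclideanSpace ℝ (Fin (2 * n + 2))}
    (hx : x ∈ κ.toHomeo.target) :
    (fderiv ℝ κ.toHomeo.symm x ∘L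
      ((realIsometry n).toContinuousLinearEquiv : _ →L[ℝ] EuclideanSpace ℝ (Fin (2 * n + 2)))).det *
      κ.jacobian (κ.toHomeo.symm x) = 1 := by
  rw [jacobian, ← det_comp]
  have : (fderiv ℝ κ.toHomeo.symm x ∘L
      ((realIsometry n).toContinuousLinearEquiv : _ →L[ℝ] EuclideanSpace ℝ (Fin (2 * n + 2)))) ∘L
      (((realIsometry n).symm.toContinuousLinearEquiv :
        EuclideanSpace ℝ (Fin (2 * n + 2)) →L[ℝ] EuclideanSpace ℂ (Fin (n + 1))) ∘L
        fderiv ℝ κ.toHomeo (κ.toHomeo.symm x)) = ContinuousLinearMap.id ℝ _ := by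
    rw [← κ.fderiv_symm_comp hx]
    ext w
    simp
  rw [this]
  exact LinearMap.det_id

theorem jacobian_ne_zero {z : EuclideanSpace ℂ (Fin (n + 1))} (hz : z ∈ κ.toHomeo.source) :
    κ.jacobian z ≠ 0 := by
  have h := κ.det_symm_mul_jacobian (κ.toHomeo.map_source hz)
  rw [κ.toHomeo.left_inv hz] at h
  exact right_ne_zero_of_mul_eq_one h

theorem jacobian_reflect {z : EuclideanSpace ℂ (Fin (n + 1))} (hz : z ∈ κ.toHomeo.source) :
    κ.reflect.jacobian z = -κ.jacobian z := by
  have h1 : fderiv ℝ κ.reflect.toHomeo z =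
      (reflection n : EuclideanSpace ℝ (Fin (2 * n + 2)) →L[ℝ] _) ∘L fderiv ℝ κ.toHomeo z :=
    ((reflection n).hasFDerivAt.comp z
      ((κ.contDiffAt hz).differentiableAt (by simp)).hasFDerivAt).fderiv
  have h2 : LinearMap.det (((realIsometry n).symm.toLinearEquiv.toLinearMap ∘ₗ
      (reflection n : EuclideanSpace ℝ (Fin (2 * n + 2)) →L[ℝ] _).toLinearMap ∘ₗ
      (realIsometry n).symm.toLinearEquiv.symm.toLinearMap)) = -1 := by
    rw [LinearMap.det_conj]
    exact det_reflection
  rw [jacobian, h1, jacobian, neg_eq_neg_one_mul, ← h2]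
  refine Eq.trans ?_ (LinearMap.det_comp _ _)
  refine congrArg LinearMap.det (LinearMap.ext fun w => ?_)
  simp

/-- A half chart is positive if it preserves the orientation. -/
def IsPositive : Prop := ∀ z ∈ κ.toHomeo.source, 0 < κ.jacobian z

theorem exists_isPositive_of_pos {z : EuclideanSpace ℂ (Fin (n + 1))}
    (hz : z ∈ κ.toHomeo.source) (h : 0 < κ.jacobian z) :
    ∃ κ' : HalfChart n, κ'.IsPositive ∧ z ∈ κ'.toHomeo.source := by
  have hc : ContinuousOn κ.jacobian κ.toHomeo.source :=
    ContinuousLinearMap.continuous_det.comp_continuousOn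
      (continuousOn_const.clm_comp (κ.contDiffOn.continuousOn_fderiv_of_isOpen
        κ.toHomeo.open_source (by simp)))
  have hO := hc.isOpen_inter_preimage κ.toHomeo.open_source (isOpen_Ioi (a := (0 : ℝ)))
  exact ⟨κ.restr _ hO, fun w hw => hw.2.2, hz, hz, h⟩

/-- The Jacobian never vanishes: a reflection makes it positive at the point, and continuity keeps
it so on a smaller domain. -/
theorem exists_isPositive (z : Ball n) : ∃ κ : HalfChart n, κ.IsPositive ∧
    (z : EuclideanSpace ℂ (Fin (n + 1))) ∈ κ.toHomeo.source := by
  obtain ⟨κ, hz⟩ := exists_mem_source z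
  rcases (κ.jacobian_ne_zero hz).lt_or_gt with h | h
  · refine κ.reflect.exists_isPositive_of_pos ⟨hz, Set.mem_univ _⟩ ?_
    rw [κ.jacobian_reflect hz]
    exact neg_pos.mpr h
  · exact κ.exists_isPositive_of_pos hz h

theorem val_symm_apply {z : Ball n}
    (hz : (z : EuclideanSpace ℂ (Fin (n + 1))) ∈ κ.toHomeo.source) :
    ((𝓡∂ (2 * n + 2)).symm (κ.toHomeo z)).1 = κ.toHomeo z := by
  refine (𝓡∂ (2 * n + 2)).right_inv ?_
  rw [range_modelWithCornersEuclideanHalfSpace]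
  exact (κ.norm_le_iff _ hz).mp (mem_closedBall_zero_iff.mp z.2)

theorem norm_symm_le {x : EuclideanHalfSpace (2 * n + 2)} (hx : x.1 ∈ κ.toHomeo.target) :
    ‖κ.toHomeo.symm x.1‖ ≤ 1 := by
  rw [κ.norm_le_iff _ (κ.toHomeo.map_target hx), κ.toHomeo.right_inv hx]
  exact x.2

open Classical in
/-- The chart of the closed ball given by a half chart. -/
def toBall : OpenPartialHomeomorph (Ball n) (EuclideanHalfSpace (2 * n + 2)) where
  toFun z := (𝓡∂ (2 * n + 2)).symm (κ.toHomeo z)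
  invFun x := if h : ‖κ.toHomeo.symm x.1‖ ≤ 1 then
    ⟨κ.toHomeo.symm x.1, mem_closedBall_zero_iff.mpr h⟩ else Classical.arbitrary _
  source := {z | (z : EuclideanSpace ℂ (Fin (n + 1))) ∈ κ.toHomeo.source}
  target := {x | x.1 ∈ κ.toHomeo.target}
  map_source' z hz := by
    change ((𝓡∂ (2 * n + 2)).symm (κ.toHomeo z)).1 ∈ κ.toHomeo.target
    rw [κ.val_symm_apply hz]
    exact κ.toHomeo.map_source hz
  map_target' x hx := by
    rw [dif_pos (κ.norm_symm_le hx)]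
    exact κ.toHomeo.map_target hx
  left_inv' z hz := by
    have h : κ.toHomeo.symm ((𝓡∂ (2 * n + 2)).symm (κ.toHomeo z)).1 = z := by
      rw [κ.val_symm_apply hz, κ.toHomeo.left_inv hz]
    rw [dif_pos (by rw [h]; exact mem_closedBall_zero_iff.mp z.2)]
    exact Subtype.ext h
  right_inv' x hx := by
    rw [dif_pos (κ.norm_symm_le hx)]
    change (𝓡∂ (2 * n + 2)).symm (κ.toHomeo (κ.toHomeo.symm x.1)) = x
    rw [κ.toHomeo.right_inv hx]
    exact (𝓡∂ (2 * n + 2)).left_inv x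
  open_source := κ.toHomeo.open_source.preimage continuous_subtype_val
  open_target := κ.toHomeo.open_target.preimage continuous_subtype_val
  continuousOn_toFun := (𝓡∂ (2 * n + 2)).continuous_symm.comp_continuousOn
    (κ.toHomeo.continuousOn.comp continuous_subtype_val.continuousOn fun _ h => h)
  continuousOn_invFun := by
    rw [Topology.IsInducing.subtypeVal.continuousOn_iff]
    refine (κ.toHomeo.symm.continuousOn.comp continuous_subtype_val.continuousOn
      fun _ h => h).congr fun x hx => ?_
    simp only [Function.comp_apply]
    rw [dif_pos (κ.norm_symm_le hx)]

theorem val_toBall {z : Ball n} (hz : z ∈ κ.toBall.source) : (κ.toBall z).1 = κ.toHomeo z :=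
  κ.val_symm_apply hz

theorem val_toBall_symm {x : EuclideanHalfSpace (2 * n + 2)} (hx : x ∈ κ.toBall.target) :
    (κ.toBall.symm x : EuclideanSpace ℂ (Fin (n + 1))) = κ.toHomeo.symm x.1 := by
  have h : κ.toBall.symm x =
      ⟨κ.toHomeo.symm x.1, mem_closedBall_zero_iff.mpr (κ.norm_symm_le hx)⟩ :=
    dif_pos (κ.norm_symm_le hx)
  rw [h]

end HalfChart

end

end GenLens

open scoped Topology

namespace GenLens

noncomputable section

variable {n : ℕ}

namespace LensCharacteristic.Resolution

variable {ξ : LensCharacteristic n} {R : ξ.Resolution}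

/-! ### The smooth structure of the filling -/

theorem IsSection.mem_source {P : Frame n} {s : OpenPartialHomeomorph R.Filling (Ball n)}
    (hs : R.IsSection P s) {z : Ball n} (hz : z ∈ s.target) :
    R.param P z ∈ s.source ∧ s (R.param P z) = z := by
  rw [← (hs z hz).2]
  exact ⟨s.map_target hz, s.right_inv hz⟩

theorem IsSection.apply {P : Frame n} {s : OpenPartialHomeomorph R.Filling (Ball n)}
    (hs : R.IsSection P s) {m : R.Filling} (hm : m ∈ s.source) :
    (s m : EuclideanSpace ℂ (Fin (n + 1))) ∈ R.domain P ∧ R.param P (s m) = m := by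
  obtain ⟨h1, h2⟩ := hs _ (s.map_source hm)
  exact ⟨h1, by rw [← h2, s.left_inv hm]⟩

theorem exists_isOpen_target (s : OpenPartialHomeomorph R.Filling (Ball n)) :
    ∃ O : Set (EuclideanSpace ℂ (Fin (n + 1))), IsOpen O ∧ ∀ z : Ball n, z ∈ s.target ↔
      (z : EuclideanSpace ℂ (Fin (n + 1))) ∈ O := by
  obtain ⟨O, hO, h⟩ := isOpen_induced_iff.mp s.open_target
  exact ⟨O, hO, fun z => by rw [← h]; rfl⟩

/-- The change of charts of the filling is the restriction of a smooth map. -/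
theorem exists_transition {P Q : Frame n} (hP : R.IsPatch P) (hQ : R.IsPatch Q)
    {s s' : OpenPartialHomeomorph R.Filling (Ball n)} (hs : R.IsSection P s)
    (hs' : R.IsSection Q s') (κ κ' : HalfChart n) {m : R.Filling}
    (hm : m ∈ (s.trans κ.toBall).source) (hm' : m ∈ (s'.trans κ'.toBall).source) :
    ∃ G : EuclideanSpace ℝ (Fin (2 * n + 2)) → EuclideanSpace ℝ (Fin (2 * n + 2)),
      ContDiffAt ℝ ∞ G ((s.trans κ.toBall) m).1 ∧
      (κ.IsPositive → κ'.IsPositive → 0 < (fderiv ℝ G ((s.trans κ.toBall) m).1).det) ∧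
      ∀ᶠ y in 𝓝[Set.range (𝓡∂ (2 * n + 2))] ((s.trans κ.toBall) m).1,
        ((s'.trans κ'.toBall) ((s.trans κ.toBall).symm ((𝓡∂ (2 * n + 2)).symm y))).1 = G y := by
  obtain ⟨hms, hmκ⟩ := hm
  obtain ⟨hms', hmκ'⟩ := hm'
  obtain ⟨hd, hp⟩ := hs.apply hms
  obtain ⟨hd', hp'⟩ := hs'.apply hms'
  set z := s m with hz
  set z' := s' m with hz'
  have hball : ∀ b : Ball n, ‖(b : EuclideanSpace ℂ (Fin (n + 1)))‖ ≤ 1 := fun b =>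
    mem_closedBall_zero_iff.mp b.2
  obtain ⟨W, hWz, hW⟩ := exists_isGerm hP hQ hd hd' (hball z) (hball z') (hp.trans hp'.symm)
  have hzκ : (z : EuclideanSpace ℂ (Fin (n + 1))) ∈ κ.toHomeo.source := hmκ
  have hzκ' : W z ∈ κ'.toHomeo.source := hWz ▸ hmκ'
  have hx : ((s.trans κ.toBall) m).1 = κ.toHomeo z := κ.val_toBall hmκ
  rw [hx]
  have hxt := κ.toHomeo.map_source hzκ
  have hinv : κ.toHomeo.symm (κ.toHomeo z) = z := κ.toHomeo.left_inv hzκ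
  have h1 : ContDiffAt ℝ ∞ κ.toHomeo.symm (κ.toHomeo z) := κ.contDiffAt_symm hxt
  have h2 : ContDiffAt ℝ ∞ W (κ.toHomeo.symm (κ.toHomeo z)) := hinv.symm ▸ hW.contDiffAt
  have h3 : ContDiffAt ℝ ∞ κ'.toHomeo (W (κ.toHomeo.symm (κ.toHomeo z))) :=
    κ'.contDiffAt (hinv.symm ▸ hzκ')
  -- The germ `W` lives on a full neighbourhood in $\mathbb C^{n+1}$, also across the unit sphere,
  -- so this map extends the transition beyond the half space.
  refine ⟨fun y => κ'.toHomeo (W (κ.toHomeo.symm y)),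
    h3.comp (κ.toHomeo z) (h2.comp (κ.toHomeo z) h1), fun hpos hpos' => ?_,
    ?_⟩
  · have hfd := ((h3.differentiableAt (by simp)).hasFDerivAt.comp (κ.toHomeo z)
      ((h2.differentiableAt (by simp)).hasFDerivAt.comp (κ.toHomeo z)
        (h1.differentiableAt (by simp)).hasFDerivAt)).fderiv
    have e1 := κ.det_symm_mul_jacobian hxt
    rw [hinv] at e1 hfd
    have e2 := hpos z hzκ
    have e3 := hpos' (W z) hzκ'
    have e4 := hW.det_pos
    change 0 < (fderiv ℝ (κ'.toHomeo ∘ W ∘ κ.toHomeo.symm) (κ.toHomeo z)).det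
    rw [hfd]
    set J : EuclideanSpace ℂ (Fin (n + 1)) →L[ℝ] EuclideanSpace ℝ (Fin (2 * n + 2)) :=
      ((realIsometry n).toContinuousLinearEquiv :
        EuclideanSpace ℂ (Fin (n + 1)) →L[ℝ] EuclideanSpace ℝ (Fin (2 * n + 2)))
    -- After conjugation by the isometry the determinant splits into the Jacobian of `κ'`, the
    -- determinant of the germ and the inverse of the Jacobian of `κ`.
    have e5 : LinearMap.det ((realIsometry n).symm.toLinearEquiv.toLinearMap ∘ₗ
        (fderiv ℝ κ'.toHomeo (W z) ∘L fderiv ℝ W z ∘L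
          fderiv ℝ κ.toHomeo.symm (κ.toHomeo z)).toLinearMap ∘ₗ
        (realIsometry n).symm.toLinearEquiv.symm.toLinearMap) =
        κ'.jacobian (W z) * ((fderiv ℝ W z).det *
          (fderiv ℝ κ.toHomeo.symm (κ.toHomeo z) ∘L J).det) := by
      rw [HalfChart.jacobian, ← HalfChart.det_comp, ← HalfChart.det_comp]
      rfl
    rw [LinearMap.det_conj] at e5
    refine lt_of_lt_of_eq ?_ e5.symm
    have e6 : 0 < (fderiv ℝ κ.toHomeo.symm (κ.toHomeo z) ∘L J).det :=
      pos_of_mul_pos_left (lt_of_lt_of_eq one_pos e1.symm) e2.le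
    positivity
  · obtain ⟨O, hO, hOs⟩ := exists_isOpen_target s
    obtain ⟨O', hO', hOs'⟩ := exists_isOpen_target s'
    have hzO : (z : EuclideanSpace ℂ (Fin (n + 1))) ∈ O := (hOs z).mp (s.map_source hms)
    have hzO' : W z ∈ O' := hWz ▸ (hOs' z').mp (s'.map_source hms')
    have hc : Filter.Tendsto κ.toHomeo.symm (𝓝 (κ.toHomeo z)) (𝓝 (z : EuclideanSpace ℂ _)) := by
      have := h1.continuousAt.tendsto
      rwa [hinv] at this
    have hE : ∀ᶠ u in 𝓝 (z : EuclideanSpace ℂ (Fin (n + 1))), u ∈ O ∧ W u ∈ O' ∧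
        W u ∈ κ'.toHomeo.source := by
      filter_upwards [hO.mem_nhds hzO, hW.contDiffAt.continuousAt.preimage_mem_nhds
        (hO'.mem_nhds hzO'), hW.contDiffAt.continuousAt.preimage_mem_nhds
        (κ'.toHomeo.open_source.mem_nhds hzκ')] with u a b c
      exact ⟨a, b, c⟩
    filter_upwards [self_mem_nhdsWithin, nhdsWithin_le_nhds (κ.toHomeo.open_target.mem_nhds hxt),
      nhdsWithin_le_nhds (hc.eventually hE), nhdsWithin_le_nhds (hc.eventually hW.eventually)]
      with y hyr hyt ⟨f1, f2, f3⟩ ⟨f4, f5, f6, f7⟩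
    have hIy : ((𝓡∂ (2 * n + 2)).symm y).1 = y := (𝓡∂ (2 * n + 2)).right_inv hyr
    set x := (𝓡∂ (2 * n + 2)).symm y
    have hxtb : x ∈ κ.toBall.target := by
      change x.1 ∈ κ.toHomeo.target
      rw [hIy]
      exact hyt
    have hb := κ.val_toBall_symm hxtb
    rw [hIy] at hb
    have hbt : κ.toBall.symm x ∈ s.target := by
      rw [hOs, hb]
      exact f1
    have hu1 : ‖κ.toHomeo.symm y‖ ≤ 1 := hb ▸ hball _
    -- Both norms compare with 1 as the level compares with the bound, so the germ respects the
    -- closed ball.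
    have hu1' := (norm_eq_of_base_eq hP hQ f4 f5 f6.symm).1.mp hu1
    let b' : Ball n := ⟨W (κ.toHomeo.symm y), mem_closedBall_zero_iff.mpr hu1'⟩
    have hb' : b' ∈ s'.target := (hOs' b').mpr f2
    have hsy : (s.trans κ.toBall).symm x = R.param Q b' := by
      change s.symm (κ.toBall.symm x) = _
      rw [(hs _ hbt).2, hb]
      exact (f7 hu1).symm
    rw [hsy]
    change (κ'.toBall (s' (R.param Q b'))).1 = _
    rw [(hs'.mem_source hb').2, κ'.val_toBall f3]

variable (R) in
/-- The charts of the filling. -/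
def fillingAtlas : Set (OpenPartialHomeomorph R.Filling (EuclideanHalfSpace (2 * n + 2))) :=
  {c | ∃ (P : Frame n) (s : OpenPartialHomeomorph R.Filling (Ball n)) (κ : HalfChart n),
    R.IsPatch P ∧ R.IsSection P s ∧ c = s.trans κ.toBall}

theorem exists_chart (m : R.Filling) : ∃ (P : Frame n)
    (s : OpenPartialHomeomorph R.Filling (Ball n)) (κ : HalfChart n),
    R.IsPatch P ∧ R.IsSection P s ∧ κ.IsPositive ∧ m ∈ (s.trans κ.toBall).source := by
  obtain ⟨P, z, hP, hz, rfl, -⟩ := R.exists_patch m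
  obtain ⟨s, hs, hzs⟩ := hP.exists_section hz
  obtain ⟨κ, hκ, hzκ⟩ := HalfChart.exists_isPositive z
  obtain ⟨h1, h2⟩ := hs.mem_source hzs
  refine ⟨P, s, κ, hP, hs, hκ, h1, ?_⟩
  change (s (R.param P z) : EuclideanSpace ℂ (Fin (n + 1))) ∈ κ.toHomeo.source
  rw [h2]
  exact hzκ

theorem exists_mem_fillingAtlas (m : R.Filling) : ∃ c ∈ R.fillingAtlas, m ∈ c.source := by
  obtain ⟨P, s, κ, hP, hs, -, hm⟩ := exists_chart m
  exact ⟨_, ⟨P, s, κ, hP, hs, rfl⟩, hm⟩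

instance : ChartedSpace (EuclideanHalfSpace (2 * n + 2)) R.Filling where
  atlas := R.fillingAtlas
  chartAt m := (exists_mem_fillingAtlas m).choose
  mem_chart_source m := (exists_mem_fillingAtlas m).choose_spec.2
  chart_mem_atlas m := (exists_mem_fillingAtlas m).choose_spec.1

instance : IsManifold (𝓡∂ (2 * n + 2)) ∞ R.Filling := by
  refine isManifold_of_contDiffOn _ _ _ ?_
  rintro _ _ ⟨P, s, κ, hP, hs, rfl⟩ ⟨Q, s', κ', hQ, hs', rfl⟩ y ⟨hy, x, rfl⟩
  have hy' : x ∈ ((s.trans κ.toBall).symm.trans (s'.trans κ'.toBall)).source := by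
    have := (𝓡∂ (2 * n + 2)).left_inv x
    rw [Set.mem_preimage, this] at hy
    exact hy
  set m := (s.trans κ.toBall).symm x with hm
  have hxm : (s.trans κ.toBall) m = x := (s.trans κ.toBall).right_inv hy'.1
  obtain ⟨G, hG, -, hev⟩ := exists_transition hP hQ hs hs' κ κ'
    ((s.trans κ.toBall).map_target hy'.1) (m := m) hy'.2
  rw [hxm] at hG hev
  have h1 : ContDiffWithinAt ℝ ∞ ((𝓡∂ (2 * n + 2)) ∘
      ((s.trans κ.toBall).symm.trans (s'.trans κ'.toBall)) ∘ (𝓡∂ (2 * n + 2)).symm)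
      (Set.range (𝓡∂ (2 * n + 2))) ((𝓡∂ (2 * n + 2)) x) :=
    hG.contDiffWithinAt.congr_of_eventuallyEq hev (hev.self_of_nhdsWithin ⟨x, rfl⟩)
  exact h1.mono Set.inter_subset_right

theorem mem_maximalAtlas {P : Frame n} (hP : R.IsPatch P)
    {s : OpenPartialHomeomorph R.Filling (Ball n)} (hs : R.IsSection P s) (κ : HalfChart n) :
    s.trans κ.toBall ∈ IsManifold.maximalAtlas (𝓡∂ (2 * n + 2)) ∞ R.Filling :=
  IsManifold.subset_maximalAtlas ⟨P, s, κ, hP, hs, rfl⟩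

variable (R) in
theorem isOrientable_filling : IsOrientable (2 * n + 2) R.Filling := by
  refine ⟨{c | ∃ (P : Frame n) (s : OpenPartialHomeomorph R.Filling (Ball n)) (κ : HalfChart n),
    R.IsPatch P ∧ R.IsSection P s ∧ κ.IsPositive ∧ c = s.trans κ.toBall}, ?_, fun m => ?_, ?_⟩
  · rintro _ ⟨P, s, κ, hP, hs, -, rfl⟩
    exact mem_maximalAtlas hP hs κ
  · obtain ⟨P, s, κ, hP, hs, hκ, hm⟩ := exists_chart m
    exact ⟨_, ⟨P, s, κ, hP, hs, hκ, rfl⟩, hm⟩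
  · rintro _ ⟨P, s, κ, hP, hs, hκ, rfl⟩ _ ⟨Q, s', κ', hQ, hs', hκ', rfl⟩ m ⟨hm, hm'⟩
    obtain ⟨G, hG, hdet, hev⟩ := exists_transition hP hQ hs hs' κ κ' hm hm'
    have hr : ((s.trans κ.toBall) m).1 ∈ Set.range (𝓡∂ (2 * n + 2)) :=
      ⟨(s.trans κ.toBall) m, rfl⟩
    have h1 : fderivWithin ℝ ((s'.trans κ'.toBall).extend (𝓡∂ (2 * n + 2)) ∘
        ((s.trans κ.toBall).extend (𝓡∂ (2 * n + 2))).symm) (Set.range (𝓡∂ (2 * n + 2)))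
        ((s.trans κ.toBall).extend (𝓡∂ (2 * n + 2)) m) =
        fderiv ℝ G ((s.trans κ.toBall) m).1 := by
      -- A half space has unique derivatives, so the derivative within it at a boundary point is
      -- that of the smooth extension `G`.
      rw [← fderivWithin_eq_fderiv ((𝓡∂ (2 * n + 2)).uniqueDiffOn _ hr)
        (hG.differentiableAt (by simp))]
      exact Filter.EventuallyEq.fderivWithin_eq hev (hev.self_of_nhdsWithin hr)
    rw [h1]
    exact hdet hκ hκ'

/-- The first chart coordinate vanishes exactly on the unit sphere, which a patch matches with the
top level of the polytope. -/
theorem mem_boundary_iff (m : R.Filling) :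
    m ∈ (𝓡∂ (2 * n + 2)).boundary R.Filling ↔ R.level (R.moment m) = R.bound := by
  obtain ⟨P, s, κ, hP, hs, hc⟩ :=
    ChartedSpace.chart_mem_atlas (H := EuclideanHalfSpace (2 * n + 2)) m
  have hm := ChartedSpace.mem_chart_source (H := EuclideanHalfSpace (2 * n + 2)) m
  change extChartAt (𝓡∂ (2 * n + 2)) m m ∈ frontier (Set.range (𝓡∂ (2 * n + 2))) ↔ _
  have h1 : extChartAt (𝓡∂ (2 * n + 2)) m m = (ChartedSpace.chartAt m m :
    EuclideanHalfSpace (2 * n + 2)).1 := rfl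
  rw [hc] at hm h1
  have h2 : ((s.trans κ.toBall) m).1 = κ.toHomeo (s m) := κ.val_toBall hm.2
  rw [frontier_range_modelWithCornersEuclideanHalfSpace, h1, h2]
  obtain ⟨hd, hp⟩ := hs.apply hm.1
  have hb := R.moment_param (hP.base_mem hd (mem_closedBall_zero_iff.mp (s m).2))
  rw [hp] at hb
  rw [hb]
  change 0 = κ.toHomeo (s m) 0 ↔ _
  have hsκ : (s m : EuclideanSpace ℂ (Fin (n + 1))) ∈ κ.toHomeo.source := hm.2
  rw [eq_iff_le_not_lt, ← κ.norm_le_iff _ hsκ, ← κ.norm_lt_iff _ hsκ, hP.norm_le _ hd,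
    hP.norm_lt _ hd,
    eq_iff_le_not_lt]

end LensCharacteristic.Resolution

end

end GenLens

open scoped Topology

namespace GenLens

noncomputable section

variable {n : ℕ}

/-! ### Smoothness of the torus action -/

theorem contMDiff_coe_circle : ContMDiff (𝓡 1) 𝓘(ℝ, ℂ) ∞ (fun t : Circle => (t : ℂ)) :=
  have := finrank_real_complex_fact'
  contMDiff_coe_sphere (E := ℂ) (n := 1)

theorem contMDiff_torus_coord (k : Fin (n + 1)) :
    ContMDiff (torusModel n) 𝓘(ℝ, ℂ) ∞ (fun t : Torus n => ((t k : Circle) : ℂ)) := by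
  intro t
  rw [contMDiffAt_iff]
  refine ⟨(continuous_subtype_val.comp (continuous_apply k)).continuousAt, ?_⟩
  have h := (contMDiffAt_iff.mp (contMDiff_coe_circle (t k))).2
  rw [modelWithCornersSelf_coe, Set.range_id, contDiffWithinAt_univ] at h
  exact (ContDiffAt.comp (extChartAt (torusModel n) t t) h
    (ContinuousLinearMap.proj (R := ℝ) (φ := fun _ : Fin (n + 1) => EuclideanSpace ℝ (Fin 1))
      k).contDiff.contDiffAt).contDiffWithinAt

theorem contMDiff_torusHom_coord (V : Fin (n + 1) → Fin (n + 1) → ℤ) (k : Fin (n + 1)) :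
    ContMDiff (torusModel n) 𝓘(ℝ, ℂ) ∞ (fun t : Torus n => ((torusHom V t k : Circle) : ℂ)) := by
  have hcoe : (fun t : Torus n => ((torusHom V t k : Circle) : ℂ)) =
      fun t => ∏ j, ((t j : Circle) : ℂ) ^ V j k := by
    funext t
    refine (map_prod Circle.coeHom (fun j => t j ^ V j k) Finset.univ).trans ?_
    exact Finset.prod_congr rfl fun j _ => Circle.coe_zpow _ _
  rw [hcoe]
  intro t
  have h : ContDiffAt ℝ ∞ (fun c : Fin (n + 1) → ℂ => ∏ j, c j ^ V j k) (fun j => (t j : ℂ)) :=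
    contDiffAt_prod fun j _ => contDiffAt_zpow_comp (contDiff_apply ℝ ℂ j).contDiffAt
      (Circle.coe_ne_zero _) _
  exact ContMDiffAt.comp (g := fun c : Fin (n + 1) → ℂ => ∏ j, c j ^ V j k) t h.contMDiffAt
    (contMDiffAt_pi_space.mpr fun j => contMDiff_torus_coord j t)

/-- The homomorphism `torusHom V` has local sections that depend smoothly on the point. -/
theorem exists_smooth_preimage {V : Fin (n + 1) → Fin (n + 1) → ℤ} (hV : (Matrix.of V).det ≠ 0)
    (t₀ : Torus n) : ∃ σ : (Fin (n + 1) → ℂ) → Fin (n + 1) → ℂ,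
      (∀ i, ContDiffAt ℝ ∞ (fun c => σ c i) fun k => (t₀ k : ℂ)) ∧
      ∀ t : Torus n, ∃ s, torusHom V s = t ∧ ∀ i, (s i : ℂ) = σ (fun k => (t k : ℂ)) i := by
  obtain ⟨s₀, rfl⟩ := torusHom_surjective_of_det hV t₀
  set t₀ := torusHom V s₀ with ht₀
  -- Angles are measured relative to `t₀`, so the principal branch is smooth at the base point. The
  -- formula gives a preimage of every `t`, but its smoothness is claimed at `t₀` alone.
  refine ⟨fun c i => s₀ i * Complex.exp ((∑ k, Complex.arg (c k * (t₀ k : ℂ)⁻¹) *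
    (realMatrix V)⁻¹ k i : ℝ) * Complex.I), fun i => ?_, fun t => ?_⟩
  · refine contDiffAt_const.mul (ContDiffAt.cexp (ContDiffAt.mul ?_ contDiffAt_const))
    refine ContDiffAt.comp (g := fun r : ℝ => (r : ℂ)) (fun k => (t₀ k : ℂ))
      Complex.ofRealCLM.contDiff.contDiffAt ?_
    refine ContDiffAt.sum fun k _ => ContDiffAt.mul ?_ contDiffAt_const
    have h1 : ContDiffAt ℝ ∞ (fun c : Fin (n + 1) → ℂ => c k * (t₀ k : ℂ)⁻¹)
        (fun k => (t₀ k : ℂ)) := (contDiff_apply ℝ ℂ k).contDiffAt.mul contDiffAt_const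
    have h2 : ContDiffAt ℝ ∞ Complex.log ((t₀ k : ℂ) * (t₀ k : ℂ)⁻¹) := by
      rw [mul_inv_cancel₀ (Circle.coe_ne_zero _)]
      exact (Complex.contDiffAt_log Complex.one_mem_slitPlane).restrict_scalars ℝ
    have h3 := Complex.imCLM.contDiff.contDiffAt.comp (fun k => (t₀ k : ℂ))
      (h2.comp (fun k => (t₀ k : ℂ)) h1)
    simp only [Function.comp_def, Complex.imCLM_apply, Complex.log_im] at h3
    exact h3
  · let φ : Fin (n + 1) → ℝ := fun k => Complex.arg ((t k : ℂ) * (t₀ k : ℂ)⁻¹)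
    refine ⟨s₀ * fun i => Circle.exp (Matrix.vecMul φ (realMatrix V)⁻¹ i), ?_, fun i => ?_⟩
    · rw [map_mul, torusHom_exp, Matrix.vecMul_vecMul,
        Matrix.nonsing_inv_mul _ (isUnit_det_realMatrix hV), Matrix.vecMul_one]
      funext k
      have h : Circle.exp (φ k) = t k * (t₀ k)⁻¹ := by
        rw [← Circle.exp_arg (t k * (t₀ k)⁻¹)]
        simp [φ]
      change t₀ k * Circle.exp (φ k) = t k
      rw [h, mul_comm, inv_mul_cancel_right]
    · change ((s₀ i * Circle.exp _ : Circle) : ℂ) = _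
      rw [Circle.coe_mul, Circle.coe_exp]
      rfl

namespace LensCharacteristic.Resolution

variable {ξ : LensCharacteristic n} {R : ξ.Resolution} {P : Frame n}
  {s : OpenPartialHomeomorph R.Filling (Ball n)}

theorem contMDiffAt_section (hP : R.IsPatch P) (hs : R.IsSection P s) {m : R.Filling}
    (hm : m ∈ s.source) : ContMDiffAt (𝓡∂ (2 * n + 2)) 𝓘(ℝ, EuclideanSpace ℂ (Fin (n + 1))) ∞
      (fun m => (s m : EuclideanSpace ℂ (Fin (n + 1)))) m := by
  obtain ⟨κ, hκ⟩ := HalfChart.exists_mem_source (s m)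
  have hmc : m ∈ (s.trans κ.toBall).source := ⟨hm, hκ⟩
  have h1 := (s.trans κ.toBall).contMDiffAt_extend (mem_maximalAtlas hP hs κ) hmc
  have hx : (s.trans κ.toBall).extend (𝓡∂ (2 * n + 2)) m = κ.toHomeo (s m) := κ.val_toBall hκ
  have h2 : ContDiffAt ℝ ∞ κ.toHomeo.symm ((s.trans κ.toBall).extend (𝓡∂ (2 * n + 2)) m) := by
    rw [hx]
    exact κ.contDiffAt_symm (κ.toHomeo.map_source hκ)
  refine (h2.contMDiffAt.comp m h1).congr_of_eventuallyEq ?_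
  filter_upwards [(s.trans κ.toBall).open_source.mem_nhds hmc] with m' hm'
  have hx' : (s.trans κ.toBall).extend (𝓡∂ (2 * n + 2)) m' = κ.toHomeo (s m') :=
    κ.val_toBall hm'.2
  rw [Function.comp_apply, hx']
  exact (κ.toHomeo.left_inv hm'.2).symm

variable {F H N : Type*} [NormedAddCommGroup F] [NormedSpace ℝ F] [TopologicalSpace H]
  {J : ModelWithCorners ℝ F H} [TopologicalSpace N] [ChartedSpace H N]

/-- Since `s` inverts `param` on its target, `f` reads in a chart as a half chart applied to `g`.
Smoothness of maps into the filling can thus be checked on lifts to the ball. -/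
theorem contMDiffAt_of_param (hP : R.IsPatch P) (hs : R.IsSection P s) {f : N → R.Filling}
    {g : N → EuclideanSpace ℂ (Fin (n + 1))} {x : N} {b : Ball n} (hb : b ∈ s.target)
    (hgx : g x = b) (hg : ContMDiffAt J 𝓘(ℝ, EuclideanSpace ℂ (Fin (n + 1))) ∞ g x)
    (hfg : ∀ᶠ y in 𝓝 x, ‖g y‖ ≤ 1 ∧ f y = R.param P (g y)) :
    ContMDiffAt J (𝓡∂ (2 * n + 2)) ∞ f x := by
  obtain ⟨κ, hκ⟩ := HalfChart.exists_mem_source b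
  obtain ⟨O, hO, hOs⟩ := exists_isOpen_target s
  have hbt : κ.toBall b ∈ (s.trans κ.toBall).target := by
    refine ⟨κ.toBall.map_source hκ, ?_⟩
    change κ.toBall.symm (κ.toBall b) ∈ s.target
    rw [κ.toBall.left_inv hκ]
    exact hb
  have h1 := contMDiffAt_symm_of_mem_maximalAtlas (mem_maximalAtlas hP hs κ) hbt
  have h2 : ContMDiffAt J 𝓘(ℝ, EuclideanSpace ℝ (Fin (2 * n + 2))) ∞ (fun y => κ.toHomeo (g y)) x :=
    (κ.contDiffAt (hgx ▸ hκ)).contMDiffAt.comp x hg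
  have hev : ∀ᶠ y in 𝓝 x, ‖g y‖ ≤ 1 ∧ g y ∈ κ.toHomeo.source ∧ g y ∈ O ∧
      f y = R.param P (g y) := by
    filter_upwards [hfg, hg.continuousAt.preimage_mem_nhds
      (κ.toHomeo.open_source.mem_nhds (hgx ▸ hκ)), hg.continuousAt.preimage_mem_nhds
      (hO.mem_nhds (hgx ▸ (hOs b).mp hb))] with y a b c
    exact ⟨a.1, b, c, a.2⟩
  let S : Set N := {y | κ.toHomeo (g y) ∈ Set.range (𝓡∂ (2 * n + 2))}
  have hrange : ∀ y, ‖g y‖ ≤ 1 → g y ∈ κ.toHomeo.source → y ∈ S := by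
    intro y hy1 hy2
    change κ.toHomeo (g y) ∈ Set.range (𝓡∂ (2 * n + 2))
    rw [range_modelWithCornersEuclideanHalfSpace]
    exact (κ.norm_le_iff _ hy2).mp hy1
  have hS : S ∈ 𝓝 x := by
    filter_upwards [hev] with y hy
    exact hrange y hy.1 hy.2.1
  have h3 : ContMDiffAt J (𝓡∂ (2 * n + 2)) ∞
      (fun y => (𝓡∂ (2 * n + 2)).symm (κ.toHomeo (g y))) x :=
    (((𝓡∂ (2 * n + 2)).contMDiffOn_symm _ (show x ∈ S from mem_of_mem_nhds hS)).comp x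
      h2.contMDiffWithinAt
      (s := S) fun y hy => hy).contMDiffAt hS
  have hx : (𝓡∂ (2 * n + 2)).symm (κ.toHomeo (g x)) = κ.toBall b := by
    rw [hgx]
    rfl
  have h4 : ContMDiffAt (𝓡∂ (2 * n + 2)) (𝓡∂ (2 * n + 2)) ∞ (s.trans κ.toBall).symm
      ((𝓡∂ (2 * n + 2)).symm (κ.toHomeo (g x))) := hx ▸ h1
  refine (h4.comp x h3).congr_of_eventuallyEq ?_
  filter_upwards [hev] with y ⟨y1, y2, y3, y4⟩
  let c : Ball n := ⟨g y, mem_closedBall_zero_iff.mpr y1⟩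
  have hc : c ∈ s.target := (hOs c).mpr y3
  change f y = s.symm (κ.toBall.symm (κ.toBall c))
  rw [κ.toBall.left_inv y2, (hs c hc).2, y4]

/-- In a patch, `torusHom P.V r` acts as rotation by `r`, and near a given torus element `r` can be
chosen smoothly. Rotations preserve the domain of the patch, so a second section of the same patch
serves as chart at the image. -/
theorem contMDiff_smul_filling {τ : N → Torus n}
    (hτ : ∀ k, ContMDiff J 𝓘(ℝ, ℂ) ∞ fun t => ((τ t k : Circle) : ℂ)) :
    ContMDiff (J.prod (𝓡∂ (2 * n + 2))) (𝓡∂ (2 * n + 2)) ∞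
      fun a : N × R.Filling => τ a.1 • a.2 := by
  rintro ⟨t₀, m₀⟩
  obtain ⟨P, s, κ, hP, hs, -, hm₀⟩ := exists_chart m₀
  have hms : m₀ ∈ s.source := hm₀.1
  obtain ⟨σ, hσ, hσs⟩ := exists_smooth_preimage P.det_ne_zero (τ t₀)
  let g : N × R.Filling → EuclideanSpace ℂ (Fin (n + 1)) := fun a =>
    WithLp.toLp 2 fun i => σ (fun k => (τ a.1 k : ℂ)) i * (s a.2 : EuclideanSpace ℂ _) i
  have hrot : ∀ (t : N) (m : R.Filling), ∃ r, torusHom P.V r = τ t ∧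
      g (t, m) = rotate r (s m : EuclideanSpace ℂ (Fin (n + 1))) := by
    intro t m
    obtain ⟨r, hr, hri⟩ := hσs (τ t)
    refine ⟨r, hr, ?_⟩
    ext i
    change _ = (r i : ℂ) * (s m : EuclideanSpace ℂ _) i
    rw [hri]
  have hball : ∀ b : Ball n, ‖(b : EuclideanSpace ℂ (Fin (n + 1)))‖ ≤ 1 := fun b =>
    mem_closedBall_zero_iff.mp b.2
  have hnorm : ∀ a, ‖g a‖ ≤ 1 := by
    rintro ⟨t, m⟩
    obtain ⟨r, -, h⟩ := hrot t m
    rw [h, norm_rotate]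
    exact hball _
  have hsmul : ∀ (t : N) (m : R.Filling), m ∈ s.source →
      g (t, m) ∈ R.domain P ∧ τ t • m = R.param P (g (t, m)) := by
    intro t m hm
    obtain ⟨r, hr, h⟩ := hrot t m
    obtain ⟨h1, h2⟩ := hs.apply hm
    refine ⟨by rw [h]; exact R.rotate_mem_domain r h1, ?_⟩
    rw [h, ← R.torusHom_smul_param r h1 (hP.base_mem h1 (hball _)), hr, h2]
  let b : Ball n := ⟨g (t₀, m₀), mem_closedBall_zero_iff.mpr (hnorm _)⟩
  obtain ⟨s', hs', hb⟩ := hP.exists_section (z := b) (hsmul t₀ m₀ hms).1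
  refine contMDiffAt_of_param (g := g) hP hs' hb rfl ?_ ?_
  · have h1 : ContMDiffAt (J.prod (𝓡∂ (2 * n + 2))) 𝓘(ℝ, Fin (n + 1) → ℂ) ∞
        (fun a : N × R.Filling => fun k => ((τ a.1 k : Circle) : ℂ)) (t₀, m₀) :=
      contMDiffAt_pi_space.mpr fun k =>
        ContMDiffAt.comp (g := fun t => ((τ t k : Circle) : ℂ)) (t₀, m₀) (hτ k t₀) contMDiffAt_fst
    have h2 : ContMDiffAt (J.prod (𝓡∂ (2 * n + 2))) 𝓘(ℝ, EuclideanSpace ℂ (Fin (n + 1))) ∞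
        (fun a : N × R.Filling => (s a.2 : EuclideanSpace ℂ (Fin (n + 1)))) (t₀, m₀) :=
      ContMDiffAt.comp (g := fun m => (s m : EuclideanSpace ℂ (Fin (n + 1)))) (t₀, m₀)
        (contMDiffAt_section hP hs hms) contMDiffAt_snd
    let Φ : (Fin (n + 1) → ℂ) × EuclideanSpace ℂ (Fin (n + 1)) → EuclideanSpace ℂ (Fin (n + 1)) :=
      fun a => WithLp.toLp 2 fun i => σ a.1 i * a.2 i
    have h3 : ContDiffAt ℝ ∞ Φ
        (fun k => (τ t₀ k : ℂ), (s m₀ : EuclideanSpace ℂ (Fin (n + 1)))) := by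
      refine contDiffAt_toLp fun i => ContDiffAt.mul ?_ ?_
      · exact (hσ i).comp (fun k => (τ t₀ k : ℂ), (s m₀ : EuclideanSpace ℂ (Fin (n + 1))))
          contDiffAt_fst
      · exact (contDiff_coord i).contDiffAt.comp
          (fun k => (τ t₀ k : ℂ), (s m₀ : EuclideanSpace ℂ (Fin (n + 1)))) contDiffAt_snd
    exact ContMDiffAt.comp (g := Φ) (t₀, m₀) h3.contMDiffAt (h1.prodMk_space h2)
  · have : ∀ᶠ a : N × R.Filling in 𝓝 (t₀, m₀), a.2 ∈ s.source :=
      continuous_snd.continuousAt.eventually (s.open_source.mem_nhds hms)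
    filter_upwards [this] with a ha
    exact ⟨hnorm a, (hsmul a.1 a.2 ha).2⟩

end LensCharacteristic.Resolution

end

end GenLens

open scoped Topology

namespace GenLens

noncomputable section

variable {n : ℕ}

/-! ### Quotients of the odd sphere -/

theorem contMDiff_smul_sphere (t : Torus n) :
    ContMDiff (𝓡 (2 * n + 1)) (𝓡 (2 * n + 1)) ∞ fun z : OddSphere n => t • z := by
  have h : ContMDiff (𝓡 (2 * n + 1)) 𝓘(ℝ, EuclideanSpace ℂ (Fin (n + 1))) ∞
      fun z : OddSphere n => rotate t z := by
    have h1 : ContDiff ℝ ∞ (rotate t) := by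
      rw [rotate_eq_mulCoord]
      exact (mulCoord _).contDiff
    exact h1.contMDiff.comp contMDiff_coe_sphere
  exact h.codRestrict_sphere fun z => (t • z).2

section Quotient

variable (H : Subgroup (Torus n))

/-- The projection of the sphere to its quotient. -/
def toQuotient (z : OddSphere n) : MulAction.orbitRel.Quotient H (OddSphere n) := Quotient.mk'' z

variable {H}

theorem toQuotient_surjective : Function.Surjective (toQuotient H) := Quotient.mk''_surjective

theorem toQuotient_eq {z w : OddSphere n} :
    toQuotient H z = toQuotient H w ↔ ∃ g ∈ H, g • w = z := by
  refine Quotient.eq''.trans ⟨?_, ?_⟩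
  · rintro ⟨g, h⟩
    exact ⟨g, g.2, h⟩
  · rintro ⟨g, hg, h⟩
    exact ⟨⟨g, hg⟩, h⟩

variable [Finite H] [IsCancelSMul H (OddSphere n)]

theorem exists_eq_of_mem_atlas
    {c : OpenPartialHomeomorph (MulAction.orbitRel.Quotient H (OddSphere n))
    (EuclideanSpace ℝ (Fin (2 * n + 1)))}
    (hc : c ∈ atlas (EuclideanSpace ℝ (Fin (2 * n + 1)))
      (MulAction.orbitRel.Quotient H (OddSphere n))) :
    ∃ (ℓ : OpenPartialHomeomorph (MulAction.orbitRel.Quotient H (OddSphere n)) (OddSphere n))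
      (z : OddSphere n), (∀ u, ℓ.symm u = toQuotient H u) ∧
      c = ℓ.trans (stereographic' (2 * n + 1) (-z)) := by
  obtain ⟨q, rfl⟩ := hc
  exact ⟨_, _, fun u => congrFun (IsLocalHomeomorph.localInverseAt_symm _ _) u, rfl⟩

theorem stereographic'_mem_maximalAtlas (v : OddSphere n) :
    stereographic' (2 * n + 1) v ∈ IsManifold.maximalAtlas (𝓡 (2 * n + 1)) ∞ (OddSphere n) :=
  IsManifold.subset_maximalAtlas ⟨v, rfl⟩

instance isManifold_quotient :
    IsManifold (𝓡 (2 * n + 1)) ∞ (MulAction.orbitRel.Quotient H (OddSphere n)) := by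
  refine isManifold_of_contDiffOn _ _ _ fun c c' hc hc' => ?_
  obtain ⟨ℓ, z, hℓ, rfl⟩ := exists_eq_of_mem_atlas hc
  obtain ⟨ℓ', z', hℓ', rfl⟩ := exists_eq_of_mem_atlas hc'
  rintro x ⟨hx, -⟩
  refine ContDiffAt.contDiffWithinAt ?_
  replace hx : x ∈ ((ℓ.trans (stereographic' (2 * n + 1) (-z))).symm.trans
      (ℓ'.trans (stereographic' (2 * n + 1) (-z')))).source := hx
  set φ := stereographic' (2 * n + 1) (-z)
  set φ' := stereographic' (2 * n + 1) (-z')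
  obtain ⟨⟨hx1, hx2⟩, hx3, hx4⟩ := hx
  set w := φ.symm x with hw
  have hx2 : w ∈ ℓ.target := hx2
  have hx3 : ℓ.symm w ∈ ℓ'.source := hx3
  have hx4 : ℓ' (ℓ.symm w) ∈ φ'.source := hx4
  rw [hℓ] at hx3 hx4
  have h1 : toQuotient H (ℓ' (toQuotient H w)) = toQuotient H w := by
    rw [← hℓ' (ℓ' _), ℓ'.left_inv hx3]
  obtain ⟨g, hg, hgw⟩ := toQuotient_eq.mp h1
  -- A local inverse sends the class of `w` to some translate `g • w`, and by openness of its target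
  -- the same `g` works near `w`. So the transition is a rotation read in stereographic charts.
  have hloc : ∀ᶠ u in 𝓝 w, ℓ' (toQuotient H u) = g • u := by
    have hc : ContinuousAt (fun u : OddSphere n => g • u) w :=
      (continuous_const_smul g).continuousAt
    have hmem : g • w ∈ ℓ'.target := by
      rw [hgw]
      exact ℓ'.map_source hx3
    filter_upwards [hc.preimage_mem_nhds (ℓ'.open_target.mem_nhds hmem)] with u hu
    have h2 : toQuotient H u = toQuotient H (g • u) :=
      (toQuotient_eq.mpr ⟨g, hg, rfl⟩).symm
    rw [h2, ← hℓ', ℓ'.right_inv hu]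
  have hφ : ContMDiffAt (𝓡 (2 * n + 1)) (𝓡 (2 * n + 1)) ∞ φ.symm x :=
    contMDiffAt_symm_of_mem_maximalAtlas (stereographic'_mem_maximalAtlas _) hx1
  have hφ' : ContMDiffAt (𝓡 (2 * n + 1)) (𝓡 (2 * n + 1)) ∞ φ' (g • w) :=
    contMDiffAt_of_mem_maximalAtlas (stereographic'_mem_maximalAtlas _) (hgw ▸ hx4)
  have hcomp : ContMDiffAt (𝓡 (2 * n + 1)) (𝓡 (2 * n + 1)) ∞ (fun y => φ' (g • φ.symm y)) x :=
    ContMDiffAt.comp x hφ' (ContMDiffAt.comp x (contMDiff_smul_sphere g w) hφ)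
  refine (contMDiffAt_iff_contDiffAt.mp hcomp).congr_of_eventuallyEq ?_
  filter_upwards [hφ.continuousAt.eventually hloc] with y hy
  change φ' (ℓ' (ℓ.symm (φ.symm y))) = _
  rw [hℓ, hy]

/-- The quotients by two equal subgroups are diffeomorphic. -/
theorem exists_diffeomorph_of_eq {H' : Subgroup (Torus n)} [Finite H']
    [IsCancelSMul H' (OddSphere n)] (h : H = H') :
    ∃ Φ : Diffeomorph (𝓡 (2 * n + 1)) (𝓡 (2 * n + 1)) (MulAction.orbitRel.Quotient H (OddSphere n))
      (MulAction.orbitRel.Quotient H' (OddSphere n)) ∞,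
      ∀ z, Φ (toQuotient H z) = toQuotient H' z := by
  subst h
  exact ⟨Diffeomorph.refl _ _ _, fun _ => rfl⟩

end Quotient

namespace LensCharacteristic.Resolution

variable {ξ : LensCharacteristic n} (R : ξ.Resolution)

theorem base_sphere_mem_polytope (z : OddSphere n) : R.boundaryFrame.base z ∈ R.polytope ∧
    R.level (R.boundaryFrame.base z) = R.bound := by
  have h : R.level (R.boundaryFrame.base z) = R.bound := by
    rw [R.level_base_boundaryFrame, norm_eq_of_mem_sphere z, one_pow, mul_one]
  refine ⟨R.mem_polytope_of_level_eq (fun j => ?_) h, h⟩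
  have h1 := R.boundaryFrame.height_base z j
  simp only [Facet.height, Frame.row, boundaryFrame, Pi.zero_apply, sub_zero] at h1
  change 0 ≤ pairing (ξ.vec j) (R.boundaryFrame.base z)
  unfold boundaryFrame
  rw [h1]
  positivity

theorem sphere_mem_domain (z : OddSphere n) :
    (z : EuclideanSpace ℂ (Fin (n + 1))) ∈ R.domain R.boundaryFrame :=
  R.mem_cell_boundaryFrame (R.base_sphere_mem_polytope z).1 (R.base_sphere_mem_polytope z).2

theorem param_sphere_eq {z w : OddSphere n} :
    R.param R.boundaryFrame z = R.param R.boundaryFrame w ↔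
      toQuotient ξ.group z = toQuotient ξ.group w := by
  rw [R.param_eq_param_iff (R.sphere_mem_domain z) (R.base_sphere_mem_polytope z).1
    (R.base_sphere_mem_polytope w).1, eq_comm (a := toQuotient _ _), toQuotient_eq]
  refine exists_congr fun g => and_congr Iff.rfl ⟨fun h => Subtype.ext h.symm, fun h => ?_⟩
  rw [← h]
  rfl

variable {H : Subgroup (Torus n)} (hH : H = ξ.group)

/-- The lens space as the boundary of the filling. -/
def ofQuotient : MulAction.orbitRel.Quotient H (OddSphere n) → R.Filling :=
  Quotient.lift (fun z : OddSphere n => R.param R.boundaryFrame z) fun z w h => by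
    subst hH
    exact R.param_sphere_eq.mpr (Quotient.sound h)

theorem ofQuotient_toQuotient (z : OddSphere n) :
    R.ofQuotient hH (toQuotient H z) = R.param R.boundaryFrame z := rfl

theorem continuous_ofQuotient : Continuous (R.ofQuotient hH) := by
  refine Continuous.quotient_lift ?_ _
  exact R.isPatch_boundaryFrame.continuousOn_param.comp_continuous continuous_subtype_val
    fun z => ⟨R.sphere_mem_domain z, Metric.sphere_subset_closedBall z.2⟩

theorem isEmbedding_ofQuotient : Topology.IsEmbedding (R.ofQuotient hH) := by
  refine ((R.continuous_ofQuotient hH).isClosedEmbedding fun x y h => ?_).isEmbedding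
  obtain ⟨z, rfl⟩ := toQuotient_surjective x
  obtain ⟨w, rfl⟩ := toQuotient_surjective y
  subst hH
  exact R.param_sphere_eq.mp h

theorem range_ofQuotient :
    Set.range (R.ofQuotient hH) = (𝓡∂ (2 * n + 2)).boundary R.Filling := by
  ext m
  rw [mem_boundary_iff]
  constructor
  · rintro ⟨x, rfl⟩
    obtain ⟨z, rfl⟩ := toQuotient_surjective x
    rw [R.ofQuotient_toQuotient, R.moment_param (R.base_sphere_mem_polytope z).1]
    exact (R.base_sphere_mem_polytope z).2
  · intro h
    obtain ⟨w, hw, hb, rfl⟩ := R.exists_param_eq R.boundaryFrame m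
      (R.mem_cell_boundaryFrame (R.moment m).2 h)
    rw [← hb, R.level_base_boundaryFrame] at h
    have h1 : ‖w‖ ^ 2 = 1 := by
      have := R.bound_pos.ne'
      field_simp at h
      exact h
    have h2 : ‖w‖ = 1 := (pow_eq_one_iff_of_nonneg (norm_nonneg w) two_ne_zero).mp h1
    exact ⟨toQuotient H ⟨w, mem_sphere_zero_iff_norm.mpr h2⟩, rfl⟩

variable [Finite H] [IsCancelSMul H (OddSphere n)]

/-- Stereographic coordinates on the lens space and collar coordinates with the same pole on the
filling turn the map into $x\mapsto(0,x)$; see `splitHead_collar`. -/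
theorem isImmersionAt_ofQuotient (q : MulAction.orbitRel.Quotient H (OddSphere n)) :
    Manifold.IsImmersionAtOfComplement ℝ (𝓡 (2 * n + 1)) (𝓡∂ (2 * n + 2)) ∞
      (R.ofQuotient hH) q := by
  obtain ⟨ℓ, z, hℓ, hc⟩ := exists_eq_of_mem_atlas
    (chart_mem_atlas (EuclideanSpace ℝ (Fin (2 * n + 1))) q)
  have hq := mem_chart_source (EuclideanSpace ℝ (Fin (2 * n + 1))) q
  have hmax := IsManifold.chart_mem_maximalAtlas (I := 𝓡 (2 * n + 1)) (n := ∞) q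
  rw [hc] at hq hmax
  obtain ⟨hq1, hq2⟩ := hq
  have hq2 : ℓ q ∈ (stereographic' (2 * n + 1) (-z)).source := hq2
  have hmk : ∀ y ∈ ℓ.source, toQuotient H (ℓ y) = y := fun y hy => by rw [← hℓ, ℓ.left_inv hy]
  let ι : OddSphere n → Ball n := fun u => ⟨u, Metric.sphere_subset_closedBall u.2⟩
  have hι : Continuous ι := continuous_subtype_val.subtype_mk _
  obtain ⟨s, hs, hus⟩ := R.isPatch_boundaryFrame.exists_section (z := ι (ℓ q))
    (R.sphere_mem_domain (ℓ q))
  let U := ℓ.source ∩ ℓ ⁻¹' (ι ⁻¹' s.target)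
  have hU : IsOpen U := ℓ.isOpen_inter_preimage (s.open_target.preimage hι)
  have hsrc : ∀ u ∈ (stereographic' (2 * n + 1) (-z)).source,
      ι u ∈ (HalfChart.outer (-z)).toBall.source := by
    intro u hu
    rw [stereographic'_source] at hu
    change innerSL ℝ ((-z : OddSphere n) : EuclideanSpace ℂ (Fin (n + 1)))
      (u : EuclideanSpace ℂ (Fin (n + 1))) < ‖(u : EuclideanSpace ℂ (Fin (n + 1)))‖
    rw [norm_eq_of_mem_sphere u]
    exact (inner_lt_one_iff_real_of_norm_eq_one (norm_eq_of_mem_sphere (-z))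
      (norm_eq_of_mem_sphere u)).mpr fun h => hu (Subtype.ext h.symm)
  refine Manifold.IsImmersionAtOfComplement.mk_of_continuousAt
    (R.continuous_ofQuotient hH).continuousAt
    ((ContinuousLinearEquiv.prodComm ℝ _ _).trans (splitHead (2 * n + 1)).symm)
    ((ℓ.trans (stereographic' (2 * n + 1) (-z))).restr U)
    (s.trans (HalfChart.outer (-z)).toBall) ?_ ?_
    (restr_mem_maximalAtlas (contDiffGroupoid ∞ (𝓡 (2 * n + 1))) hmax hU)
    (mem_maximalAtlas R.isPatch_boundaryFrame hs _) ?_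
  · refine ⟨⟨hq1, hq2⟩, ?_⟩
    rw [hU.interior_eq]
    exact ⟨hq1, hus⟩
  · have h1 : R.ofQuotient hH q = R.param R.boundaryFrame (ι (ℓ q)) := by
      conv_lhs => rw [← hmk q hq1]
      rfl
    obtain ⟨h2, h3⟩ := hs.mem_source hus
    rw [h1]
    refine ⟨h2, ?_⟩
    change s (R.param R.boundaryFrame (ι (ℓ q))) ∈ (HalfChart.outer (-z)).toBall.source
    rw [h3]
    exact hsrc _ hq2
  · intro x hx
    set c := (ℓ.trans (stereographic' (2 * n + 1) (-z))).restr U with hcdef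
    have hx' : x ∈ c.target := by simpa using hx
    have hy := c.map_target hx'
    have hyx := c.right_inv hx'
    set y := c.symm x with hydef
    obtain ⟨⟨hy1, hy2⟩, hyU⟩ := hy
    rw [hU.interior_eq] at hyU
    have hfy : R.ofQuotient hH y = R.param R.boundaryFrame (ι (ℓ y)) := by
      conv_lhs => rw [← hmk y hy1]
      rfl
    have h3 := (hs.mem_source hyU.2).2
    change ((HalfChart.outer (-z)).toBall (s (R.ofQuotient hH y))).1 =
      (splitHead (2 * n + 1)).symm (0, x)
    rw [hfy, h3, HalfChart.val_toBall (z := ι (ℓ y)) _ (hsrc _ hy2),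
      ContinuousLinearEquiv.eq_symm_apply]
    refine (splitHead_collar (-z) (ℓ y)).trans ?_
    rw [← hyx]
    rfl

theorem isSmoothEmbedding_ofQuotient :
    Manifold.IsSmoothEmbedding (𝓡 (2 * n + 1)) (𝓡∂ (2 * n + 2)) ∞ (R.ofQuotient hH) where
  isImmersion := Manifold.IsImmersionOfComplement.isImmersion (F := ℝ)
    (R.isImmersionAt_ofQuotient hH)
  isEmbedding := R.isEmbedding_ofQuotient hH

end LensCharacteristic.Resolution

/-- A quotient of the sphere by the group of a hyper characteristic function is equivariantly a
boundary, for every action of the torus that is induced by the action on the sphere. -/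
theorem LensCharacteristic.isEquivariantBoundary (ξ : LensCharacteristic n) {H : Subgroup (Torus n)}
    (hH : H = ξ.group) [Finite H] [IsCancelSMul H (OddSphere n)]
    [MulAction (Torus n) (MulAction.orbitRel.Quotient H (OddSphere n))] (τ : Torus n →* Torus n)
    (hτ : ∀ k, ContMDiff (torusModel n) 𝓘(ℝ, ℂ) ∞ fun t => ((τ t k : Circle) : ℂ))
    (hact : ∀ t z, ∃ s, torusHom ξ.vec s = τ t ∧ t • toQuotient H z = toQuotient H (s • z)) :
    IsEquivariantBoundary n (MulAction.orbitRel.Quotient H (OddSphere n)) := by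
  obtain ⟨R⟩ := ξ.nonempty_resolution
  have key : ∀ (t s : Torus n) (z : OddSphere n), torusHom ξ.vec s = τ t →
      R.param R.boundaryFrame (rotate s z) = τ t • R.param R.boundaryFrame z := by
    intro t s z h
    rw [← h]
    exact (R.torusHom_smul_param s (R.sphere_mem_domain z) (R.base_sphere_mem_polytope z).1).symm
  -- The torus acts on the filling through `τ`, which is later taken to be the identity for a
  -- generalized lens space and $\Lambda_\xi$ for a classical one.
  let act : MulAction (Torus n) R.Filling := MulAction.compHom R.Filling τ
  refine ⟨R.Filling, inferInstance, inferInstance, act, inferInstance, inferInstance, inferInstance,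
    R.isOrientable_filling, ⟨Resolution.contMDiff_smul_filling hτ⟩, R.ofQuotient hH,
    R.isSmoothEmbedding_ofQuotient hH, R.range_ofQuotient hH, fun t x => ?_⟩
  obtain ⟨z, rfl⟩ := toQuotient_surjective x
  obtain ⟨s, hs, hsz⟩ := hact t z
  rw [hsz, R.ofQuotient_toQuotient, R.ofQuotient_toQuotient]
  exact key t s z hs

end

end GenLens

open scoped Topology

namespace GenLens

noncomputable section

variable {n : ℕ}

/-! ### The identification space of a simplex -/

/-- The point of the sphere with nonnegative coordinates over a point of the simplex. -/
def sqrtPoint (x : stdSimplex ℝ (Fin (n + 1))) : OddSphere n :=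
  ⟨WithLp.toLp 2 fun i => ((√(x.1 i) : ℝ) : ℂ), by
    rw [mem_sphere_zero_iff_norm, EuclideanSpace.norm_eq, Real.sqrt_eq_one, ← x.2.2]
    refine Finset.sum_congr rfl fun i _ => ?_
    change ‖((√(x.1 i) : ℝ) : ℂ)‖ ^ 2 = x.1 i
    rw [Complex.norm_real, Real.norm_eq_abs, sq_abs, Real.sq_sqrt (x.2.1 i)]⟩

theorem sqrtPoint_apply (x : stdSimplex ℝ (Fin (n + 1))) (i : Fin (n + 1)) :
    (sqrtPoint x).1 i = ((√(x.1 i) : ℝ) : ℂ) := rfl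

theorem continuous_smul_sqrtPoint :
    Continuous fun a : Torus n × stdSimplex ℝ (Fin (n + 1)) => a.1 • sqrtPoint a.2 := by
  refine Continuous.subtype_mk ((PiLp.continuous_toLp 2 _).comp (continuous_pi fun i => ?_)) _
  exact (continuous_subtype_val.comp ((continuous_apply i).comp continuous_fst)).mul
    (Complex.continuous_ofReal.comp (Real.continuous_sqrt.comp
      ((continuous_apply i).comp (continuous_subtype_val.comp continuous_snd))))

namespace LensCharacteristic

variable (ξ : LensCharacteristic n)

/-- The real span is the image of the coordinate subspace of the vanishing barycentric coordinates,
and the exponential maps that subspace onto the corresponding coordinate subtorus. -/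
theorem mem_isotropy_iff {x : stdSimplex ℝ (Fin (n + 1))} {t : Torus n} :
    t ∈ ξ.isotropy x ↔ ∃ c : Torus n, (∀ i, x.1 i ≠ 0 → c i = 1) ∧ torusHom ξ.vec c = t := by
  constructor
  · rintro ⟨v, hv, rfl⟩
    obtain ⟨a, ha, rfl⟩ : ∃ a : Fin (n + 1) → ℝ, (∀ i, x.1 i ≠ 0 → a i = 0) ∧
        Matrix.vecMul a (realMatrix ξ.vec) = v := by
      induction hv using Submodule.span_induction with
      | mem w hw =>
        obtain ⟨j, hj, rfl⟩ := hw
        refine ⟨Pi.single j 1, fun i hi => Pi.single_eq_of_ne ?_ 1, ?_⟩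
        · rintro rfl
          exact hi hj
        · rw [Matrix.single_one_vecMul]
          rfl
      | zero => exact ⟨0, fun _ _ => rfl, Matrix.zero_vecMul _⟩
      | add v w _ _ hv hw =>
        obtain ⟨a, ha, rfl⟩ := hv
        obtain ⟨b, hb, rfl⟩ := hw
        exact ⟨a + b, fun i hi => by simp [ha i hi, hb i hi], Matrix.add_vecMul _ _ _⟩
      | smul r v _ hv =>
        obtain ⟨a, ha, rfl⟩ := hv
        exact ⟨r • a, fun i hi => by simp [ha i hi], Matrix.smul_vecMul _ _ _⟩
    refine ⟨fun i => Circle.exp (((2 * Real.pi) • a) i), fun i hi => by simp [ha i hi], ?_⟩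
    rw [torusHom_exp, Matrix.smul_vecMul]
    rfl
  · rintro ⟨c, hc, rfl⟩
    let a : Fin (n + 1) → ℝ := fun j => (2 * Real.pi)⁻¹ * Complex.arg (c j)
    have ha : ∀ j, Circle.exp (((2 * Real.pi) • a) j) = c j := by
      intro j
      rw [Pi.smul_apply, smul_eq_mul, mul_inv_cancel_left₀ Real.two_pi_pos.ne', Circle.exp_arg]
    refine ⟨Matrix.vecMul a (realMatrix ξ.vec), ?_, ?_⟩
    · rw [Matrix.vecMul_eq_sum]
      refine Submodule.sum_mem _ fun j _ => ?_
      by_cases hj : x.1 j = 0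
      · exact Submodule.smul_mem _ _ (Submodule.subset_span ⟨j, hj, rfl⟩)
      · have : a j = 0 := by simp [a, hc j hj]
        rw [this, zero_smul]
        exact Submodule.zero_mem _
    · have h : c = fun j => Circle.exp (((2 * Real.pi) • a) j) := funext fun j => (ha j).symm
      conv_lhs => rw [h]
      rw [torusHom_exp, Matrix.smul_vecMul]
      rfl

theorem toLens_eq {z w : OddSphere n} : ξ.toLens z = ξ.toLens w ↔ ∃ g ∈ ξ.group, g • w = z :=
  toQuotient_eq (H := ξ.group)

/-- Moduli recover the point of the simplex, and phases are visible only at nonzero coordinates; the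
isotropy group accounts for the rest. -/
theorem toLens_smul_sqrtPoint_eq {a b : Torus n} {x y : stdSimplex ℝ (Fin (n + 1))} :
    ξ.toLens (a • sqrtPoint x) = ξ.toLens (b • sqrtPoint y) ↔
      x = y ∧ (torusHom ξ.vec a)⁻¹ * torusHom ξ.vec b ∈ ξ.isotropy x := by
  rw [toLens_eq, mem_isotropy_iff]
  constructor
  · rintro ⟨g, hg, h⟩
    have hi : ∀ i, (g i : ℂ) * ((b i : ℂ) * ((√(y.1 i) : ℝ) : ℂ)) =
        (a i : ℂ) * ((√(x.1 i) : ℝ) : ℂ) := fun i => congrArg (fun u : OddSphere n => u.1 i) h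
    have hxy : x = y := by
      apply Subtype.ext
      funext i
      have h1 := congrArg norm (hi i)
      simp only [norm_mul, Circle.norm_coe, one_mul, Complex.norm_real, Real.norm_eq_abs,
        abs_of_nonneg (Real.sqrt_nonneg _)] at h1
      exact ((Real.sqrt_inj (y.2.1 i) (x.2.1 i)).mp h1).symm
    subst hxy
    refine ⟨rfl, g * b * a⁻¹, fun i hi0 => ?_, ?_⟩
    · have h0 : ((√(x.1 i) : ℝ) : ℂ) ≠ 0 := by
        exact_mod_cast (Real.sqrt_pos.mpr (lt_of_le_of_ne (x.2.1 i) (Ne.symm hi0))).ne'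
      have h2 := hi i
      rw [← mul_assoc] at h2
      have h3 : g i * b i = a i := Circle.ext (by
        rw [Circle.coe_mul]
        exact mul_right_cancel₀ h0 h2)
      change g i * b i * (a i)⁻¹ = 1
      rw [h3, mul_inv_cancel]
    · have hg1 : torusHom ξ.vec g = 1 := hg
      rw [map_mul, map_mul, hg1, one_mul, map_inv, mul_comm]
  · rintro ⟨rfl, c, hc, h⟩
    refine ⟨a * b⁻¹ * c, ?_, ?_⟩
    · change torusHom ξ.vec (a * b⁻¹ * c) = 1
      rw [map_mul, map_mul, map_inv, h, mul_mul_mul_comm, mul_inv_cancel, inv_mul_cancel, mul_one]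
    · apply Subtype.ext
      ext i
      rw [smul_coord, smul_coord, smul_coord, sqrtPoint_apply]
      by_cases hi : x.1 i = 0
      · simp [hi]
      · change ((a i * (b i)⁻¹ * c i : Circle) : ℂ) * _ = _
        rw [hc i hi, mul_one, ← mul_assoc, ← Circle.coe_mul, inv_mul_cancel_right]

/-- The map from the identification space to the lens space. -/
def identificationMap : ξ.IdentificationSpace → ξ.LensSpace :=
  Quotient.lift (fun a => a.1 • ξ.toLens (sqrtPoint a.2)) (by
    rintro ⟨t, x⟩ ⟨s, y⟩ h
    obtain ⟨a, rfl⟩ := ξ.torusHom_surjective t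
    obtain ⟨b, rfl⟩ := ξ.torusHom_surjective s
    change torusHom ξ.vec a • _ = torusHom ξ.vec b • _
    rw [torusHom_smul_toLens, torusHom_smul_toLens]
    exact ξ.toLens_smul_sqrtPoint_eq.mpr h)

theorem continuous_toLens : Continuous ξ.toLens := continuous_quotient_mk'

/-- The action on the lens space is defined by a set-theoretic section of $\Lambda_\xi$. Continuity
is therefore tested after composition with $\Lambda_\xi\times\mathrm{id}$, a quotient map by
compactness, where the formula becomes $(t,x)\mapsto[t\sqrt x]$. -/
theorem continuous_identificationMap : Continuous ξ.identificationMap := by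
  refine Continuous.quotient_lift ?_ _
  let Λ : Torus n × stdSimplex ℝ (Fin (n + 1)) → Torus n × stdSimplex ℝ (Fin (n + 1)) :=
    Prod.map (torusHom ξ.vec) id
  have hΛ : Continuous Λ := (continuous_torusHom _).prodMap continuous_id
  have hq : Topology.IsQuotientMap Λ :=
    hΛ.isClosedMap.isQuotientMap hΛ (ξ.torusHom_surjective.prodMap Function.surjective_id)
  rw [hq.continuous_iff]
  refine (ξ.continuous_toLens.comp continuous_smul_sqrtPoint).congr fun a => ?_
  exact (ξ.torusHom_smul_toLens a.1 (sqrtPoint a.2)).symm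

theorem bijective_identificationMap : Function.Bijective ξ.identificationMap := by
  constructor
  · intro u v h
    induction u using Quotient.inductionOn with
    | h a =>
      induction v using Quotient.inductionOn with
      | h b =>
        obtain ⟨t, x⟩ := a
        obtain ⟨s, y⟩ := b
        obtain ⟨a, rfl⟩ := ξ.torusHom_surjective t
        obtain ⟨b, rfl⟩ := ξ.torusHom_surjective s
        change torusHom ξ.vec a • _ = torusHom ξ.vec b • _ at h
        rw [torusHom_smul_toLens, torusHom_smul_toLens] at h
        exact Quotient.sound (ξ.toLens_smul_sqrtPoint_eq.mp h)
  · intro q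
    obtain ⟨z, rfl⟩ : ∃ z, ξ.toLens z = q := Quotient.mk''_surjective q
    have hz : ∑ i, ‖z.1 i‖ ^ 2 = 1 := by
      rw [← EuclideanSpace.norm_sq_eq, norm_eq_of_mem_sphere z, one_pow]
    refine ⟨Quotient.mk _ (torusHom ξ.vec (phase z.1),
      ⟨fun i => ‖z.1 i‖ ^ 2, fun i => by positivity, hz⟩), ?_⟩
    change torusHom ξ.vec (phase z.1) • ξ.toLens _ = _
    rw [torusHom_smul_toLens]
    congr 1
    apply Subtype.ext
    ext i
    rw [smul_coord, sqrtPoint_apply]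
    change _ * ((√(‖z.1 i‖ ^ 2) : ℝ) : ℂ) = _
    rw [Real.sqrt_sq (norm_nonneg _), phase_mul_norm]

instance : CompactSpace ξ.IdentificationSpace :=
  inferInstanceAs (CompactSpace (Quotient ξ.identification))

instance : T2Space ξ.LensSpace :=
  inferInstanceAs (T2Space (MulAction.orbitRel.Quotient ξ.group (OddSphere n)))

theorem exists_homeomorph_identificationSpace : ∃ e : ξ.LensSpace ≃ₜ ξ.IdentificationSpace,
    ∀ (t : Torus n) (x : ξ.LensSpace), e (t • x) = t • e x := by
  let e := Continuous.homeoOfEquivCompactToT2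
    (f := Equiv.ofBijective _ ξ.bijective_identificationMap) ξ.continuous_identificationMap
  refine ⟨e.symm, fun t x => ?_⟩
  obtain ⟨u, rfl⟩ := e.surjective x
  rw [e.symm_apply_apply, Homeomorph.symm_apply_eq]
  change t • ξ.identificationMap u = ξ.identificationMap (t • u)
  induction u using Quotient.inductionOn with
  | h a => exact smul_smul t a.1 _

theorem isEquivariantBoundary_lensSpace : IsEquivariantBoundary n ξ.LensSpace := by
  let : MulAction (Torus n) (MulAction.orbitRel.Quotient ξ.group (OddSphere n)) :=
    inferInstanceAs (MulAction (Torus n) ξ.LensSpace)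
  refine ξ.isEquivariantBoundary (H := ξ.group) rfl (MonoidHom.id _) contMDiff_torus_coord
    fun t z => ?_
  obtain ⟨s, rfl⟩ := ξ.torusHom_surjective t
  exact ⟨s, rfl, ξ.torusHom_smul_toLens s z⟩

end LensCharacteristic

/-! ### Classical lens spaces as generalized lens spaces -/

theorem isCompl_span_singleton {M : Type*} [AddCommGroup M] {S : Submodule ℤ M} (f : M →ₗ[ℤ] ℤ)
    {u : M} (hu : f u = 1) (hS : ∀ x, x ∈ S ↔ f x = 0) : IsCompl S (Submodule.span ℤ {u}) := by
  refine ⟨Submodule.disjoint_def.mpr fun x hx hxu => ?_, codisjoint_iff.mpr ?_⟩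
  · obtain ⟨c, rfl⟩ := Submodule.mem_span_singleton.mp hxu
    have h := (hS _).mp hx
    rw [map_smul, hu, smul_eq_mul, mul_one] at h
    rw [h, zero_smul]
  · rw [eq_top_iff]
    intro x _
    refine Submodule.mem_sup.mpr ⟨x - f x • u, (hS _).mpr ?_, f x • u,
      Submodule.smul_mem _ _ (Submodule.mem_span_singleton_self u), sub_add_cancel _ _⟩
    rw [map_sub, map_smul, hu, smul_eq_mul, mul_one, sub_self]

namespace LensParameters

variable (L : LensParameters n)

/-- The vectors `(p, -q₁, …, -qₙ), e₁, …, eₙ`. -/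
def vec : Fin (n + 1) → Fin (n + 1) → ℤ :=
  Fin.cons (Fin.cons (L.p : ℤ) fun i => -L.q i) fun i => Pi.single i.succ 1

theorem sum_vec_zero (a : Fin (n + 1) → ℤ) : (∑ j, a j • L.vec j) 0 = a 0 * L.p := by
  simp [Fin.sum_univ_succ, vec]

theorem sum_vec_succ (a : Fin (n + 1) → ℤ) (i : Fin n) :
    (∑ j, a j • L.vec j) i.succ = a i.succ - a 0 * L.q i := by
  simp [Fin.sum_univ_succ, vec, Pi.single_apply, Finset.sum_apply]
  ring

theorem linearIndependent_vec : LinearIndependent ℤ L.vec := by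
  rw [Fintype.linearIndependent_iff]
  intro a ha
  have hp : (L.p : ℤ) ≠ 0 := by
    have := L.one_lt
    omega
  have h0 : a 0 = 0 := by
    have := L.sum_vec_zero a
    rw [ha] at this
    exact (mul_eq_zero.mp this.symm).resolve_right hp
  intro j
  refine Fin.cases h0 (fun i => ?_) j
  have := L.sum_vec_succ a i
  rw [ha, h0, zero_mul, sub_zero] at this
  exact this.symm

theorem mem_span_of_sum {s : Finset (Fin (n + 1))} {a : Fin (n + 1) → ℤ}
    (ha : ∀ j ∉ s, a j = 0) : ∑ j, a j • L.vec j ∈ Submodule.span ℤ (L.vec '' s) := by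
  refine Submodule.sum_mem _ fun j _ => ?_
  by_cases hj : j ∈ s
  · exact Submodule.smul_mem _ _ (Submodule.subset_span ⟨j, hj, rfl⟩)
  · rw [ha j hj, zero_smul]
    exact Submodule.zero_mem _

/-- Omitting one vector leaves a basis of the kernel of a functional: $x_0$ if the first is omitted,
$q_kx_0+px_k$ if $e_k$ is. Coprimality makes the latter onto $\mathbb Z$, so its kernel splits off.
-/
theorem exists_isCompl {s : Finset (Fin (n + 1))} {i₀ : Fin (n + 1)} (hs : ∀ j, j ∈ s ↔ j ≠ i₀) :
    ∃ W : Submodule ℤ (Fin (n + 1) → ℤ), IsCompl (Submodule.span ℤ (L.vec '' s)) W := by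
  have hrepr : ∀ (x : Fin (n + 1) → ℤ) (c : ℤ), x 0 = c * L.p →
      ∑ j, (Fin.cons c fun i => x i.succ + c * L.q i : Fin (n + 1) → ℤ) j • L.vec j = x := by
    intro x c hc
    funext j
    refine Fin.cases ?_ (fun i => ?_) j
    · rw [L.sum_vec_zero, Fin.cons_zero, hc]
    · rw [L.sum_vec_succ, Fin.cons_succ, Fin.cons_zero, add_sub_cancel_right]
  have hker : ∀ f : (Fin (n + 1) → ℤ) →ₗ[ℤ] ℤ, (∀ j, j ≠ i₀ → f (L.vec j) = 0) →
      ∀ x ∈ Submodule.span ℤ (L.vec '' s), f x = 0 := by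
    intro f hf x hx
    have : Submodule.span ℤ (L.vec '' s) ≤ LinearMap.ker f := by
      rw [Submodule.span_le]
      rintro _ ⟨j, hj, rfl⟩
      exact hf j ((hs j).mp hj)
    exact this hx
  rcases Fin.eq_zero_or_eq_succ i₀ with rfl | ⟨k, rfl⟩
  · refine ⟨_, isCompl_span_singleton (LinearMap.proj 0) (u := Pi.single 0 1) (by simp) fun x =>
      ⟨hker _ (fun j hj => ?_) x, fun hx => ?_⟩⟩
    · obtain ⟨i, rfl⟩ := Fin.exists_succ_eq.mpr hj
      simp [vec]
    · rw [← hrepr x 0 (by simpa using hx)]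
      refine L.mem_span_of_sum fun j hj => ?_
      have : j = 0 := by
        by_contra h
        exact hj ((hs j).mpr h)
      rw [this, Fin.cons_zero]
  · obtain ⟨a, b, hab⟩ := L.coprime k
    let f : (Fin (n + 1) → ℤ) →ₗ[ℤ] ℤ :=
      L.q k • LinearMap.proj 0 + (L.p : ℤ) • LinearMap.proj k.succ
    have hf : ∀ x, f x = L.q k * x 0 + L.p * x k.succ := fun x => rfl
    refine ⟨_, isCompl_span_singleton f (u := Pi.single 0 b + Pi.single k.succ a) ?_ fun x =>
      ⟨hker _ (fun j hj => ?_) x, fun hx => ?_⟩⟩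
    · rw [hf]
      simp
      linarith
    · rw [hf]
      revert hj
      refine Fin.cases (fun _ => ?_) (fun i hi => ?_) j
      · simp [vec]
        ring
      · have : k ≠ i := fun h => hi (h ▸ rfl)
        simp [vec, this]
    · rw [hf] at hx
      -- Bézout's identity $ap+bq_k=1$ shows that the coefficient of the first vector is the integer
      -- $ax_0-bx_k$.
      have hc : x 0 = (a * x 0 - b * x k.succ) * L.p := by
        linear_combination (-x 0) * hab + b * hx
      rw [← hrepr x _ hc]
      refine L.mem_span_of_sum fun j hj => ?_
      have : j = k.succ := by
        by_contra h
        exact hj ((hs j).mpr h)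
      rw [this, Fin.cons_succ]
      linear_combination (-x k.succ) * hab + a * hx

/-- The hyper characteristic function of a classical lens space. -/
def toLensCharacteristic : LensCharacteristic n where
  vec := L.vec
  isHyperCharacteristic s hs _ := by
    obtain ⟨i₀, hi₀⟩ : ∃ i₀, sᶜ = {i₀} := by
      rw [← Finset.card_eq_one, Finset.card_compl, hs, Fintype.card_fin]
      omega
    refine ⟨?_, L.exists_isCompl (i₀ := i₀) fun j => ?_⟩
    · have h := finrank_span_eq_card (L.linearIndependent_vec.comp (Subtype.val : s → _)
        Subtype.val_injective)
      have hr : Set.range (L.vec ∘ (Subtype.val : s → _)) = L.vec '' s := by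
        rw [Set.range_comp]
        simp
      rw [hr, Fintype.card_coe, hs] at h
      exact h
    · rw [← not_iff_not, ← Finset.mem_compl, hi₀, Finset.mem_singleton, not_not]
  rank_eq := by
    rw [finrank_span_eq_card L.linearIndependent_vec, Fintype.card_fin]

/-- Here $\Lambda_\xi(t)=(t_0^p,t_0^{-q_1}t_1,\dots,t_0^{-q_n}t_n)$, so a kernel element is
determined by $t_0$, which is any $p$-th root of unity. -/
theorem group_eq : L.group = L.toLensCharacteristic.group := by
  have h0 : ∀ t : Torus n, torusHom L.vec t 0 = t 0 ^ L.p := by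
    intro t
    change ∏ j, t j ^ L.vec j 0 = _
    simp [Fin.prod_univ_succ, vec]
  have hsucc : ∀ (t : Torus n) (i : Fin n),
      torusHom L.vec t i.succ = (t 0 ^ L.q i)⁻¹ * t i.succ := by
    intro t i
    change ∏ j, t j ^ L.vec j i.succ = _
    rw [Fin.prod_univ_succ, Finset.prod_eq_single i]
    · simp [vec]
    · intro j _ hj
      have : i ≠ j := hj.symm
      simp [vec, this]
    · simp
  ext t
  constructor
  · rintro ⟨g, hg, rfl⟩
    change torusHom L.vec _ = 1
    funext j
    refine Fin.cases ?_ (fun i => ?_) j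
    · rw [h0, Fin.cons_zero, hg]
      rfl
    · rw [hsucc, Fin.cons_zero, Fin.cons_succ, inv_mul_cancel]
      rfl
  · intro ht
    have ht : torusHom L.vec t = 1 := ht
    refine ⟨t 0, ?_, funext fun j => ?_⟩
    · rw [← h0, ht]
      rfl
    · refine Fin.cases rfl (fun i => ?_) j
      have h := congrFun ht i.succ
      rw [hsucc, Pi.one_apply, inv_mul_eq_one] at h
      rw [Fin.cons_succ, h]

theorem exists_diffeomorph : ∃ (ξ : LensCharacteristic n)
    (Φ : Diffeomorph (𝓡 (2 * n + 1)) (𝓡 (2 * n + 1)) L.LensSpace ξ.LensSpace ∞),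
    ∀ (t : Torus n) (x : L.LensSpace), Φ (t • x) = torusHom ξ.vec t • Φ x := by
  obtain ⟨Φ, hΦ⟩ := exists_diffeomorph_of_eq L.group_eq
  refine ⟨L.toLensCharacteristic, Φ, fun t x => ?_⟩
  obtain ⟨z, rfl⟩ : ∃ z, toQuotient L.group z = x := Quotient.mk''_surjective x
  have h := L.toLensCharacteristic.torusHom_smul_toLens t z
  refine (hΦ (t • z)).trans (h.symm.trans ?_)
  exact congrArg _ (hΦ z).symm

theorem isEquivariantBoundary_lensSpace : IsEquivariantBoundary n L.LensSpace := by
  let : MulAction (Torus n) (MulAction.orbitRel.Quotient L.group (OddSphere n)) :=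
    quotientAction L.group
  exact L.toLensCharacteristic.isEquivariantBoundary L.group_eq (torusHom L.vec)
    (contMDiff_torusHom_coord L.vec) fun t z => ⟨t, rfl, rfl⟩

end LensParameters

end

end GenLens

theorem corollary3p7 (n : ℕ) (hn : 1 ≤ n) :
    (∀ ξ : GenLens.LensCharacteristic n,
      IsManifold (𝓡 (2 * n + 1)) ∞ ξ.LensSpace ∧
      (∃ e : ξ.LensSpace ≃ₜ ξ.IdentificationSpace,
        ∀ (t : GenLens.Torus n) (x : ξ.LensSpace), e (t • x) = t • e x) ∧
      GenLens.IsEquivariantBoundary n ξ.LensSpace) ∧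
    (∀ L : GenLens.LensParameters n,
      IsManifold (𝓡 (2 * n + 1)) ∞ L.LensSpace ∧
      (∃ (ξ : GenLens.LensCharacteristic n)
        (Φ : Diffeomorph (𝓡 (2 * n + 1)) (𝓡 (2 * n + 1)) L.LensSpace ξ.LensSpace ∞),
        ∀ (t : GenLens.Torus n) (x : L.LensSpace),
          Φ (t • x) = GenLens.torusHom ξ.vec t • Φ x) ∧
      GenLens.IsEquivariantBoundary n L.LensSpace) := by
  refine ⟨fun ξ => ⟨?_, ξ.exists_homeomorph_identificationSpace,
    ξ.isEquivariantBoundary_lensSpace⟩, fun L => ⟨?_, L.exists_diffeomorph,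
    L.isEquivariantBoundary_lensSpace⟩⟩
  · exact GenLens.isManifold_quotient (H := ξ.group)
  · exact GenLens.isManifold_quotient (H := L.group)
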